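/- **Setting.** Let $(x_{i1},x_{i2})$, $i=1,2,\dots$, be i.i.d. with a density $q$ on $(0,1)^2$ that lies between two positive constants; let $q_1,q_2$ be its marginal densities. Observe $y_i=f_1(x_{i1})+f_2(x_{i2})+\varepsilon_i$, $i\le n$, where $E[f_j(x_{ij})]=0$ and, given the design, the errors $\varepsilon_i$ are independent with mean $0$ and variance $\sigma^2(x_{i1},x_{i2})$, the function $\sigma^2$ lying between two positive constants on $(0,1)^2$. Fix $p\ge 0$ and $m\ge 1$. Let $B(x)=(B_{-p+1}(x),\dots,B_{K_n}(x))'$ be the vector of the B-spline basis functions of degree $p$ with the equidistant knots $\kappa_k=k/K_n$ ($k\in\mathbb Z$), where $K_n\to\infty$ and $K_n=O(n^\gamma)$ for some $0<\gamma<1/2$. Let $Q_m=D_m'D_m$ with $D_m$ the matrix of $m$-th order differences, let $X_j$ be the $n\times(K_n+p)$ matrix with rows $B(x_{ij})'$, let $\lambda_{jn}\ge 0$ be smoothing parameters and $\Lambda_j=X_j'X_j+\lambda_{jn}Q_m$. Given $b_2^{(0)}$, which may depend on the design only, the backfitting iterates are $b_1^{(\ell)}=\Lambda_1^{-1}X_1'(y-X_2b_2^{(\ell-1)})$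 and $b_2^{(\ell)}=\Lambda_2^{-1}X_2'(y-X_1b_1^{(\ell)})$. Put $\hat f_j(x_j)=B(x_j)'\hat b_j$ with $\hat b_j=\lim_{\ell\to\infty}b_j^{(\ell)}$. The initial value is assumed to satisfy $n^{-1}\sum_{i\le n}B(x_{i2})'b_2^{(0)}=O_P(K_n^{-1})$; for instance $b_2^{(0)}=0$. Let $b_j^*$ be such that $B(\cdot)'b_j^*$ is a best $L_\infty(0,1)$ approximation of $f_j$ among the splines $B(\cdot)'b$. Let $G_j=\big(\int_0^1B_iB_kq_j\big)_{ik}$ and $\Sigma_j=\big(\int_0^1\!\int_0^1\sigma^2(x_1,x_2)B_i(x_j)B_k(x_j)q(x_1,x_2)\,dx_1dx_2\big)_{ik}$. Below, $E$, $V$ and $\mathrm{Cov}$ are taken with respect to the conditional law of the errors given the design, and $O_P$, $o_P$ refer to the law of the design. **Theorem 1.** Suppose that $f_1,f_2\in C^{p+1}[0,1]$ and $\lambda_{jn}=o(nK_n^{-1})$ for $j=1,2$. Then $G_1,G_2$ are invertible for all large $n$. With probability tending to one, $\Lambda_1$ and $\Lambda_2$ are invertible, the backfitting iterates converge for every response vector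 and every initial value, and $\hat f_j(x_j)$ has a finite conditional second moment. For every fixed $(x_1,x_2)\in(0,1)^2$, as $n\to\infty$, $$E[\hat f_j(x_j)]=f_j(x_j)+b_{j,\lambda}(x_j)+O_P(K_n^{-1})+o_P(\lambda_{jn}K_nn^{-1}),\qquad V[\hat f_j(x_j)]=V_j(x_j)(1+o_P(1)),\qquad j=1,2,$$ $$\mathrm{Cov}(\hat f_1(x_1),\hat f_2(x_2))=O_P(n^{-1}),$$ where $$b_{j,\lambda}(x_j)=-\frac{\lambda_{jn}}n B(x_j)'G_j^{-1}Q_mb_j^*,\qquad V_j(x_j)=\frac1nB(x_j)'G_j^{-1}\Sigma_jG_j^{-1}B(x_j).$$ -/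

import Mathlib

open MeasureTheory ProbabilityTheory Filter Topology Set Asymptotics
open scoped ENNReal Matrix

noncomputable section

namespace AddSpline

/-! ### Stochastic order symbols -/

/-- `Z n = O_P(a n)` as `n → ∞`. -/
def IsBigOP {Ω : Type*} [MeasurableSpace Ω] (P : Measure Ω) (Z : ℕ → Ω → ℝ) (a : ℕ → ℝ) : Prop :=
  ∀ δ : ℝ, 0 < δ → ∃ M : ℝ, ∀ᶠ n in atTop, P {ω | M * |a n| < |Z n ω|} ≤ ENNReal.ofReal δ

/-- `Z n = o_P(a n)` as `n → ∞`. -/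
def IsLittleOP {Ω : Type*} [MeasurableSpace Ω] (P : Measure Ω) (Z : ℕ → Ω → ℝ) (a : ℕ → ℝ) :
    Prop :=
  ∀ η : ℝ, 0 < η → Tendsto (fun n => P {ω | η * |a n| < |Z n ω|}) atTop (𝓝 0)

/-! ### B-splines and the difference penalty -/

/-- The equidistant knots `κ_k = k / K`. -/
def knot (K : ℕ) (k : ℤ) : ℝ := (k : ℝ) / (K : ℝ)

/-- The B-spline basis function `B_k^{[p]}`, by the recursion of de Boor. -/
def bspline (K : ℕ) : ℕ → ℤ → ℝ → ℝ
  | 0, k, x => if knot K (k - 1) < x ∧ x ≤ knot K k then 1 else 0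
  | p + 1, k, x =>
      (x - knot K (k - 1)) / (knot K (k + p) - knot K (k - 1)) * bspline K p k x
        + (knot K (k + p + 1) - x) / (knot K (k + p + 1) - knot K k) * bspline K p (k + 1) x

/-- The vector `B(x) = (B_{-p+1}(x), …, B_K(x))`. -/
def bvec (p K : ℕ) (x : ℝ) : Fin (K + p) → ℝ :=
  fun k => bspline K p ((k : ℤ) - p + 1) x

/-- The matrix `D_m` of `m`-th order differences,
`(D_m b)_i = ∑_{l ≤ m} (-1)^{m-l} (m choose l) b_{i+l}`. -/
def diffMatrix (m N : ℕ) : Matrix (Fin (N - m)) (Fin N) ℝ :=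
  Matrix.of fun i k =>
    if (i : ℕ) ≤ k then (-1 : ℝ) ^ (m + ((k : ℕ) - i)) * (m.choose ((k : ℕ) - i) : ℝ) else 0

/-- The difference penalty `Q_m = D_m' D_m`. -/
def penalty (m N : ℕ) : Matrix (Fin N) (Fin N) ℝ :=
  (diffMatrix m N)ᵀ * diffMatrix m N

/-- `B(·)'b` is a best `L_∞` approximation of `f` on `(0,1)` by splines. -/
def IsBestApprox (p K : ℕ) (f : ℝ → ℝ) (b : Fin (K + p) → ℝ) : Prop :=
  ∀ c : Fin (K + p) → ℝ,
    (⨆ x ∈ Ioo (0 : ℝ) 1, ENNReal.ofReal |f x - bvec p K x ⬝ᵥ b|) ≤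
      ⨆ x ∈ Ioo (0 : ℝ) 1, ENNReal.ofReal |f x - bvec p K x ⬝ᵥ c|

/-! ### Penalized least squares and backfitting

The two covariates are indexed by `Fin 2`: index `0` is the first, index `1` the second. -/

/-- The `j`-th coordinate of a point of the plane. -/
def coord (j : Fin 2) (z : ℝ × ℝ) : ℝ := if j = 0 then z.1 else z.2

/-- The design matrix `X_j`, with rows `B(x_{ij})'`. -/
def designMatrix (p K : ℕ) {n : ℕ} (x : Fin n → ℝ × ℝ) (j : Fin 2) :
    Matrix (Fin n) (Fin (K + p)) ℝ :=
  Matrix.of fun i => bvec p K (coord j (x i))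

/-- `Λ_j = X_j' X_j + λ_j Q_m`. -/
def Lam (p m K : ℕ) {n : ℕ} (lam : Fin 2 → ℝ) (x : Fin n → ℝ × ℝ) (j : Fin 2) :
    Matrix (Fin (K + p)) (Fin (K + p)) ℝ :=
  (designMatrix p K x j)ᵀ * designMatrix p K x j + lam j • penalty m (K + p)

/-- One half-step of backfitting: `Λ_j⁻¹ X_j' r`, the penalized fit of a residual vector `r`. -/
def fitCoef (p m K : ℕ) {n : ℕ} (lam : Fin 2 → ℝ) (x : Fin n → ℝ × ℝ) (j : Fin 2)
    (r : Fin n → ℝ) : Fin (K + p) → ℝ :=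
  (Lam p m K lam x j)⁻¹ *ᵥ ((designMatrix p K x j)ᵀ *ᵥ r)

/-- The backfitting iterates `(b_1^{(ℓ)}, b_2^{(ℓ)})` started at `b_2^{(0)} = b0`.
The first component at stage `0` is never used. -/
def backfit (p m K : ℕ) {n : ℕ} (lam : Fin 2 → ℝ) (x : Fin n → ℝ × ℝ) (y : Fin n → ℝ)
    (b0 : Fin (K + p) → ℝ) : ℕ → (Fin (K + p) → ℝ) × (Fin (K + p) → ℝ)
  | 0 => (0, b0)
  | l + 1 =>
      let b1 := fitCoef p m K lam x 0
        (y - designMatrix p K x 1 *ᵥ (backfit p m K lam x y b0 l).2)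
      (b1, fitCoef p m K lam x 1 (y - designMatrix p K x 0 *ᵥ b1))

/-- The limit `(b̂_1, b̂_2)` of backfitting (meaningful when the iterates converge). -/
def backfitLimit (p m K : ℕ) {n : ℕ} (lam : Fin 2 → ℝ) (x : Fin n → ℝ × ℝ) (y : Fin n → ℝ)
    (b0 : Fin (K + p) → ℝ) : (Fin (K + p) → ℝ) × (Fin (K + p) → ℝ) :=
  limUnder atTop (backfit p m K lam x y b0)

/-- The backfitting penalized spline estimator `f̂_j(t) = B(t)' b̂_j`. -/
def fhat (p m K : ℕ) {n : ℕ} (lam : Fin 2 → ℝ) (x : Fin n → ℝ × ℝ) (y : Fin n → ℝ)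
    (b0 : Fin (K + p) → ℝ) (j : Fin 2) (t : ℝ) : ℝ :=
  bvec p K t ⬝ᵥ
    (if j = 0 then (backfitLimit p m K lam x y b0).1 else (backfitLimit p m K lam x y b0).2)

/-- The backfitting procedure is well posed for the design `x`: both `Λ_j` are invertible, and the
iterates converge for every response vector and every starting value. -/
def WellPosed (p m K : ℕ) {n : ℕ} (lam : Fin 2 → ℝ) (x : Fin n → ℝ × ℝ) : Prop :=
  (∀ j, IsUnit (Lam p m K lam x j).det) ∧
    ∀ (y : Fin n → ℝ) (b0 : Fin (K + p) → ℝ), ∃ b, Tendsto (backfit p m K lam x y b0) atTop (𝓝 b)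

/-- The responses `y_i = f_1(x_{i1}) + f_2(x_{i2}) + e_i`. -/
def response (f : Fin 2 → ℝ → ℝ) {n : ℕ} (x : Fin n → ℝ × ℝ) (e : Fin n → ℝ) : Fin n → ℝ :=
  fun i => f 0 (x i).1 + f 1 (x i).2 + e i

/-! ### Population quantities -/

/-- The open unit square. -/
def unitSquare : Set (ℝ × ℝ) := Ioo (0 : ℝ) 1 ×ˢ Ioo (0 : ℝ) 1

/-- The marginal density `q_j` of the joint density `q`. -/
def marginal (q : ℝ × ℝ → ℝ) (j : Fin 2) (t : ℝ) : ℝ :=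
  if j = 0 then ∫ v in (0 : ℝ)..1, q (t, v) else ∫ u in (0 : ℝ)..1, q (u, t)

/-- `G_j = (∫ B_i B_k q_j)_{ik}`. -/
def gram (p K : ℕ) (q : ℝ × ℝ → ℝ) (j : Fin 2) : Matrix (Fin (K + p)) (Fin (K + p)) ℝ :=
  Matrix.of fun i k => ∫ t in (0 : ℝ)..1, bvec p K t i * bvec p K t k * marginal q j t

/-- `Σ_j = (∫∫ σ²(u,v) B_i B_k q(u,v) du dv)_{ik}`, the splines evaluated at the `j`-th variable. -/
def sigmaMat (p K : ℕ) (q s2 : ℝ × ℝ → ℝ) (j : Fin 2) :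
    Matrix (Fin (K + p)) (Fin (K + p)) ℝ :=
  Matrix.of fun i k => ∫ u in (0 : ℝ)..1, ∫ v in (0 : ℝ)..1,
    s2 (u, v) * bvec p K (coord j (u, v)) i * bvec p K (coord j (u, v)) k * q (u, v)

/-- The leading bias `-(λ/n) B(t)' G_j⁻¹ Q_m b*`. -/
def biasLam (p m K n : ℕ) (lamj : ℝ) (q : ℝ × ℝ → ℝ) (j : Fin 2) (bstar : Fin (K + p) → ℝ)
    (t : ℝ) : ℝ :=
  -(lamj / n) * (bvec p K t ⬝ᵥ ((gram p K q j)⁻¹ *ᵥ (penalty m (K + p) *ᵥ bstar)))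

/-- The leading variance `n⁻¹ B(t)' G_j⁻¹ Σ_j G_j⁻¹ B(t)`. -/
def leadVar (p K n : ℕ) (q s2 : ℝ × ℝ → ℝ) (j : Fin 2) (t : ℝ) : ℝ :=
  (1 / (n : ℝ)) *
    (bvec p K t ⬝ᵥ
      (((gram p K q j)⁻¹ * sigmaMat p K q s2 j * (gram p K q j)⁻¹) *ᵥ bvec p K t))

/-! ### The random design and the conditional law of the errors -/

/-- The regular conditional distribution of the error sequence given the design sequence,
at the outcome `ω`. -/
def errLaw {Ω : Type*} [MeasurableSpace Ω] (P : Measure Ω) [IsFiniteMeasure P]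
    (X : ℕ → Ω → ℝ × ℝ) (ε : ℕ → Ω → ℝ) (ω : Ω) : Measure (ℕ → ℝ) :=
  condDistrib (fun ω' i => ε i ω') (fun ω' i => X i ω') P (fun i => X i ω)

/-- The observations of the bivariate additive model: an i.i.d. design with density `q` on the unit
square, and errors that, given the design, are independent and centred with
variances `σ²(x_{i1}, x_{i2})`; the components `f_j` are centred. -/
structure IsAdditiveModel {Ω : Type*} [MeasurableSpace Ω] (P : Measure Ω) [IsProbabilityMeasure P]
    (X : ℕ → Ω → ℝ × ℝ) (ε : ℕ → Ω → ℝ) (f : Fin 2 → ℝ → ℝ) (q s2 : ℝ × ℝ → ℝ) : Prop where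
  measurable_X : ∀ i, Measurable (X i)
  measurable_ε : ∀ i, Measurable (ε i)
  indep_X : iIndepFun X P
  law_X : ∀ i, P.map (X i) =
    (volume.restrict unitSquare).withDensity (fun z => ENNReal.ofReal (q z))
  indep_ε : ∀ᵐ ω ∂P, iIndepFun (fun (i : ℕ) (e : ℕ → ℝ) => e i) (errLaw P X ε ω)
  memLp_ε : ∀ᵐ ω ∂P, ∀ i, MemLp (fun e : ℕ → ℝ => e i) 2 (errLaw P X ε ω)
  mean_ε : ∀ᵐ ω ∂P, ∀ i, ∫ e : ℕ → ℝ, e i ∂(errLaw P X ε ω) = 0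
  var_ε : ∀ᵐ ω ∂P, ∀ i, Var[fun e : ℕ → ℝ => e i; errLaw P X ε ω] = s2 (X i ω)
  centred : ∀ j i, ∫ ω, f j (coord j (X i ω)) ∂P = 0

/-- A measurable function lying between two positive constants on the unit square. -/
def BddPos (g : ℝ × ℝ → ℝ) : Prop :=
  Measurable g ∧ ∃ c C : ℝ, 0 < c ∧ ∀ z ∈ unitSquare, c ≤ g z ∧ g z ≤ C

/-- The estimator `f̂_j(t)` from the first `n` observations, as a function of the errors `e`, for the
design at the outcome `ω`. -/
def estimator {Ω : Type*} (p m : ℕ) (K : ℕ → ℕ) (lam : Fin 2 → ℕ → ℝ) (f : Fin 2 → ℝ → ℝ)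
    (X : ℕ → Ω → ℝ × ℝ) (b0 : (n : ℕ) → (Fin n → ℝ × ℝ) → Fin (K n + p) → ℝ)
    (j : Fin 2) (t : ℝ) (n : ℕ) (ω : Ω) (e : ℕ → ℝ) : ℝ :=
  fhat p m (K n) (fun j => lam j n) (fun i : Fin n => X i ω)
    (response f (fun i : Fin n => X i ω) (fun i : Fin n => e i))
    (b0 n (fun i : Fin n => X i ω)) j t

end AddSpline

end

open MeasureTheory ProbabilityTheory Filter Topology Set Asymptotics
open scoped ENNReal Matrix

noncomputable section

namespace AddSpline

/-! Write A_j = Λ_j/n and H = X_1'X_2/n. Backfitting is block Gauss–Seidel for A_1 u + H v =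
X_1'y/n, H'u + A_2 v = X_2'y/n. The splines sum to one and the penalty kills constants, so (1, -1)
lies in the kernel. This is the only degeneracy: the quadratic form of the system dominates
(c/K)(|u|² + |v|²) as soon as one component is centred. For the population this holds because the
density is bounded below, so the form can be compared with a Lebesgue integral over the square,
where the cross term is a product of two means (`exists_popMat_joint_coercive`). It passes to the
sample because the moment matrices concentrate in Frobenius norm at rate n^{-1/2}, which is o(1/K)
(`exists_blockSystem`). The iteration conserves the empirical mean of the fitted second component
and contracts the increments (`BlockSystem.exists_tendsto`); the limit is the solution of the block
equations whose mean is that of the initial value.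

The estimators are then read off by duality. With w = A_1⁻¹B(x_1) one has B(x_1)'u = w·r_1 -
(H'w)·v: a univariate penalized spline fit, minus a term carried by the other component. Two facts
make this term small. First, A_1 is banded and coercive, so w is concentrated near the cell of x_1;
an energy estimate with the weight 1 + θ|i - i₀| bounds its weighted norm by O(K)
(`Banded.l2_wt_le_of_coercive`). Second, H is smoothing: its entries are O(K^{-2}) in mean square
when K² ≤ n, and weighted Frobenius norms turn this into |H'w| = O(K^{-1/2}) (`CrossBound`). As the
points x_j are fixed, Markov's inequality for second moments suffices throughout.

Bias: after subtracting the coefficients f_j(knot), the block equations have right-hand sides with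
entries O(K^{-2}), hence |v| = O(K^{-1/2}), and the deviation from f_j(x_j) is O(1/K). The leading
bias of the theorem is itself O(1/K) (`exists_abs_biasLam_le`), so it may be moved in or out of the
remainder.

Variance: the estimator is affine in the errors with weight vector X_1 w/n - α, where |X_1 w/n|² =
O(K/n) and |α|² = O(1/n). The second part changes the variance only by a relative K^{-1/2}; in the
first, A_1 is replaced by G_1, and the leading variance is at least of order K/n
(`exists_gram_bound`).

Covariance: of the four products, the two mixed ones would lose a factor √K under Cauchy–Schwarz.
They are instead read as responses of the block system to data localized in one coordinate and
tested in the other (`LocalizedSystem.abs_covariance_le`). -/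

/-! ### Euclidean and Frobenius norms -/

/-- The Euclidean norm of a vector of reals. -/
def l2 {ι : Type*} [Fintype ι] (v : ι → ℝ) : ℝ := √(∑ i, v i ^ 2)

/-- The Frobenius norm of a matrix. -/
def frob {ι κ : Type*} [Fintype ι] [Fintype κ] (A : Matrix ι κ ℝ) : ℝ :=
  √(∑ i, ∑ k, A i k ^ 2)

section Norms

variable {ι κ : Type*} [Fintype ι] [Fintype κ]

lemma l2_nonneg (v : ι → ℝ) : 0 ≤ l2 v := Real.sqrt_nonneg _

lemma l2_sq (v : ι → ℝ) : l2 v ^ 2 = ∑ i, v i ^ 2 :=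
  Real.sq_sqrt (Finset.sum_nonneg fun _ _ => sq_nonneg _)

lemma l2_sq_eq_dotProduct (v : ι → ℝ) : l2 v ^ 2 = v ⬝ᵥ v := by
  rw [l2_sq]; simp [dotProduct, sq]

lemma sum_abs_mul_le (u v : ι → ℝ) : ∑ i, |u i| * |v i| ≤ l2 u * l2 v := by
  have := Real.sum_mul_le_sqrt_mul_sqrt Finset.univ (fun i => |u i|) (fun i => |v i|)
  simpa [l2, sq_abs] using this

lemma abs_dotProduct_le (u v : ι → ℝ) : |u ⬝ᵥ v| ≤ l2 u * l2 v := by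
  refine le_trans ?_ (sum_abs_mul_le u v)
  simp only [dotProduct, ← abs_mul]
  exact Finset.abs_sum_le_sum_abs _ _

lemma dotProduct_le_l2 (u v : ι → ℝ) : u ⬝ᵥ v ≤ l2 u * l2 v :=
  (le_abs_self _).trans (abs_dotProduct_le u v)

lemma l2_smul (c : ℝ) (v : ι → ℝ) : l2 (c • v) = |c| * l2 v := by
  simp only [l2, Pi.smul_apply, smul_eq_mul, mul_pow, ← Finset.mul_sum]
  rw [Real.sqrt_mul (sq_nonneg c), Real.sqrt_sq_eq_abs]

lemma l2_neg (v : ι → ℝ) : l2 (-v) = l2 v := by simp [l2]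

lemma l2_zero : l2 (0 : ι → ℝ) = 0 := by simp [l2]

lemma l2_add_le (u v : ι → ℝ) : l2 (u + v) ≤ l2 u + l2 v := by
  refine abs_le_of_sq_le_sq' ?_ (add_nonneg (l2_nonneg u) (l2_nonneg v)) |>.2
  rw [add_sq, l2_sq_eq_dotProduct, l2_sq_eq_dotProduct, l2_sq_eq_dotProduct]
  have := dotProduct_le_l2 u v
  simp only [add_dotProduct, dotProduct_add, dotProduct_comm v u]
  linarith

lemma l2_sub_le (u v : ι → ℝ) : l2 (u - v) ≤ l2 u + l2 v := by
  rw [sub_eq_add_neg, ← l2_neg v]; exact l2_add_le _ _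

lemma l2_mono {u v : ι → ℝ} (h : ∀ i, |u i| ≤ |v i|) : l2 u ≤ l2 v :=
  Real.sqrt_le_sqrt (Finset.sum_le_sum fun i _ => sq_le_sq.2 (h i))

lemma l2_le_of_abs_le {v : ι → ℝ} {b : ℝ} (h : ∀ i, |v i| ≤ b) (hb : 0 ≤ b) :
    l2 v ≤ √(Fintype.card ι) * b := by
  have h1 : ∑ i, v i ^ 2 ≤ ∑ _i : ι, b ^ 2 :=
    Finset.sum_le_sum fun i _ => sq_le_sq.2 (by rw [abs_of_nonneg hb]; exact h i)
  calc l2 v ≤ √(∑ _i : ι, b ^ 2) := Real.sqrt_le_sqrt h1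
    _ = √(Fintype.card ι) * b := by
      simp [Real.sqrt_sq hb]

/-- Cancelling one factor `l2 v`; this is how a bound on a bilinear form, tested with the output
vector itself, becomes a bound on an operator norm. -/
lemma l2_le_of_dotProduct_le {v : ι → ℝ} {b : ℝ} (hb : 0 ≤ b)
    (h : v ⬝ᵥ v ≤ b * l2 v) : l2 v ≤ b := by
  rw [← l2_sq_eq_dotProduct] at h
  by_contra! hlt
  nlinarith [l2_nonneg v]

lemma abs_apply_le_l2 (v : ι → ℝ) (i : ι) : |v i| ≤ l2 v := by
  rw [← Real.sqrt_sq_eq_abs]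
  exact Real.sqrt_le_sqrt (Finset.single_le_sum (f := fun i => v i ^ 2)
    (fun _ _ => sq_nonneg _) (Finset.mem_univ i))

lemma frob_nonneg (A : Matrix ι κ ℝ) : 0 ≤ frob A := Real.sqrt_nonneg _

lemma frob_sq (A : Matrix ι κ ℝ) : frob A ^ 2 = ∑ i, ∑ k, A i k ^ 2 :=
  Real.sq_sqrt (Finset.sum_nonneg fun _ _ => Finset.sum_nonneg fun _ _ => sq_nonneg _)

lemma abs_apply_le_frob (A : Matrix ι κ ℝ) (i : ι) (k : κ) : |A i k| ≤ frob A := by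
  rw [← Real.sqrt_sq_eq_abs]
  refine Real.sqrt_le_sqrt ?_
  calc A i k ^ 2 ≤ ∑ k, A i k ^ 2 := Finset.single_le_sum (f := fun k => A i k ^ 2)
        (fun _ _ => sq_nonneg _) (Finset.mem_univ k)
    _ ≤ _ := Finset.single_le_sum (f := fun i => ∑ k, A i k ^ 2)
        (fun _ _ => Finset.sum_nonneg fun _ _ => sq_nonneg _) (Finset.mem_univ i)

lemma l2_mulVec_le (A : Matrix ι κ ℝ) (v : κ → ℝ) : l2 (A *ᵥ v) ≤ frob A * l2 v := by
  refine abs_le_of_sq_le_sq' ?_ (mul_nonneg (frob_nonneg A) (l2_nonneg v)) |>.2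
  rw [mul_pow, frob_sq, l2_sq, l2_sq, Finset.sum_mul]
  exact Finset.sum_le_sum fun i _ => Finset.sum_mul_sq_le_sq_mul_sq _ _ _

lemma abs_bilin_le_frob (A : Matrix ι κ ℝ) (u : ι → ℝ) (v : κ → ℝ) :
    |u ⬝ᵥ (A *ᵥ v)| ≤ frob A * l2 u * l2 v := by
  refine (abs_dotProduct_le _ _).trans ?_
  have := mul_le_mul_of_nonneg_left (l2_mulVec_le A v) (l2_nonneg u)
  linarith

/-- A bilinear form bounded through a weighted Frobenius norm. -/
lemma abs_bilin_le_weighted (A : Matrix ι κ ℝ) (W : ι → ℝ) (W' : κ → ℝ) (hW : ∀ i, 0 < W i)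
    (hW' : ∀ k, 0 < W' k) (u : ι → ℝ) (v : κ → ℝ) {b : ℝ}
    (hb : ∑ i, ∑ k, (W i ^ 2)⁻¹ * (W' k ^ 2)⁻¹ * A i k ^ 2 ≤ b) :
    |u ⬝ᵥ (A *ᵥ v)| ≤ √b * l2 (W * u) * l2 (W' * v) := by
  -- The weights are moved from the vectors into the matrix, so that the plain Frobenius bound
  -- applies to the conjugated matrix.
  set A' : Matrix ι κ ℝ := Matrix.of fun i k => (W i)⁻¹ * A i k * (W' k)⁻¹ with hA'
  have h1 : u ⬝ᵥ (A *ᵥ v) = (W * u) ⬝ᵥ (A' *ᵥ (W' * v)) := by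
    simp only [dotProduct, Matrix.mulVec, hA', Matrix.of_apply, Pi.mul_apply]
    refine Finset.sum_congr rfl fun i _ => ?_
    rw [Finset.mul_sum, Finset.mul_sum]
    refine Finset.sum_congr rfl fun k _ => ?_
    have := (hW i).ne'; have := (hW' k).ne'
    field_simp
  have h2 : frob A' ≤ √b := by
    refine Real.sqrt_le_sqrt (le_trans (le_of_eq ?_) hb)
    refine Finset.sum_congr rfl fun i _ => Finset.sum_congr rfl fun k _ => ?_
    simp only [hA', Matrix.of_apply, mul_pow, inv_pow]; ring
  rw [h1]
  refine (abs_bilin_le_frob A' _ _).trans ?_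
  gcongr
  · exact l2_nonneg _
  · exact l2_nonneg _

/-- The norm of `Aᵀ v` bounded through a row-weighted Frobenius norm. -/
lemma l2_transpose_mulVec_le_weighted (A : Matrix ι κ ℝ) (W : ι → ℝ) (hW : ∀ i, 0 < W i)
    (v : ι → ℝ) {b : ℝ} (hb : ∑ i, ∑ k, (W i ^ 2)⁻¹ * A i k ^ 2 ≤ b) :
    l2 (Aᵀ *ᵥ v) ≤ √b * l2 (W * v) := by
  refine l2_le_of_dotProduct_le (mul_nonneg (Real.sqrt_nonneg _) (l2_nonneg _)) ?_
  have := abs_bilin_le_weighted A W 1 hW (fun _ => one_pos) v (Aᵀ *ᵥ v) (b := b)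
    (by simpa using hb)
  rw [one_mul] at this
  refine le_trans (le_of_eq ?_) ((le_abs_self _).trans this)
  rw [Matrix.dotProduct_mulVec v, ← Matrix.mulVec_transpose]

end Norms

/-! ### Banded matrices -/

/-- A square matrix with bandwidth `L`. -/
def Banded {N : ℕ} (L : ℕ) (A : Matrix (Fin N) (Fin N) ℝ) : Prop :=
  ∀ i k, A i k ≠ 0 → (i : ℕ) ≤ k + L ∧ (k : ℕ) ≤ i + L

section Band

variable {N L : ℕ} {A : Matrix (Fin N) (Fin N) ℝ} {a : ℝ}

lemma Banded.transpose (h : Banded L A) : Banded L Aᵀ := fun i k hik => (h k i hik).symm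

lemma Banded.mono {L' : ℕ} (h : Banded L A) (hL : L ≤ L') : Banded L' A := fun i k hik => by
  have := h i k hik; omega

lemma Banded.add {B : Matrix (Fin N) (Fin N) ℝ} (h : Banded L A) (h' : Banded L B) :
    Banded L (A + B) := fun i k hik => by
  by_cases h1 : A i k = 0
  · by_cases h2 : B i k = 0
    · simp [h1, h2] at hik
    · exact h' i k h2
  · exact h i k h1

lemma Banded.smul (h : Banded L A) (c : ℝ) : Banded L (c • A) := fun i k hik =>
  h i k fun h0 => hik (by simp [h0])

lemma card_band_le (L : ℕ) (i : Fin N) :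
    (Finset.univ.filter fun k : Fin N => (i : ℕ) ≤ k + L ∧ (k : ℕ) ≤ i + L).card ≤ 2 * L + 1 := by
  calc _ ≤ (Finset.Icc ((i : ℕ) - L) (i + L)).card := by
        refine Finset.card_le_card_of_injOn (fun k => (k : ℕ)) ?_ (fun x _ y _ h => Fin.ext h)
        intro k hk
        simp only [Finset.coe_filter, Set.mem_ofPred_eq, Finset.mem_univ, true_and] at hk
        simp only [Finset.coe_Icc, Set.mem_Icc]; omega
    _ ≤ 2 * L + 1 := by rw [Nat.card_Icc]; omega

lemma Banded.sum_abs_le (h : Banded L A) (ha : ∀ i k, |A i k| ≤ a) (i : Fin N) :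
    ∑ k, |A i k| ≤ (2 * L + 1) * a := by
  have ha0 : 0 ≤ a := (abs_nonneg _).trans (ha i i)
  calc ∑ k, |A i k| = ∑ k ∈ Finset.univ.filter
        (fun k : Fin N => (i : ℕ) ≤ k + L ∧ (k : ℕ) ≤ i + L), |A i k| := by
        symm
        refine Finset.sum_subset (Finset.subset_univ _) fun k _ hk => ?_
        by_contra h0
        exact hk (Finset.mem_filter.2 ⟨Finset.mem_univ _, h i k fun h1 => h0 (by simp [h1])⟩)
    _ ≤ ∑ k ∈ Finset.univ.filter
        (fun k : Fin N => (i : ℕ) ≤ k + L ∧ (k : ℕ) ≤ i + L), a := Finset.sum_le_sum fun k _ => ha i k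
    _ ≤ _ := by
        rw [Finset.sum_const, nsmul_eq_mul]
        refine mul_le_mul_of_nonneg_right ?_ ha0
        exact_mod_cast card_band_le L i

lemma Banded.abs_mulVec_le (h : Banded L A) (ha : ∀ i k, |A i k| ≤ a) {v : Fin N → ℝ} {b : ℝ}
    (hb0 : 0 ≤ b) (hv : ∀ i, |v i| ≤ b) (i : Fin N) : |(A *ᵥ v) i| ≤ (2 * L + 1) * a * b := by
  calc |(A *ᵥ v) i| ≤ ∑ k, |A i k| * |v k| := by
        simp only [Matrix.mulVec, dotProduct, ← abs_mul]; exact Finset.abs_sum_le_sum_abs _ _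
    _ ≤ ∑ k, |A i k| * b := Finset.sum_le_sum fun k _ =>
        mul_le_mul_of_nonneg_left (hv k) (abs_nonneg _)
    _ ≤ _ := by
        rw [← Finset.sum_mul]; exact mul_le_mul_of_nonneg_right (h.sum_abs_le ha i) hb0

/-- Schur's test: splitting |A_ik| into two square roots and using Cauchy–Schwarz leaves only row
and column sums, so the dimension does not enter. -/
lemma Banded.bilin_le (h : Banded L A) (ha : ∀ i k, |A i k| ≤ a) (ha0 : 0 ≤ a)
    (u v : Fin N → ℝ) :
    ∑ i, ∑ k, |A i k| * |u i| * |v k| ≤ (2 * L + 1) * a * l2 u * l2 v := by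
  have hc : (0:ℝ) ≤ (2 * L + 1) * a := by positivity
  have h1 : ∑ i, ∑ k, |A i k| * u i ^ 2 ≤ (2 * L + 1) * a * l2 u ^ 2 := by
    rw [l2_sq, Finset.mul_sum]
    refine Finset.sum_le_sum fun i _ => ?_
    rw [← Finset.sum_mul]
    exact mul_le_mul_of_nonneg_right (h.sum_abs_le ha i) (sq_nonneg _)
  have h2 : ∑ i, ∑ k, |A i k| * v k ^ 2 ≤ (2 * L + 1) * a * l2 v ^ 2 := by
    rw [Finset.sum_comm, l2_sq, Finset.mul_sum]
    refine Finset.sum_le_sum fun i _ => ?_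
    rw [← Finset.sum_mul]
    exact mul_le_mul_of_nonneg_right
      (h.transpose.sum_abs_le (fun i k => ha k i) i) (sq_nonneg _)
  have h3 : (∑ i, ∑ k, |A i k| * |u i| * |v k|) ≤
      √(∑ x : Fin N × Fin N, (√|A x.1 x.2| * |u x.1|) ^ 2) *
      √(∑ x : Fin N × Fin N, (√|A x.1 x.2| * |v x.2|) ^ 2) := by
    rw [← Fintype.sum_prod_type' (f := fun i k => |A i k| * |u i| * |v k|)]
    refine le_trans (le_of_eq ?_) (Real.sum_mul_le_sqrt_mul_sqrt _ _ _)
    refine Finset.sum_congr rfl fun x _ => ?_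
    have := Real.mul_self_sqrt (abs_nonneg (A x.1 x.2))
    linear_combination (-|u x.1| * |v x.2|) * this
  have e1 : (∑ x : Fin N × Fin N, (√|A x.1 x.2| * |u x.1|) ^ 2) = ∑ i, ∑ k, |A i k| * u i ^ 2 := by
    rw [← Fintype.sum_prod_type' (f := fun i k => |A i k| * u i ^ 2)]
    refine Finset.sum_congr rfl fun x _ => ?_
    rw [mul_pow, Real.sq_sqrt (abs_nonneg _), sq_abs]
  have e2 : (∑ x : Fin N × Fin N, (√|A x.1 x.2| * |v x.2|) ^ 2) = ∑ i, ∑ k, |A i k| * v k ^ 2 := by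
    rw [← Fintype.sum_prod_type' (f := fun i k => |A i k| * v k ^ 2)]
    refine Finset.sum_congr rfl fun x _ => ?_
    rw [mul_pow, Real.sq_sqrt (abs_nonneg _), sq_abs]
  rw [e1, e2] at h3
  calc _ ≤ _ := h3
    _ ≤ √((2 * L + 1) * a * l2 u ^ 2) * √((2 * L + 1) * a * l2 v ^ 2) := by gcongr
    _ = (2 * L + 1) * a * l2 u * l2 v := by
      rw [Real.sqrt_mul hc, Real.sqrt_mul hc, Real.sqrt_sq (l2_nonneg _),
        Real.sqrt_sq (l2_nonneg _)]
      linear_combination (l2 u * l2 v) * Real.mul_self_sqrt hc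

lemma abs_bilin_le_sum (A : Matrix (Fin N) (Fin N) ℝ) (u v : Fin N → ℝ) :
    |u ⬝ᵥ (A *ᵥ v)| ≤ ∑ i, ∑ k, |A i k| * |u i| * |v k| := by
  simp only [dotProduct, Matrix.mulVec, Finset.mul_sum]
  refine (Finset.abs_sum_le_sum_abs _ _).trans (Finset.sum_le_sum fun i _ => ?_)
  refine (Finset.abs_sum_le_sum_abs _ _).trans (Finset.sum_le_sum fun k _ => ?_)
  rw [abs_mul, abs_mul]; exact le_of_eq (by ring)

lemma Banded.abs_bilin_le (h : Banded L A) (ha : ∀ i k, |A i k| ≤ a) (ha0 : 0 ≤ a)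
    (u v : Fin N → ℝ) : |u ⬝ᵥ (A *ᵥ v)| ≤ (2 * L + 1) * a * l2 u * l2 v :=
  (abs_bilin_le_sum A u v).trans (h.bilin_le ha ha0 u v)

lemma Banded.l2_mulVec_le (h : Banded L A) (ha : ∀ i k, |A i k| ≤ a) (ha0 : 0 ≤ a)
    (v : Fin N → ℝ) : l2 (A *ᵥ v) ≤ (2 * L + 1) * a * l2 v := by
  refine l2_le_of_dotProduct_le (mul_nonneg (by positivity) (l2_nonneg _)) ?_
  have := (le_abs_self _).trans (h.abs_bilin_le ha ha0 (A *ᵥ v) v)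
  linarith

/-! ### Slowly varying weights -/

/-- The weight `1 + θ |i - i₀|`. -/
def wt (N : ℕ) (θ : ℝ) (i₀ : ℕ) : Fin N → ℝ := fun i => 1 + θ * |((i : ℕ) : ℝ) - i₀|

lemma one_le_wt {θ : ℝ} (hθ : 0 ≤ θ) (i₀ : ℕ) (i : Fin N) : 1 ≤ wt N θ i₀ i :=
  le_add_of_nonneg_right (mul_nonneg hθ (abs_nonneg _))

lemma wt_pos {θ : ℝ} (hθ : 0 ≤ θ) (i₀ : ℕ) (i : Fin N) : 0 < wt N θ i₀ i :=
  one_pos.trans_le (one_le_wt hθ i₀ i)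

/-- The weight is Lipschitz in the index with constant θ: across one band it hardly moves when θ is
small, although it grows without bound far from i₀. -/
lemma abs_wt_sub_le {θ : ℝ} (hθ : 0 ≤ θ) (i₀ : ℕ) {i k : Fin N}
    (h : (i : ℕ) ≤ k + L ∧ (k : ℕ) ≤ i + L) : |wt N θ i₀ i - wt N θ i₀ k| ≤ θ * L := by
  have h1 : |((i : ℕ) : ℝ) - (k : ℕ)| ≤ L := by
    rw [abs_sub_le_iff]
    have h2 : ((i : ℕ) : ℝ) ≤ (k : ℕ) + L := by exact_mod_cast h.1
    have h3 : ((k : ℕ) : ℝ) ≤ (i : ℕ) + L := by exact_mod_cast h.2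
    constructor <;> linarith
  have h2 : wt N θ i₀ i - wt N θ i₀ k = θ * (|((i : ℕ) : ℝ) - i₀| - |((k : ℕ) : ℝ) - i₀|) := by
    simp only [wt]; ring
  rw [h2, abs_mul, abs_of_nonneg hθ]
  refine mul_le_mul_of_nonneg_left ?_ hθ
  refine (abs_abs_sub_abs_le_abs_sub _ _).trans ?_
  simpa using h1

lemma l2_le_l2_wt {θ : ℝ} (hθ : 0 ≤ θ) (i₀ : ℕ) (v : Fin N → ℝ) :
    l2 v ≤ l2 (wt N θ i₀ * v) := by
  refine l2_mono fun i => ?_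
  rw [Pi.mul_apply, abs_mul, abs_of_pos (wt_pos hθ i₀ i)]
  exact le_mul_of_one_le_left (abs_nonneg _) (one_le_wt hθ i₀ i)

/-- A linear weight already has summable inverse squares. Shifting by i₀ embeds the sum into one
over ℤ, so the bound depends on neither the dimension nor the centre, and weighted Euclidean bounds
give ℓ¹ bounds at no cost in K. -/
lemma exists_sum_wt_le {θ : ℝ} (hθ : 0 < θ) :
    ∃ S : ℝ, 0 < S ∧ ∀ (N i₀ : ℕ), ∑ i, (wt N θ i₀ i ^ 2)⁻¹ ≤ S := by
  have hs : Summable fun z : ℤ => ((1 + θ * |(z : ℝ)|) ^ 2)⁻¹ := by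
    have h0 : Summable fun z : ℤ => (θ ^ 2)⁻¹ * (1 / (z : ℝ) ^ 2) :=
      (Real.summable_one_div_int_pow.2 (by norm_num)).mul_left _
    refine Summable.of_norm_bounded_eventually h0 ?_
    filter_upwards [(Set.finite_singleton (0 : ℤ)).compl_mem_cofinite] with z hz
    have hz0 : (z : ℝ) ≠ 0 := by exact_mod_cast hz
    have hz1 : 0 < |(z : ℝ)| := abs_pos.2 hz0
    rw [Real.norm_of_nonneg (by positivity), one_div, ← mul_inv, ← mul_pow]
    refine inv_anti₀ (by positivity) ?_
    rw [← sq_abs, abs_mul, abs_of_pos hθ]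
    gcongr
    linarith
  refine ⟨(∑' z : ℤ, ((1 + θ * |(z : ℝ)|) ^ 2)⁻¹) + 1, ?_, fun N i₀ => ?_⟩
  · have : 0 ≤ ∑' z : ℤ, ((1 + θ * |(z : ℝ)|) ^ 2)⁻¹ := tsum_nonneg fun z => by positivity
    linarith
  · have hinj : Function.Injective fun i : Fin N => ((i : ℕ) : ℤ) - i₀ := fun i k h => by
      apply Fin.ext; simp only at h; omega
    have h1 := hs.sum_le_tsum (Finset.univ.map ⟨_, hinj⟩) (fun z _ => by positivity)
    rw [Finset.sum_map] at h1
    simp only [Function.Embedding.coeFn_mk] at h1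
    push_cast at h1
    simp only [wt]
    linarith

lemma sum_abs_le_wt {θ : ℝ} (hθ : 0 ≤ θ) {i₀ : ℕ} {S : ℝ}
    (hS : ∑ i, (wt N θ i₀ i ^ 2)⁻¹ ≤ S) (v : Fin N → ℝ) :
    ∑ i, |v i| ≤ √S * l2 (wt N θ i₀ * v) := by
  have h1 := sum_abs_mul_le (fun i => (wt N θ i₀ i)⁻¹) (wt N θ i₀ * v)
  have h2 : ∑ i, |v i| = ∑ i, |(wt N θ i₀ i)⁻¹| * |(wt N θ i₀ * v) i| := by
    refine Finset.sum_congr rfl fun i _ => ?_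
    have := (wt_pos hθ i₀ i).ne'
    rw [← abs_mul, Pi.mul_apply, inv_mul_cancel_left₀ this]
  rw [h2]
  refine h1.trans (mul_le_mul_of_nonneg_right (Real.sqrt_le_sqrt ?_) (l2_nonneg _))
  simpa [inv_pow] using hS

/-- Inside the band the weights at two indices have ratio at most 1 + θL, so the weight passes
through the matrix at the price of that factor. -/
lemma Banded.l2_wt_mulVec_le (h : Banded L A) (ha : ∀ i k, |A i k| ≤ a) (ha0 : 0 ≤ a) {θ : ℝ}
    (hθ : 0 ≤ θ) (i₀ : ℕ) (v : Fin N → ℝ) :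
    l2 (wt N θ i₀ * (A *ᵥ v)) ≤ (1 + θ * L) * ((2 * L + 1) * a) * l2 (wt N θ i₀ * v) := by
  refine l2_le_of_dotProduct_le (mul_nonneg (by positivity) (l2_nonneg _)) ?_
  set u := wt N θ i₀ * (A *ᵥ v) with hu
  have h1 : u ⬝ᵥ u ≤ ∑ i, ∑ k, |A i k| * |u i| * |((1 + θ * L) • (wt N θ i₀ * v)) k| := by
    rw [dotProduct]
    refine Finset.sum_le_sum fun i _ => ?_
    have h2 : |u i| ≤ ∑ k, |A i k| * |((1 + θ * L) • (wt N θ i₀ * v)) k| := by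
      rw [hu, Pi.mul_apply, Matrix.mulVec, dotProduct, Finset.mul_sum]
      refine (Finset.abs_sum_le_sum_abs _ _).trans (Finset.sum_le_sum fun k _ => ?_)
      by_cases h0 : A i k = 0
      · simp [h0]
      · have h3 := abs_wt_sub_le hθ i₀ (h i k h0)
        have h4 := one_le_wt hθ i₀ k
        have h5 : wt N θ i₀ i ≤ (1 + θ * L) * wt N θ i₀ k := by
          have := (abs_le.1 h3).2
          have h6 : 0 ≤ θ * L := by positivity
          nlinarith
        rw [Pi.smul_apply, Pi.mul_apply, smul_eq_mul, abs_mul, abs_mul, abs_mul, abs_mul,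
          abs_of_pos (wt_pos hθ i₀ i), abs_of_pos (wt_pos hθ i₀ k),
          abs_of_nonneg (by positivity : (0:ℝ) ≤ 1 + θ * L)]
        calc wt N θ i₀ i * (|A i k| * |v k|) ≤ ((1 + θ * L) * wt N θ i₀ k) * (|A i k| * |v k|) := by
              gcongr
          _ = _ := by ring
    calc u i * u i ≤ |u i| * |u i| := by rw [abs_mul_abs_self]
      _ ≤ |u i| * ∑ k, |A i k| * |((1 + θ * L) • (wt N θ i₀ * v)) k| :=
        mul_le_mul_of_nonneg_left h2 (abs_nonneg _)
      _ = _ := by rw [Finset.mul_sum]; exact Finset.sum_congr rfl fun k _ => by ring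
  have h3 := h1.trans (h.bilin_le ha ha0 u _)
  rw [l2_smul, abs_of_nonneg (by positivity)] at h3
  linarith

/-- By symmetry W_i² may be replaced by the average of W_i² and W_k², which differs from W_i W_k by
(W_i - W_k)²/2. Hence the commutator of the weight with A is quadratic in the increments of the
weight. -/
lemma weighted_energy_identity (hA : A.IsSymm) (W w : Fin N → ℝ) :
    (W * w) ⬝ᵥ (W * (A *ᵥ w)) = (W * w) ⬝ᵥ (A *ᵥ (W * w))
      + (1 / 2) * ∑ i, ∑ k, (W i - W k) ^ 2 * A i k * w i * w k := by
  have e1 : (W * w) ⬝ᵥ (W * (A *ᵥ w)) = ∑ i, ∑ k, W i ^ 2 * A i k * w i * w k := by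
    simp only [dotProduct, Pi.mul_apply, Matrix.mulVec, Finset.mul_sum]
    exact Finset.sum_congr rfl fun i _ => Finset.sum_congr rfl fun k _ => by ring
  have e2 : (W * w) ⬝ᵥ (A *ᵥ (W * w)) = ∑ i, ∑ k, W i * W k * A i k * w i * w k := by
    simp only [dotProduct, Pi.mul_apply, Matrix.mulVec, Finset.mul_sum]
    exact Finset.sum_congr rfl fun i _ => Finset.sum_congr rfl fun k _ => by ring
  have e3 : ∑ i, ∑ k, W i ^ 2 * A i k * w i * w k = ∑ i, ∑ k, W k ^ 2 * A i k * w i * w k := by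
    rw [Finset.sum_comm]
    refine Finset.sum_congr rfl fun i _ => Finset.sum_congr rfl fun k _ => ?_
    rw [hA.apply i k]; ring
  have e4 : ∑ i, ∑ k, (W i - W k) ^ 2 * A i k * w i * w k
      = (∑ i, ∑ k, W i ^ 2 * A i k * w i * w k) + (∑ i, ∑ k, W k ^ 2 * A i k * w i * w k)
        - 2 * ∑ i, ∑ k, W i * W k * A i k * w i * w k := by
    simp only [Finset.mul_sum, ← Finset.sum_add_distrib, ← Finset.sum_sub_distrib]
    exact Finset.sum_congr rfl fun i _ => Finset.sum_congr rfl fun k _ => by ring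
  rw [e1, e2, e4, ← e3]; ring

/-- Off-diagonal decay for the inverse of a coercive banded matrix, as an energy estimate. -/
lemma Banded.l2_wt_le_of_coercive (h : Banded L A) (hA : A.IsSymm) (ha : ∀ i k, |A i k| ≤ a)
    (ha0 : 0 ≤ a) {c : ℝ} (hc : 0 < c) (hco : ∀ v, c * l2 v ^ 2 ≤ v ⬝ᵥ (A *ᵥ v)) {θ : ℝ}
    (hθ : 0 ≤ θ) (hsmall : (θ * L) ^ 2 * ((2 * L + 1) * a) ≤ c) (i₀ : ℕ) (w : Fin N → ℝ) :
    l2 (wt N θ i₀ * w) ≤ 2 / c * l2 (wt N θ i₀ * (A *ᵥ w)) := by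
  set W := wt N θ i₀
  have h1 := weighted_energy_identity hA W w
  -- The commutator is small against the unweighted norm. Entering the identity with the factor 1/2,
  -- it consumes at most half of the coercive term, which is where the constant 2/c comes from.
  have h2 : |∑ i, ∑ k, (W i - W k) ^ 2 * A i k * w i * w k| ≤ c * l2 (W * w) ^ 2 := by
    calc |∑ i, ∑ k, (W i - W k) ^ 2 * A i k * w i * w k|
        ≤ ∑ i, ∑ k, (θ * L) ^ 2 * (|A i k| * |w i| * |w k|) := by
          refine (Finset.abs_sum_le_sum_abs _ _).trans (Finset.sum_le_sum fun i _ => ?_)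
          refine (Finset.abs_sum_le_sum_abs _ _).trans (Finset.sum_le_sum fun k _ => ?_)
          by_cases h0 : A i k = 0
          · simp [h0]
          · have h3 := abs_wt_sub_le hθ i₀ (h i k h0)
            rw [abs_mul, abs_mul, abs_mul, abs_of_nonneg (sq_nonneg (W i - W k)), ← sq_abs (W i - W k)]
            have h4 : |W i - W k| ^ 2 ≤ (θ * L) ^ 2 := by gcongr
            calc _ = |W i - W k| ^ 2 * (|A i k| * |w i| * |w k|) := by ring
              _ ≤ _ := by gcongr
      _ ≤ (θ * L) ^ 2 * ((2 * L + 1) * a * l2 w * l2 w) := by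
          simp only [← Finset.mul_sum]
          exact mul_le_mul_of_nonneg_left (h.bilin_le ha ha0 w w) (sq_nonneg _)
      _ = ((θ * L) ^ 2 * ((2 * L + 1) * a)) * l2 w ^ 2 := by ring
      _ ≤ c * l2 (W * w) ^ 2 := by
          gcongr
          · exact l2_nonneg _
          · exact l2_le_l2_wt hθ i₀ w
  have h3 := hco (W * w)
  have h4 := dotProduct_le_l2 (W * w) (W * (A *ᵥ w))
  have h5 := (abs_le.1 h2).1
  have h6 : l2 (W * w) * (c / 2 * l2 (W * w)) ≤ l2 (W * w) * l2 (W * (A *ᵥ w)) := by nlinarith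
  rcases (l2_nonneg (W * w)).eq_or_lt with h0 | h0
  · rw [← h0]; have := l2_nonneg (W * (A *ᵥ w)); positivity
  · have h7 := le_of_mul_le_mul_left h6 h0
    rw [div_mul_eq_mul_div, le_div_iff₀ hc]; linarith

end Band

/-! ### Cardinal B-splines -/

lemma knot_one (k : ℤ) : knot 1 k = k := by simp [knot]

lemma bspline_one_succ (p : ℕ) (k : ℤ) (x : ℝ) :
    bspline 1 (p + 1) k x = (x - (k - 1)) / (p + 1) * bspline 1 p k x
      + (k + p + 1 - x) / (p + 1) * bspline 1 p (k + 1) x := by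
  rw [bspline]
  simp only [knot_one]
  push_cast
  congr 2
  · congr 1; ring
  · congr 1; ring

/-- Reduction to integer knots, so that the constants for the basis functions do not involve K;
`bspline_translate` then brings every cell to (0,1]. -/
lemma bspline_scale {K : ℕ} (hK : 0 < K) (p : ℕ) (k : ℤ) (x : ℝ) :
    bspline K p k x = bspline 1 p k (K * x) := by
  have hK' : (0 : ℝ) < K := by exact_mod_cast hK
  induction p generalizing k with
  | zero =>
    simp only [bspline, knot, Nat.cast_one, div_one]
    exact if_congr (and_congr (div_lt_iff₀' hK') (le_div_iff₀' hK')) rfl rfl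
  | succ p ih =>
    rw [bspline_one_succ, bspline, ih, ih]
    have h1 : knot K (k + p) - knot K (k - 1) = (p + 1) / K := by
      simp only [knot]; push_cast; field_simp; ring
    have h2 : knot K (k + p + 1) - knot K k = (p + 1) / K := by
      simp only [knot]; push_cast; field_simp; ring
    rw [h1, h2]
    have hp : (p : ℝ) + 1 ≠ 0 := by positivity
    congr 2
    · simp only [knot]; push_cast; field_simp
    · simp only [knot]; push_cast; field_simp

lemma bspline_translate (p : ℕ) (k j : ℤ) (x : ℝ) :
    bspline 1 p (k + j) (x + j) = bspline 1 p k x := by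
  induction p generalizing k with
  | zero =>
    simp only [bspline, knot_one]
    push_cast
    have h1 : (k : ℝ) + j - 1 < x + j ↔ (k : ℝ) - 1 < x := by constructor <;> intro <;> linarith
    have h2 : x + j ≤ (k : ℝ) + j ↔ x ≤ k := by constructor <;> intro <;> linarith
    exact if_congr (and_congr h1 h2) rfl rfl
  | succ p ih =>
    rw [bspline_one_succ, bspline_one_succ, ih, show k + j + 1 = (k + 1) + j by ring, ih]
    push_cast
    congr 2
    · congr 1; ring
    · congr 1; ring

lemma bspline_support {p : ℕ} {k : ℤ} {x : ℝ} (h : bspline 1 p k x ≠ 0) :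
    (k : ℝ) - 1 < x ∧ x ≤ k + p := by
  induction p generalizing k with
  | zero =>
    simp only [bspline, knot_one] at h
    push_cast at h
    by_contra h'
    apply h
    rw [if_neg]
    simpa using h'
  | succ p ih =>
    rw [bspline_one_succ] at h
    push_cast
    by_cases h1 : bspline 1 p k x = 0
    · have h2 : bspline 1 p (k + 1) x ≠ 0 := by
        intro h2; apply h; rw [h1, h2]; ring
      have := ih h2
      push_cast at this
      constructor <;> linarith
    · have := ih h1
      constructor <;> linarith

lemma bspline_nonneg (p : ℕ) (k : ℤ) (x : ℝ) : 0 ≤ bspline 1 p k x := by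
  induction p generalizing k with
  | zero => simp only [bspline]; split_ifs <;> norm_num
  | succ p ih =>
    rw [bspline_one_succ]
    have hp : (0 : ℝ) < p + 1 := by positivity
    refine add_nonneg ?_ ?_
    · by_cases h : bspline 1 p k x = 0
      · simp [h]
      · have := bspline_support h
        exact mul_nonneg (div_nonneg (by linarith) hp.le) (ih k)
    · by_cases h : bspline 1 p (k + 1) x = 0
      · simp [h]
      · have := bspline_support h
        push_cast at this
        exact mul_nonneg (div_nonneg (by linarith) hp.le) (ih _)

/-- In the recursion each function of degree p occurs twice, and after an index shift its two linear
factors add up to 1. The two boundary terms vanish because their supports miss (0,1]. -/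
lemma sum_bspline_local (p : ℕ) {t : ℝ} (h0 : 0 < t) (h1 : t ≤ 1) :
    ∑ i ∈ Finset.range (p + 1), bspline 1 p ((i : ℤ) - p + 1) t = 1 := by
  induction p with
  | zero =>
    rw [zero_add, Finset.sum_range_one]
    simp only [bspline, knot_one]
    rw [if_pos]
    push_cast
    constructor <;> linarith
  | succ p ih =>
    have hp : (p : ℝ) + 1 ≠ 0 := by positivity
    have e : ∀ i : ℕ, bspline 1 (p + 1) ((i : ℤ) - (p + 1 : ℕ) + 1) t
        = (t - (i - p - 1)) / (p + 1) * bspline 1 p ((i : ℤ) - p) t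
          + (i + 1 - t) / (p + 1) * bspline 1 p ((i : ℤ) - p + 1) t := by
      intro i
      rw [show ((i : ℤ) - (p + 1 : ℕ) + 1) = (i : ℤ) - p by push_cast; ring, bspline_one_succ]
      push_cast
      congr 3; ring
    simp only [e, Finset.sum_add_distrib]
    rw [Finset.sum_range_succ', Finset.sum_range_succ _ (p + 1)]
    have z1 : bspline 1 p (((0 : ℕ) : ℤ) - p) t = 0 := by
      by_contra h
      have := (bspline_support h).2
      push_cast at this; linarith
    have z2 : bspline 1 p (((p + 1 : ℕ) : ℤ) - p + 1) t = 0 := by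
      by_contra h
      have := (bspline_support h).1
      push_cast at this; linarith
    rw [z1, z2, mul_zero, mul_zero, add_zero, add_zero, ← Finset.sum_add_distrib]
    refine Eq.trans ?_ ih
    refine Finset.sum_congr rfl fun i _ => ?_
    rw [show (((i + 1 : ℕ) : ℤ) - p) = (i : ℤ) - p + 1 by push_cast; ring, ← add_mul]
    push_cast
    rw [← add_div, show t - ((i : ℝ) + 1 - p - 1) + (i + 1 - t) = p + 1 by ring, div_self hp, one_mul]

lemma bspline_le_one (p : ℕ) (k : ℤ) (x : ℝ) : bspline 1 p k x ≤ 1 := by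
  -- The cells are open on the left and closed on the right, hence the ceiling minus one rather than
  -- the floor.
  set ν : ℤ := ⌈x⌉ - 1 with hν
  have h0 : 0 < x - ν := by
    have := Int.ceil_lt_add_one x
    rw [hν]; push_cast; linarith
  have h1 : x - ν ≤ 1 := by
    have := Int.le_ceil x
    rw [hν]; push_cast; linarith
  have e : bspline 1 p k x = bspline 1 p (k - ν) (x - ν) := by
    rw [← bspline_translate p (k - ν) ν]; simp
  rw [e]
  by_cases hz : bspline 1 p (k - ν) (x - ν) = 0
  · rw [hz]; norm_num
  · have hs := bspline_support hz
    have hk1 : k - ν < 2 := by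
      have : ((k - ν : ℤ) : ℝ) < 2 := by linarith [hs.1]
      exact_mod_cast this
    have hk2 : 0 < k - ν + p := by
      have : (0 : ℝ) < ((k - ν : ℤ) : ℝ) + p := by linarith [hs.2]
      exact_mod_cast this
    rw [← sum_bspline_local p h0 h1]
    have hi : k - ν = (((k - ν + p - 1).toNat : ℕ) : ℤ) - p + 1 := by
      rw [Int.toNat_of_nonneg (by omega)]; ring
    conv_lhs => rw [hi]
    refine Finset.single_le_sum (f := fun i : ℕ => bspline 1 p ((i : ℤ) - p + 1) (x - ν))
      (fun i _ => bspline_nonneg _ _ _) ?_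
    simp only [Finset.mem_range]; omega

lemma measurable_bspline (K p : ℕ) (k : ℤ) : Measurable (bspline K p k) := by
  induction p generalizing k with
  | zero =>
    change Measurable fun x => if knot K (k - 1) < x ∧ x ≤ knot K k then (1 : ℝ) else 0
    exact Measurable.ite measurableSet_Ioc measurable_const measurable_const
  | succ p ih =>
    have : bspline K (p + 1) k = fun x =>
        (x - knot K (k - 1)) / (knot K (k + p) - knot K (k - 1)) * bspline K p k x
        + (knot K (k + p + 1) - x) / (knot K (k + p + 1) - knot K k) * bspline K p (k + 1) x := rfl
    rw [this]
    have h1 := ih k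
    have h2 := ih (k + 1)
    fun_prop

/-! ### Derivatives and local linear independence -/

lemma bspline_zero_hasDerivAt (k : ℤ) {t : ℝ} (h0 : 0 < t) (h1 : t < 1) :
    HasDerivAt (bspline 1 0 k) 0 t := by
  have : bspline 1 0 k =ᶠ[𝓝 t] fun _ => if k = 1 then 1 else 0 := by
    filter_upwards [Ioo_mem_nhds h0 h1] with s hs
    simp only [bspline, knot_one]
    push_cast
    refine if_congr ?_ rfl rfl
    constructor
    · rintro ⟨h2, h3⟩
      have h4 : (k : ℝ) < 2 := by linarith [hs.2]
      have h5 : (0 : ℝ) < k := by linarith [hs.1]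
      have h4' : k < 2 := by exact_mod_cast h4
      have h5' : 0 < k := by exact_mod_cast h5
      omega
    · rintro rfl
      push_cast
      constructor <;> linarith [hs.1, hs.2]
  exact (hasDerivAt_const t _).congr_of_eventuallyEq this

/-- Differentiating the recursion and inserting the recursion for the lower degree. Staying inside
an open cell avoids the knots, where low-degree splines are not differentiable. -/
lemma bspline_succ_hasDerivAt (p : ℕ) (k : ℤ) {t : ℝ} (h0 : 0 < t) (h1 : t < 1) :
    HasDerivAt (bspline 1 (p + 1) k) (bspline 1 p k t - bspline 1 p (k + 1) t) t := by
  induction p generalizing k with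
  | zero =>
    have e : bspline 1 (0 + 1) k = fun x => (x - (k - 1)) / ((0 : ℕ) + 1) * bspline 1 0 k x
      + (k + (0 : ℕ) + 1 - x) / ((0 : ℕ) + 1) * bspline 1 0 (k + 1) x :=
        funext fun x => bspline_one_succ 0 k x
    rw [e]
    have d1 : HasDerivAt (fun x : ℝ => (x - ((k : ℝ) - 1)) / ((0 : ℕ) + 1)) (1 / ((0 : ℕ) + 1)) t :=
      ((hasDerivAt_id t).sub_const _).div_const _
    have d2 : HasDerivAt (fun x : ℝ => ((k : ℝ) + (0 : ℕ) + 1 - x) / ((0 : ℕ) + 1))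
        (-1 / ((0 : ℕ) + 1)) t := ((hasDerivAt_id t).const_sub _).div_const _
    refine ((d1.fun_mul (bspline_zero_hasDerivAt k h0 h1)).fun_add
      (d2.fun_mul (bspline_zero_hasDerivAt (k + 1) h0 h1))).congr_deriv ?_
    push_cast; ring
  | succ p ih =>
    have e : bspline 1 (p + 1 + 1) k = fun x =>
        (x - (k - 1)) / ((p + 1 : ℕ) + 1) * bspline 1 (p + 1) k x
        + (k + (p + 1 : ℕ) + 1 - x) / ((p + 1 : ℕ) + 1) * bspline 1 (p + 1) (k + 1) x :=
      funext fun x => bspline_one_succ (p + 1) k x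
    rw [e]
    have d1 : HasDerivAt (fun x : ℝ => (x - ((k : ℝ) - 1)) / ((p + 1 : ℕ) + 1))
        (1 / ((p + 1 : ℕ) + 1)) t :=
      ((hasDerivAt_id t).sub_const _).div_const _
    have d2 : HasDerivAt (fun x : ℝ => ((k : ℝ) + (p + 1 : ℕ) + 1 - x) / ((p + 1 : ℕ) + 1))
        (-1 / ((p + 1 : ℕ) + 1)) t := ((hasDerivAt_id t).const_sub _).div_const _
    refine ((d1.fun_mul (ih k)).fun_add (d2.fun_mul (ih (k + 1)))).congr_deriv ?_
    have r1 := bspline_one_succ p k t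
    have r2 := bspline_one_succ p (k + 1) t
    push_cast at r2 ⊢
    rw [r1, r2]
    field_simp
    ring

lemma bspline_continuousAt (p : ℕ) (k : ℤ) {t : ℝ} (h0 : 0 < t) (h1 : t < 1) :
    ContinuousAt (bspline 1 p k) t := by
  cases p with
  | zero => exact (bspline_zero_hasDerivAt k h0 h1).continuousAt
  | succ p => exact (bspline_succ_hasDerivAt p k h0 h1).continuousAt

/-- The derivative of a vanishing combination is a vanishing combination of lower degree whose
coefficients are the differences of the u_i. By induction these vanish, so u is constant, and the
partition of unity makes the constant zero. -/
lemma bspline_local_linearIndependent (p : ℕ) (u : ℕ → ℝ)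
    (h : ∀ t : ℝ, 0 < t → t < 1 →
      ∑ i ∈ Finset.range (p + 1), u i * bspline 1 p ((i : ℤ) - p + 1) t = 0) :
    ∀ i ≤ p, u i = 0 := by
  induction p generalizing u with
  | zero =>
    intro i hi
    have := h (1 / 2) (by norm_num) (by norm_num)
    have hb := sum_bspline_local 0 (t := 1 / 2) (by norm_num) (by norm_num)
    simp only [Finset.sum_range_one, zero_add] at this hb
    rw [hb, mul_one] at this
    rw [Nat.le_zero.1 hi, this]
  | succ p ih =>
    have hd : ∀ i ≤ p, u (i + 1) - u i = 0 := by
      refine ih (fun i => u (i + 1) - u i) fun t h0 h1 => ?_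
      have d : HasDerivAt (fun t => ∑ i ∈ Finset.range (p + 1 + 1),
          u i * bspline 1 (p + 1) ((i : ℤ) - (p + 1 : ℕ) + 1) t)
          (∑ i ∈ Finset.range (p + 1 + 1), u i * (bspline 1 p ((i : ℤ) - (p + 1 : ℕ) + 1) t
            - bspline 1 p ((i : ℤ) - (p + 1 : ℕ) + 1 + 1) t)) t :=
        HasDerivAt.fun_sum fun i _ => (bspline_succ_hasDerivAt p _ h0 h1).const_mul _
      have z : (fun t => ∑ i ∈ Finset.range (p + 1 + 1),
          u i * bspline 1 (p + 1) ((i : ℤ) - (p + 1 : ℕ) + 1) t) =ᶠ[𝓝 t] fun _ => 0 := by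
        filter_upwards [Ioo_mem_nhds h0 h1] with s hs
        exact h s hs.1 hs.2
      have d' := (d.congr_of_eventuallyEq z.symm).unique (hasDerivAt_const t (0 : ℝ))
      simp only [mul_sub, Finset.sum_sub_distrib] at d'
      rw [Finset.sum_range_succ', Finset.sum_range_succ _ (p + 1)] at d'
      have z1 : bspline 1 p (((0 : ℕ) : ℤ) - (p + 1 : ℕ) + 1) t = 0 := by
        by_contra h
        have := (bspline_support h).2
        push_cast at this; linarith
      have z2 : bspline 1 p (((p + 1 : ℕ) : ℤ) - (p + 1 : ℕ) + 1 + 1) t = 0 := by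
        by_contra h
        have := (bspline_support h).1
        push_cast at this; linarith
      rw [z1, z2, mul_zero, mul_zero, add_zero, add_zero, ← Finset.sum_sub_distrib] at d'
      rw [← d']
      refine Finset.sum_congr rfl fun i _ => ?_
      rw [sub_mul]
      congr 3
      · push_cast; ring
      · push_cast; ring
    have hc : ∀ i ≤ p + 1, u i = u 0 := by
      intro i hi
      induction i with
      | zero => rfl
      | succ i ihi => rw [← ihi (by omega)]; linarith [hd i (by omega)]
    have h2 := h (1 / 2) (by norm_num) (by norm_num)
    rw [Finset.sum_congr rfl fun i hi => by
      rw [hc i (by have := Finset.mem_range.1 hi; omega)], ← Finset.mul_sum,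
      sum_bspline_local (p + 1) (by norm_num) (by norm_num), mul_one] at h2
    intro i hi
    rw [hc i hi, h2]

/-- Local stability of cardinal B-splines in `L²`. -/
lemma exists_local_stability (p : ℕ) : ∃ c : ℝ, 0 < c ∧ ∀ u : ℕ → ℝ,
    c * ∑ i ∈ Finset.range (p + 1), u i ^ 2 ≤
      ∫ t in (0 : ℝ)..1, (∑ i ∈ Finset.range (p + 1), u i * bspline 1 p ((i : ℤ) - p + 1) t) ^ 2 := by
  set B : Fin (p + 1) → ℝ → ℝ := fun i t => bspline 1 p (((i : ℕ) : ℤ) - p + 1) t with hB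
  have hBm : ∀ i, Measurable (B i) := fun i => measurable_bspline 1 p _
  have hBb : ∀ i t, |B i t| ≤ 1 := fun i t =>
    abs_le.2 ⟨by linarith [bspline_nonneg p (((i : ℕ) : ℤ) - p + 1) t], bspline_le_one _ _ _⟩
  have hint : ∀ i k, IntervalIntegrable (fun t => B i t * B k t) volume 0 1 := by
    intro i k
    rw [intervalIntegrable_iff]
    refine Measure.integrableOn_of_bounded (M := 1) (by simp)
      ((hBm i).mul (hBm k)).aestronglyMeasurable (Eventually.of_forall fun t => ?_)
    rw [Real.norm_eq_abs, abs_mul]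
    exact mul_le_one₀ (hBb i t) (abs_nonneg _) (hBb k t)
  set g : (Fin (p + 1) → ℝ) → ℝ := fun u => ∫ t in (0 : ℝ)..1, (∑ i, u i * B i t) ^ 2 with hg
  have hg1 : ∀ u, g u = ∑ i, ∑ k, u i * u k * ∫ t in (0 : ℝ)..1, B i t * B k t := by
    intro u
    have hi : ∀ i k, IntervalIntegrable (fun t => u i * B i t * (u k * B k t)) volume 0 1 := by
      intro i k
      have := (hint i k).const_mul (u i * u k)
      refine this.congr fun t _ => ?_
      ring
    have hs : ∀ i, IntervalIntegrable (fun t => ∑ k, u i * B i t * (u k * B k t)) volume 0 1 := by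
      intro i
      have := IntervalIntegrable.sum Finset.univ fun k _ => hi i k
      refine this.congr fun t _ => ?_
      simp
    simp only [hg, sq, Finset.sum_mul_sum]
    rw [intervalIntegral.integral_finsetSum fun i _ => hs i]
    refine Finset.sum_congr rfl fun i _ => ?_
    rw [intervalIntegral.integral_finsetSum fun k _ => hi i k]
    refine Finset.sum_congr rfl fun k _ => ?_
    rw [← intervalIntegral.integral_const_mul]
    congr 1; ext t; ring
  have hgc : Continuous g := by
    have : g = fun u => ∑ i, ∑ k, u i * u k * ∫ t in (0 : ℝ)..1, B i t * B k t := funext hg1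
    rw [this]; fun_prop
  -- A zero integral forces the spline to vanish almost everywhere, then everywhere on the open cell
  -- by continuity, and local independence applies.
  have hg0 : ∀ u, u ≠ 0 → 0 < g u := by
    intro u hu
    refine lt_of_le_of_ne (intervalIntegral.integral_nonneg zero_le_one fun t _ => sq_nonneg _) ?_
    intro h0
    apply hu
    have hsm : Measurable fun t => ∑ i, u i * B i t := by fun_prop
    have h1 : ∀ᵐ t ∂(volume.restrict (Ioo (0 : ℝ) 1)), (∑ i, u i * B i t) ^ 2 = 0 := by
      rw [hg] at h0
      simp only at h0
      rw [intervalIntegral.integral_of_le zero_le_one, integral_Ioc_eq_integral_Ioo] at h0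
      have := (integral_eq_zero_iff_of_nonneg (fun t => sq_nonneg _) ?_).1 h0.symm
      · exact this
      · refine Measure.integrableOn_of_bounded (M := (∑ i, |u i|) ^ 2) (by simp)
          (hsm.pow_const 2).aestronglyMeasurable (Eventually.of_forall fun t => ?_)
        rw [Real.norm_eq_abs, abs_pow]
        refine pow_le_pow_left₀ (abs_nonneg _) ?_ 2
        refine (Finset.abs_sum_le_sum_abs _ _).trans (Finset.sum_le_sum fun i _ => ?_)
        rw [abs_mul]; exact mul_le_of_le_one_right (abs_nonneg _) (hBb i t)
    have hsc : ContinuousOn (fun t => ∑ i, u i * B i t) (Ioo (0 : ℝ) 1) := by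
      refine continuousOn_finsetSum _ fun i _ => ContinuousOn.mul continuousOn_const ?_
      exact fun t ht => (bspline_continuousAt p _ ht.1 ht.2).continuousWithinAt
    have h2 : EqOn (fun t => ∑ i, u i * B i t) (fun _ => 0) (Ioo (0 : ℝ) 1) := by
      refine Measure.eqOn_open_of_ae_eq (μ := volume) ?_ isOpen_Ioo hsc continuousOn_const
      filter_upwards [h1] with t ht
      exact pow_eq_zero_iff (two_ne_zero) |>.1 ht
    have h3 := bspline_local_linearIndependent p
      (fun i => if h : i < p + 1 then u ⟨i, h⟩ else 0) fun t ht0 ht1 => by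
        rw [Finset.sum_range]
        refine Eq.trans (Finset.sum_congr rfl fun i _ => ?_) (h2 ⟨ht0, ht1⟩)
        rw [dif_pos i.2]
    ext i
    have := h3 i (by omega)
    rwa [dif_pos i.2] at this
  have hcomp : IsCompact {u : Fin (p + 1) → ℝ | ∑ i, u i ^ 2 = 1} := by
    refine Metric.isCompact_of_isClosed_isBounded (isClosed_eq (by fun_prop) continuous_const) ?_
    refine (Metric.isBounded_closedBall (x := (0 : Fin (p + 1) → ℝ)) (r := 1)).subset fun u hu => ?_
    rw [mem_closedBall_zero_iff, pi_norm_le_iff_of_nonneg zero_le_one]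
    intro i
    rw [Real.norm_eq_abs, ← sq_le_one_iff_abs_le_one]
    have hu' : ∑ i, u i ^ 2 = 1 := hu
    rw [← hu']
    exact Finset.single_le_sum (f := fun i => u i ^ 2) (fun _ _ => sq_nonneg _) (Finset.mem_univ i)
  -- The stability constant is the minimum of the quadratic form over the unit sphere; homogeneity
  -- extends it to all coefficient vectors.
  obtain ⟨u₀, hu₀, hmin⟩ := hcomp.exists_isMinOn
    ⟨Pi.single 0 1, by simp [Pi.single_apply]⟩ hgc.continuousOn
  have hu₀' : ∑ i, u₀ i ^ 2 = 1 := hu₀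
  refine ⟨g u₀, hg0 u₀ ?_, fun u => ?_⟩
  · rintro rfl; simp at hu₀'
  · have e1 : ∑ i ∈ Finset.range (p + 1), u i ^ 2 = ∑ i : Fin (p + 1), u i ^ 2 :=
      Finset.sum_range fun i => u i ^ 2
    have e2 : (∫ t in (0 : ℝ)..1,
        (∑ i ∈ Finset.range (p + 1), u i * bspline 1 p ((i : ℤ) - p + 1) t) ^ 2)
        = g fun i => u i := by
      simp only [hg, hB, Finset.sum_range]
    rw [e2]
    set v : Fin (p + 1) → ℝ := fun i => u i with hv
    set s := ∑ i, v i ^ 2 with hs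
    have hs0 : 0 ≤ s := Finset.sum_nonneg fun _ _ => sq_nonneg _
    rcases hs0.eq_or_lt with h0 | h0
    · rw [e1, ← h0, mul_zero]
      exact intervalIntegral.integral_nonneg zero_le_one fun t _ => sq_nonneg _
    · rw [e1]
      have hmem : (√s)⁻¹ • v ∈ {u : Fin (p + 1) → ℝ | ∑ i, u i ^ 2 = 1} := by
        change ∑ i, ((√s)⁻¹ • v) i ^ 2 = 1
        simp only [Pi.smul_apply, smul_eq_mul, mul_pow, ← Finset.mul_sum, inv_pow,
          Real.sq_sqrt hs0]
        exact inv_mul_cancel₀ h0.ne'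
      have h1 : g u₀ ≤ g ((√s)⁻¹ • v) := hmin hmem
      have h2 : g ((√s)⁻¹ • v) = s⁻¹ * g v := by
        rw [hg1, hg1, Finset.mul_sum]
        refine Finset.sum_congr rfl fun i _ => ?_
        rw [Finset.mul_sum]
        refine Finset.sum_congr rfl fun k _ => ?_
        have : (√s)⁻¹ * (√s)⁻¹ = s⁻¹ := by rw [← mul_inv, Real.mul_self_sqrt hs0]
        simp only [Pi.smul_apply, smul_eq_mul]
        linear_combination (v i * v k * ∫ t in (0 : ℝ)..1, B i t * B k t) * this
      rw [h2] at h1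
      have h3 : g u₀ * s ≤ s⁻¹ * g v * s := mul_le_mul_of_nonneg_right h1 hs0
      have h4 : s⁻¹ * g v * s = g v := by field_simp
      rw [h4] at h3
      exact h3

/-! ### The B-spline vector -/

section Bvec

variable {p K : ℕ}

lemma bvec_eq (hK : 0 < K) (x : ℝ) (k : Fin (K + p)) :
    bvec p K x k = bspline 1 p ((k : ℤ) - p + 1) (K * x) := bspline_scale hK _ _ _

lemma bvec_nonneg (hK : 0 < K) (x : ℝ) (k : Fin (K + p)) : 0 ≤ bvec p K x k := by
  rw [bvec_eq hK]; exact bspline_nonneg _ _ _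

lemma bvec_le_one (hK : 0 < K) (x : ℝ) (k : Fin (K + p)) : bvec p K x k ≤ 1 := by
  rw [bvec_eq hK]; exact bspline_le_one _ _ _

lemma abs_bvec_le_one (hK : 0 < K) (x : ℝ) (k : Fin (K + p)) : |bvec p K x k| ≤ 1 := by
  rw [abs_of_nonneg (bvec_nonneg hK x k)]; exact bvec_le_one hK x k

lemma measurable_bvec (p K : ℕ) (k : Fin (K + p)) : Measurable fun x => bvec p K x k :=
  measurable_bspline _ _ _

lemma bvec_support (hK : 0 < K) {x : ℝ} {k : Fin (K + p)} (h : bvec p K x k ≠ 0) :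
    (k : ℝ) - p < K * x ∧ K * x ≤ k + 1 := by
  rw [bvec_eq hK] at h
  have := bspline_support h
  push_cast at this
  constructor <;> linarith

lemma bvec_close (hK : 0 < K) {x : ℝ} {i k : Fin (K + p)} (hi : bvec p K x i ≠ 0)
    (hk : bvec p K x k ≠ 0) : (i : ℕ) ≤ k + p ∧ (k : ℕ) ≤ i + p := by
  have h1 := bvec_support hK hi
  have h2 := bvec_support hK hk
  have h3 : ((i : ℕ) : ℝ) < (k : ℕ) + p + 1 := by linarith
  have h4 : ((k : ℕ) : ℝ) < (i : ℕ) + p + 1 := by linarith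
  have h3' : (i : ℕ) < k + p + 1 := by exact_mod_cast h3
  have h4' : (k : ℕ) < i + p + 1 := by exact_mod_cast h4
  omega

/-- Extension of a coefficient vector by zero. -/
def extend {N : ℕ} (u : Fin N → ℝ) (i : ℕ) : ℝ := if h : i < N then u ⟨i, h⟩ else 0

lemma extend_coe {N : ℕ} (u : Fin N → ℝ) (i : Fin N) : extend u i = u i := by simp [extend]

/-- On the cell ν only the coefficients ν, …, ν + p are active, and the spline there is a rescaled
copy of one on the reference cell. -/
lemma bvec_dotProduct_local (hK : 0 < K) {x : ℝ} {ν : ℕ} (hν : ν < K) (h0 : (ν : ℝ) < K * x)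
    (h1 : K * x ≤ ν + 1) (u : Fin (K + p) → ℝ) :
    bvec p K x ⬝ᵥ u = ∑ i ∈ Finset.range (p + 1),
      extend u (ν + i) * bspline 1 p ((i : ℤ) - p + 1) (K * x - ν) := by
  have e1 : bvec p K x ⬝ᵥ u = ∑ i ∈ Finset.range (K + p),
      extend u i * bspline 1 p ((i : ℤ) - p + 1) (K * x) := by
    rw [Finset.sum_range, dotProduct]
    refine Finset.sum_congr rfl fun k _ => ?_
    rw [bvec_eq hK, extend_coe, mul_comm]
  have e2 : ∑ i ∈ Finset.range (p + 1),
      extend u (ν + i) * bspline 1 p ((i : ℤ) - p + 1) (K * x - ν)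
      = ∑ i ∈ Finset.Ico ν (ν + (p + 1)),
        extend u i * bspline 1 p ((i : ℤ) - p + 1) (K * x) := by
    rw [Finset.sum_Ico_eq_sum_range, Nat.add_sub_cancel_left]
    refine Finset.sum_congr rfl fun i _ => ?_
    congr 1
    rw [← bspline_translate p ((i : ℤ) - p + 1) ν (K * x - ν)]
    congr 1
    · push_cast; ring
    · push_cast; ring
  rw [e1, e2]
  symm
  refine Finset.sum_subset (fun i hi => ?_) fun i _ hi => ?_
  · simp only [Finset.mem_Ico, Finset.mem_range] at *; omega
  · simp only [Finset.mem_Ico, not_and_or, not_le, not_lt] at hi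
    by_contra h
    have h2 := bspline_support (right_ne_zero_of_mul h)
    push_cast at h2
    rcases hi with hi | hi
    · have : (i : ℝ) + 1 ≤ ν := by exact_mod_cast hi
      linarith
    · have : (ν : ℝ) + (p + 1) ≤ i := by exact_mod_cast hi
      linarith

lemma exists_cell (hK : 0 < K) {x : ℝ} (hx : x ∈ Ioo (0 : ℝ) 1) :
    ∃ ν < K, (ν : ℝ) < K * x ∧ K * x ≤ ν + 1 := by
  have hK' : (0 : ℝ) < K := by exact_mod_cast hK
  have hpos : 0 < K * x := mul_pos hK' hx.1
  have hc : 0 < ⌈K * x⌉₊ := Nat.ceil_pos.2 hpos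
  have hle : ⌈K * x⌉₊ ≤ K := Nat.ceil_le.2 (by nlinarith [hx.2])
  have h1 := Nat.ceil_lt_add_one hpos.le
  have h2 := Nat.le_ceil (K * x)
  have h3 : ((⌈K * x⌉₊ - 1 : ℕ) : ℝ) = (⌈K * x⌉₊ : ℝ) - 1 := by
    rw [Nat.cast_sub hc]; simp
  refine ⟨⌈K * x⌉₊ - 1, by omega, ?_, ?_⟩ <;> rw [h3] <;> linarith

lemma bvec_dotProduct_one (hK : 0 < K) {x : ℝ} (hx : x ∈ Ioo (0 : ℝ) 1) :
    bvec p K x ⬝ᵥ (1 : Fin (K + p) → ℝ) = 1 := by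
  obtain ⟨ν, hν, h0, h1⟩ := exists_cell hK hx
  rw [bvec_dotProduct_local hK hν h0 h1,
    ← sum_bspline_local p (t := K * x - ν) (by linarith) (by linarith)]
  refine Finset.sum_congr rfl fun i hi => ?_
  have := Finset.mem_range.1 hi
  rw [extend, dif_pos (by omega), Pi.one_apply, one_mul]

lemma sum_bvec (hK : 0 < K) {x : ℝ} (hx : x ∈ Ioo (0 : ℝ) 1) : ∑ k, bvec p K x k = 1 := by
  simpa [dotProduct] using bvec_dotProduct_one (p := p) hK hx

lemma abs_bvec_dotProduct_le (hK : 0 < K) {x : ℝ} (hx : x ∈ Ioo (0 : ℝ) 1)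
    {u : Fin (K + p) → ℝ} {b : ℝ} (h : ∀ k, bvec p K x k ≠ 0 → |u k| ≤ b) :
    |bvec p K x ⬝ᵥ u| ≤ b := by
  calc |bvec p K x ⬝ᵥ u| ≤ ∑ k, bvec p K x k * b := by
        refine (Finset.abs_sum_le_sum_abs _ _).trans (Finset.sum_le_sum fun k _ => ?_)
        rw [abs_mul, abs_of_nonneg (bvec_nonneg hK x k)]
        by_cases h0 : bvec p K x k = 0
        · simp [h0]
        · exact mul_le_mul_of_nonneg_left (h k h0) (bvec_nonneg hK x k)
    _ = b := by rw [← Finset.sum_mul, sum_bvec hK hx, one_mul]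

lemma measurable_bvec_dotProduct (u : Fin (K + p) → ℝ) :
    Measurable fun x => bvec p K x ⬝ᵥ u := by
  have := measurable_bvec p K
  unfold dotProduct
  fun_prop

lemma abs_bvec_dotProduct_le_sum (hK : 0 < K) (x : ℝ) (u : Fin (K + p) → ℝ) :
    |bvec p K x ⬝ᵥ u| ≤ ∑ k, |u k| := by
  refine (Finset.abs_sum_le_sum_abs _ _).trans (Finset.sum_le_sum fun k _ => ?_)
  rw [abs_mul]; exact mul_le_of_le_one_left (abs_nonneg _) (abs_bvec_le_one hK x k)

/-! ### Integrals of splines and stability of the basis. -/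

lemma integrableOn_of_measurable_bdd {h : ℝ → ℝ} (hm : Measurable h) {C : ℝ}
    (hb : ∀ t, |h t| ≤ C) {s : Set ℝ} (hs : volume s ≠ ⊤) : IntegrableOn h s :=
  Measure.integrableOn_of_bounded hs hm.aestronglyMeasurable (Eventually.of_forall hb)

lemma intervalIntegrable_of_measurable_bdd {h : ℝ → ℝ} (hm : Measurable h) {C : ℝ}
    (hb : ∀ t, |h t| ≤ C) (a b : ℝ) : IntervalIntegrable h volume a b :=
  intervalIntegrable_iff.2 (integrableOn_of_measurable_bdd hm hb (by simp [uIoc]))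

lemma abs_bvec_dotProduct_sq_le (hK : 0 < K) (x : ℝ) (u : Fin (K + p) → ℝ) :
    |(bvec p K x ⬝ᵥ u) ^ 2| ≤ (∑ k, |u k|) ^ 2 := by
  rw [abs_pow]; exact pow_le_pow_left₀ (abs_nonneg _) (abs_bvec_dotProduct_le_sum hK x u) 2

/-- The function is at most 1 and lives on p + 1 cells; the powers of K in the moment bounds start
here. -/
lemma integral_bvec_le (hK : 0 < K) (k : Fin (K + p)) :
    ∫ t in (0 : ℝ)..1, bvec p K t k ≤ (p + 1) / K := by
  have hK' : (0 : ℝ) < K := by exact_mod_cast hK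
  have hle : ((k : ℝ) - p) / K ≤ ((k : ℝ) + 1) / K := by
    have : (0 : ℝ) ≤ p := by positivity
    gcongr; linarith
  rw [intervalIntegral.integral_of_le zero_le_one]
  have h1 : ∫ t in Ioc (0 : ℝ) 1, bvec p K t k
      ≤ ∫ t in Ioc (0 : ℝ) 1, (Ioc (((k : ℝ) - p) / K) (((k : ℝ) + 1) / K)).indicator 1 t := by
    refine setIntegral_mono_on
      (integrableOn_of_measurable_bdd (measurable_bvec p K k) (abs_bvec_le_one hK · k) (by simp))
      ((integrable_const (1 : ℝ)).indicator measurableSet_Ioc) measurableSet_Ioc fun t _ => ?_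
    by_cases h0 : bvec p K t k = 0
    · rw [h0]; exact indicator_nonneg (fun _ _ => zero_le_one) _
    · have hs := bvec_support hK h0
      rw [indicator_of_mem]
      · exact bvec_le_one hK t k
      · constructor
        · rw [div_lt_iff₀' hK']; exact hs.1
        · rw [le_div_iff₀' hK']; exact hs.2
  refine h1.trans ?_
  rw [setIntegral_indicator measurableSet_Ioc]
  simp only [Pi.one_apply, integral_const, smul_eq_mul, mul_one, MeasurableSet.univ,
    measureReal_restrict_apply, univ_inter]
  calc volume.real (Ioc (0 : ℝ) 1 ∩ Ioc (((k : ℝ) - p) / K) (((k : ℝ) + 1) / K))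
      ≤ volume.real (Ioc (((k : ℝ) - p) / K) (((k : ℝ) + 1) / K)) :=
        measureReal_mono inter_subset_right (by simp)
    _ = (p + 1) / K := by
        rw [Real.volume_real_Ioc_of_le hle]; field_simp; ring

lemma integral_cell_sq (hK : 0 < K) {ν : ℕ} (hν : ν < K) (u : Fin (K + p) → ℝ) :
    ∫ t in ((ν : ℝ) / K)..(((ν + 1 : ℕ) : ℝ) / K), (bvec p K t ⬝ᵥ u) ^ 2 =
      (K : ℝ)⁻¹ * ∫ t in (0 : ℝ)..1, (∑ i ∈ Finset.range (p + 1),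
        extend u (ν + i) * bspline 1 p ((i : ℤ) - p + 1) t) ^ 2 := by
  have hK' : (0 : ℝ) < K := by exact_mod_cast hK
  have h1 := intervalIntegral.integral_comp_mul_sub (a := (ν : ℝ) / K)
    (b := ((ν + 1 : ℕ) : ℝ) / K) (fun t => (∑ i ∈ Finset.range (p + 1),
        extend u (ν + i) * bspline 1 p ((i : ℤ) - p + 1) t) ^ 2) hK'.ne' (ν : ℝ)
  have e1 : (K : ℝ) * (ν / K) - ν = 0 := by field_simp; ring
  have e2 : (K : ℝ) * (((ν + 1 : ℕ) : ℝ) / K) - ν = 1 := by push_cast; field_simp; ring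
  rw [e1, e2, smul_eq_mul] at h1
  rw [← h1]
  have hle : (ν : ℝ) / K ≤ ((ν + 1 : ℕ) : ℝ) / K := by push_cast; gcongr; linarith
  rw [intervalIntegral.integral_of_le hle, intervalIntegral.integral_of_le hle]
  refine setIntegral_congr_fun measurableSet_Ioc fun t ht => ?_
  have h2 : (ν : ℝ) < K * t := (div_lt_iff₀' hK').1 ht.1
  have h3 : K * t ≤ (ν : ℝ) + 1 := by
    have := (le_div_iff₀' hK').1 ht.2
    push_cast at this; exact this
  rw [bvec_dotProduct_local hK hν h2 h3]

/-- Stability of the B-spline basis in `L²(0,1)`, and locally in the supremum norm. -/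
lemma exists_stability (p : ℕ) : ∃ c : ℝ, 0 < c ∧ ∀ K : ℕ, 0 < K → ∀ u : Fin (K + p) → ℝ,
    c / K * l2 u ^ 2 ≤ (∫ t in (0 : ℝ)..1, (bvec p K t ⬝ᵥ u) ^ 2) ∧
    ∀ b : ℝ, (∀ t ∈ Ioo (0 : ℝ) 1, |bvec p K t ⬝ᵥ u| ≤ b) → ∀ k, c * u k ^ 2 ≤ b ^ 2 := by
  obtain ⟨c, hc, hst⟩ := exists_local_stability p
  refine ⟨c, hc, fun K hK u => ?_⟩
  have hK' : (0 : ℝ) < K := by exact_mod_cast hK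
  have hcell : ∀ ν < K, c / K * ∑ i ∈ Finset.range (p + 1), extend u (ν + i) ^ 2 ≤
      ∫ t in ((ν : ℝ) / K)..(((ν + 1 : ℕ) : ℝ) / K), (bvec p K t ⬝ᵥ u) ^ 2 := by
    intro ν hν
    rw [integral_cell_sq hK hν]
    have := mul_le_mul_of_nonneg_left (hst fun i => extend u (ν + i)) (inv_nonneg.2 hK'.le)
    refine le_trans (le_of_eq ?_) this
    rw [div_eq_mul_inv]; ring
  -- Every basis function is active on some cell inside (0,1); the last p indices are all seen from
  -- the cell K - 1.
  have hidx : ∀ k : Fin (K + p), ∃ ν < K, ∃ i < p + 1, (k : ℕ) = ν + i := by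
    intro k
    by_cases h : (k : ℕ) < K
    · exact ⟨k, h, 0, by omega, by omega⟩
    · exact ⟨K - 1, by omega, k - (K - 1), by omega, by omega⟩
  constructor
  · have hi := intervalIntegral.sum_integral_adjacent_intervals (μ := volume)
      (f := fun t => (bvec p K t ⬝ᵥ u) ^ 2) (a := fun ν : ℕ => (ν : ℝ) / K) (n := K)
      fun ν _ => intervalIntegrable_of_measurable_bdd
        ((measurable_bvec_dotProduct u).pow_const 2) (abs_bvec_dotProduct_sq_le hK · u) _ _
    rw [Nat.cast_zero, zero_div, div_self hK'.ne'] at hi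
    rw [← hi]
    refine le_trans ?_ (Finset.sum_le_sum fun ν hν => hcell ν (Finset.mem_range.1 hν))
    rw [← Finset.mul_sum]
    refine mul_le_mul_of_nonneg_left ?_ (by positivity)
    rw [l2_sq, ← Finset.sum_product']
    have e1 : ∑ k, u k ^ 2 = ∑ k : Fin (K + p), extend u (k : ℕ) ^ 2 := by simp [extend_coe]
    rw [e1, ← Finset.sum_range (f := fun k => extend u k ^ 2)]
    have : Finset.range (K + p) ⊆
        (Finset.range K ×ˢ Finset.range (p + 1)).image fun x => x.1 + x.2 := by
      intro k hk
      obtain ⟨ν, hν, i, hi, e⟩ := hidx ⟨k, Finset.mem_range.1 hk⟩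
      exact Finset.mem_image.2 ⟨(ν, i), by simp [hν, hi], e.symm⟩
    refine (Finset.sum_le_sum_of_subset_of_nonneg this fun _ _ _ => sq_nonneg _).trans ?_
    exact Finset.sum_image_le_of_nonneg (g := fun x : ℕ × ℕ => x.1 + x.2)
      (f := fun k => extend u k ^ 2) fun _ _ => sq_nonneg _
  · intro b hb k
    obtain ⟨ν, hν, i, hi, e⟩ := hidx k
    have h1 := hcell ν hν
    have hle : (ν : ℝ) / K ≤ ((ν + 1 : ℕ) : ℝ) / K := by push_cast; gcongr; linarith
    have h2 : ∫ t in ((ν : ℝ) / K)..(((ν + 1 : ℕ) : ℝ) / K), (bvec p K t ⬝ᵥ u) ^ 2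
        ≤ ∫ t in ((ν : ℝ) / K)..(((ν + 1 : ℕ) : ℝ) / K), b ^ 2 := by
      refine intervalIntegral.integral_mono_on_of_le_Ioo hle
        (intervalIntegrable_of_measurable_bdd
        ((measurable_bvec_dotProduct u).pow_const 2) (abs_bvec_dotProduct_sq_le hK · u) _ _)
        (by simp) fun t ht => ?_
      have ht1 : t ∈ Ioo (0 : ℝ) 1 := by
        refine ⟨lt_of_le_of_lt (by positivity) ht.1, lt_of_lt_of_le ht.2 ?_⟩
        rw [div_le_one hK']; exact_mod_cast hν
      exact sq_le_sq.2 ((hb t ht1).trans (le_abs_self b))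
    rw [intervalIntegral.integral_const, smul_eq_mul] at h2
    have h3 : extend u (ν + i) ^ 2 ≤ ∑ i ∈ Finset.range (p + 1), extend u (ν + i) ^ 2 :=
      Finset.single_le_sum (f := fun i => extend u (ν + i) ^ 2) (fun _ _ => sq_nonneg _)
        (Finset.mem_range.2 hi)
    rw [← e, extend_coe] at h3
    have h4 : ((ν + 1 : ℕ) : ℝ) / K - ν / K = 1 / K := by push_cast; field_simp; ring
    rw [h4] at h2
    have h5 : c / K * u k ^ 2 ≤ 1 / K * b ^ 2 :=
      (mul_le_mul_of_nonneg_left h3 (by positivity)).trans (h1.trans h2)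
    rw [div_mul_eq_mul_div, div_mul_eq_mul_div, one_mul] at h5
    exact (div_le_div_iff_of_pos_right hK').1 h5

/-! ### Approximation of Lipschitz functions -/

/-- The coefficients `f(κ_k)`, with the knots clamped to `[0,1]`. -/
def knotCoef (p K : ℕ) (f : ℝ → ℝ) : Fin (K + p) → ℝ :=
  fun k => f (projIcc (0 : ℝ) 1 zero_le_one (((k : ℕ) - p + 1 : ℝ) / K))

/-- Clamping to the unit interval is nonexpansive, so the boundary knots do not spoil the Lipschitz
bound. -/
lemma knotCoef_sub_le {f : ℝ → ℝ} {C : NNReal} (hf : LipschitzOnWith C f (Icc 0 1))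
    (i k : Fin (K + p)) :
    |knotCoef p K f i - knotCoef p K f k| ≤ C * |((i : ℕ) : ℝ) - (k : ℕ)| / K := by
  have h1 := hf.dist_le_mul _ (projIcc (0 : ℝ) 1 zero_le_one (((i : ℕ) - p + 1 : ℝ) / K)).2
    _ (projIcc (0 : ℝ) 1 zero_le_one (((k : ℕ) - p + 1 : ℝ) / K)).2
  rw [Real.dist_eq] at h1
  refine h1.trans ?_
  rw [mul_div_assoc]
  refine mul_le_mul_of_nonneg_left ?_ C.2
  have h2 := abs_projIcc_sub_projIcc (zero_le_one (α := ℝ)) (c := (((i : ℕ) - p + 1 : ℝ) / K))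
    (d := (((k : ℕ) - p + 1 : ℝ) / K))
  rw [Real.dist_eq]
  refine h2.trans (le_of_eq ?_)
  rw [← sub_div, abs_div, Nat.abs_cast]
  congr 2; ring

/-- By the partition of unity the error is an average of f(x) - f(κ_k) over the basis functions
active at x, whose knots are within (p + 1)/K of x. The rate 1/K is all that the stated remainder
requires. -/
lemma abs_sub_knotCoef_le (hK : 0 < K) {f : ℝ → ℝ} {C : NNReal}
    (hf : LipschitzOnWith C f (Icc 0 1)) {x : ℝ} (hx : x ∈ Ioo (0 : ℝ) 1) :
    |f x - bvec p K x ⬝ᵥ knotCoef p K f| ≤ C * (p + 1) / K := by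
  have hK' : (0 : ℝ) < K := by exact_mod_cast hK
  have e : f x - bvec p K x ⬝ᵥ knotCoef p K f
      = bvec p K x ⬝ᵥ (f x • (1 : Fin (K + p) → ℝ) - knotCoef p K f) := by
    rw [dotProduct_sub, dotProduct_smul, bvec_dotProduct_one hK hx, smul_eq_mul, mul_one]
  rw [e]
  refine abs_bvec_dotProduct_le hK hx fun k hk => ?_
  have hs := bvec_support hK hk
  simp only [Pi.sub_apply, Pi.smul_apply, Pi.one_apply, smul_eq_mul, mul_one, knotCoef]
  have hx' : x ∈ Icc (0 : ℝ) 1 := Ioo_subset_Icc_self hx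
  have h1 := hf.dist_le_mul _ hx'
    _ (projIcc (0 : ℝ) 1 zero_le_one (((k : ℕ) - p + 1 : ℝ) / K)).2
  rw [Real.dist_eq] at h1
  refine h1.trans ?_
  rw [mul_div_assoc]
  refine mul_le_mul_of_nonneg_left ?_ C.2
  have h2 := abs_projIcc_sub_projIcc (zero_le_one (α := ℝ)) (c := x)
    (d := (((k : ℕ) - p + 1 : ℝ) / K))
  rw [projIcc_of_mem _ hx'] at h2
  rw [Real.dist_eq]
  refine h2.trans ?_
  rw [le_div_iff₀ hK', ← abs_of_pos hK', ← abs_mul, abs_of_pos hK', sub_mul,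
    div_mul_cancel₀ _ hK'.ne']
  have hp : (0 : ℝ) ≤ p := by positivity
  rw [abs_le]
  constructor <;> linarith

/-- A competitor with a finite error brings the extended-real supremum back to a pointwise real
bound. -/
lemma IsBestApprox.abs_sub_le {f : ℝ → ℝ} {b c : Fin (K + p) → ℝ} (h : IsBestApprox p K f b)
    {δ : ℝ} (hδ : 0 ≤ δ) (hc : ∀ x ∈ Ioo (0 : ℝ) 1, |f x - bvec p K x ⬝ᵥ c| ≤ δ) {x : ℝ}
    (hx : x ∈ Ioo (0 : ℝ) 1) : |f x - bvec p K x ⬝ᵥ b| ≤ δ := by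
  have h1 : (⨆ x ∈ Ioo (0 : ℝ) 1, ENNReal.ofReal |f x - bvec p K x ⬝ᵥ c|) ≤ ENNReal.ofReal δ :=
    iSup₂_le fun x hx => ENNReal.ofReal_le_ofReal (hc x hx)
  have h2 : ENNReal.ofReal |f x - bvec p K x ⬝ᵥ b|
      ≤ ⨆ x ∈ Ioo (0 : ℝ) 1, ENNReal.ofReal |f x - bvec p K x ⬝ᵥ b| :=
    le_iSup₂ (f := fun x _ => ENNReal.ofReal |f x - bvec p K x ⬝ᵥ b|) x hx
  exact (ENNReal.ofReal_le_ofReal_iff hδ).1 (h2.trans ((h c).trans h1))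

end Bvec

/-! ### The difference penalty -/

section Penalty

variable {m N : ℕ}

lemma diffMatrix_ne_zero {r : Fin (N - m)} {k : Fin N} (h : diffMatrix m N r k ≠ 0) :
    (r : ℕ) ≤ k ∧ (k : ℕ) ≤ r + m := by
  simp only [diffMatrix, Matrix.of_apply] at h
  split_ifs at h with h1
  · refine ⟨h1, ?_⟩
    by_contra h2
    apply h
    rw [Nat.choose_eq_zero_of_lt (by omega)]; simp
  · exact absurd rfl h

lemma abs_diffMatrix_le (r : Fin (N - m)) (k : Fin N) : |diffMatrix m N r k| ≤ 2 ^ m := by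
  simp only [diffMatrix, Matrix.of_apply]
  split_ifs with h1
  · rw [abs_mul, abs_pow, abs_neg, abs_one, one_pow, one_mul, Nat.abs_cast]
    exact_mod_cast Nat.choose_le_two_pow _ _
  · simp

/-- The alternating sum of binomial coefficients vanishes for m ≥ 1. Constants are therefore
unpenalized, so the penalty preserves the exchange of constants between the two components. -/
lemma diffMatrix_mulVec_one (hm : 1 ≤ m) : diffMatrix m N *ᵥ 1 = 0 := by
  ext r
  have hr := r.2
  simp only [Matrix.mulVec, dotProduct, Pi.one_apply, mul_one, Pi.zero_apply, diffMatrix,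
    Matrix.of_apply]
  rw [← Finset.sum_range (f := fun k => if (r : ℕ) ≤ k then
    (-1 : ℝ) ^ (m + (k - r)) * (m.choose (k - r) : ℝ) else 0)]
  have h1 : ∑ k ∈ Finset.Ico (r : ℕ) (r + (m + 1)),
      (if (r : ℕ) ≤ k then (-1 : ℝ) ^ (m + (k - r)) * (m.choose (k - r) : ℝ) else 0)
      = ∑ k ∈ Finset.range N,
      if (r : ℕ) ≤ k then (-1 : ℝ) ^ (m + (k - r)) * (m.choose (k - r) : ℝ) else 0 := by
    refine Finset.sum_subset (fun k hk => ?_) fun k _ hk => ?_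
    · simp only [Finset.mem_Ico, Finset.mem_range] at *; omega
    · split_ifs with h2
      · simp only [Finset.mem_Ico, not_and_or, not_le, not_lt] at hk
        rw [Nat.choose_eq_zero_of_lt (by omega)]; simp
      · rfl
  rw [← h1, Finset.sum_Ico_eq_sum_range, Nat.add_sub_cancel_left]
  have h2 : ∀ k ∈ Finset.range (m + 1), (if (r : ℕ) ≤ r + k then
      (-1 : ℝ) ^ (m + (r + k - r)) * (m.choose (r + k - r) : ℝ) else 0)
      = (-1) ^ m * ((-1) ^ k * (m.choose k : ℝ)) := by
    intro k _
    rw [if_pos (by omega), Nat.add_sub_cancel_left, pow_add]; ring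
  rw [Finset.sum_congr rfl h2, ← Finset.mul_sum]
  have h3 := Int.alternating_sum_range_choose_of_ne (n := m) (by omega)
  have h4 : ∑ k ∈ Finset.range (m + 1), (-1 : ℝ) ^ k * (m.choose k : ℝ) = 0 := by
    exact_mod_cast h3
  rw [h4, mul_zero]

lemma penalty_mulVec_one (hm : 1 ≤ m) : penalty m N *ᵥ 1 = 0 := by
  rw [penalty, ← Matrix.mulVec_mulVec, diffMatrix_mulVec_one hm, Matrix.mulVec_zero]

lemma penalty_isSymm : (penalty m N).IsSymm := by
  rw [Matrix.IsSymm, penalty, Matrix.transpose_mul, Matrix.transpose_transpose]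

lemma penalty_nonneg (v : Fin N → ℝ) : 0 ≤ v ⬝ᵥ (penalty m N *ᵥ v) := by
  rw [penalty, ← Matrix.mulVec_mulVec, Matrix.dotProduct_mulVec, Matrix.vecMul_transpose,
    ← l2_sq_eq_dotProduct]
  exact sq_nonneg _

lemma penalty_banded : Banded m (penalty m N) := by
  intro i k h
  rw [penalty, Matrix.mul_apply] at h
  obtain ⟨r, _, hr⟩ := Finset.exists_ne_zero_of_sum_ne_zero h
  have h1 := diffMatrix_ne_zero (left_ne_zero_of_mul hr)
  have h2 := diffMatrix_ne_zero (right_ne_zero_of_mul hr)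
  omega

lemma abs_penalty_le (i k : Fin N) : |penalty m N i k| ≤ (m + 1) * 4 ^ m := by
  rw [penalty, Matrix.mul_apply]
  calc |∑ r, (diffMatrix m N)ᵀ i r * diffMatrix m N r k|
      ≤ ∑ r, |(diffMatrix m N)ᵀ i r * diffMatrix m N r k| := Finset.abs_sum_le_sum_abs _ _
    _ = ∑ r ∈ Finset.univ.filter fun r : Fin (N - m) => (r : ℕ) ≤ i ∧ (i : ℕ) ≤ r + m,
        |(diffMatrix m N)ᵀ i r * diffMatrix m N r k| := by
        symm
        refine Finset.sum_subset (Finset.subset_univ _) fun r _ hr => ?_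
        by_contra h0
        refine hr (Finset.mem_filter.2 ⟨Finset.mem_univ _, diffMatrix_ne_zero fun h => h0 ?_⟩)
        rw [Matrix.transpose_apply, h]; simp
    _ ≤ ∑ r ∈ Finset.univ.filter fun r : Fin (N - m) => (r : ℕ) ≤ i ∧ (i : ℕ) ≤ r + m,
        (4 : ℝ) ^ m := by
        refine Finset.sum_le_sum fun r _ => ?_
        rw [abs_mul, show (4 : ℝ) ^ m = 2 ^ m * 2 ^ m by rw [← mul_pow]; norm_num]
        exact mul_le_mul (abs_diffMatrix_le _ _) (abs_diffMatrix_le _ _) (abs_nonneg _)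
          (by positivity)
    _ ≤ _ := by
        rw [Finset.sum_const, nsmul_eq_mul]
        refine mul_le_mul_of_nonneg_right ?_ (by positivity)
        have : (Finset.univ.filter fun r : Fin (N - m) => (r : ℕ) ≤ i ∧ (i : ℕ) ≤ r + m).card
            ≤ (Finset.Icc ((i : ℕ) - m) i).card := by
          refine Finset.card_le_card_of_injOn (fun r => (r : ℕ)) ?_ (fun x _ y _ h => Fin.ext h)
          intro r hr
          simp only [Finset.coe_filter, Set.mem_ofPred_eq, Finset.mem_univ, true_and] at hr
          simp only [Finset.coe_Icc, Set.mem_Icc]; omega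
        rw [Nat.card_Icc] at this
        have h2 : (Finset.univ.filter fun r : Fin (N - m) =>
            (r : ℕ) ≤ i ∧ (i : ℕ) ≤ r + m).card ≤ m + 1 := by omega
        exact_mod_cast h2

/-- The penalty matrix applied to a vector with small increments. -/
lemma abs_penalty_mulVec_le (hm : 1 ≤ m) {c : Fin N → ℝ} {δ : ℝ}
    (hc : ∀ i k : Fin N, |c i - c k| ≤ δ * |((i : ℕ) : ℝ) - (k : ℕ)|) (hδ : 0 ≤ δ) (i : Fin N) :
    |(penalty m N *ᵥ c) i| ≤ (2 * m + 1) * ((m + 1) * 4 ^ m) * (δ * m) := by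
  -- The rows of the penalty sum to zero, so only increments of c across the band matter.
  have e : (penalty m N *ᵥ c) i = ∑ k, penalty m N i k * (c k - c i) := by
    have h0 : ∑ k, penalty m N i k = 0 := by
      have := congrFun (penalty_mulVec_one (N := N) hm) i
      simpa [Matrix.mulVec, dotProduct] using this
    simp only [mul_sub, Finset.sum_sub_distrib, ← Finset.sum_mul, h0, zero_mul, sub_zero]
    rfl
  rw [e]
  calc _ ≤ ∑ k, |penalty m N i k| * (δ * m) := by
        refine (Finset.abs_sum_le_sum_abs _ _).trans (Finset.sum_le_sum fun k _ => ?_)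
        rw [abs_mul]
        by_cases h0 : penalty m N i k = 0
        · simp [h0]
        · refine mul_le_mul_of_nonneg_left ((hc k i).trans ?_) (abs_nonneg _)
          refine mul_le_mul_of_nonneg_left ?_ hδ
          have h1 := penalty_banded i k h0
          have h2 : ((i : ℕ) : ℝ) ≤ (k : ℕ) + m := by exact_mod_cast h1.1
          have h3 : ((k : ℕ) : ℝ) ≤ (i : ℕ) + m := by exact_mod_cast h1.2
          rw [abs_le]; constructor <;> linarith
    _ ≤ _ := by
        rw [← Finset.sum_mul]
        exact mul_le_mul_of_nonneg_right
          (penalty_banded.sum_abs_le abs_penalty_le i) (by positivity)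

end Penalty

/-! ### Moments of empirical means -/

section Empirical

variable {Ω S : Type*} [MeasurableSpace Ω] [MeasurableSpace S] {P : Measure Ω}
  {X : ℕ → Ω → S} {μ : Measure S}

/-- The empirical mean of `h` over a sample. -/
def empMean {S : Type*} {n : ℕ} (x : Fin n → S) (h : S → ℝ) : ℝ := (1 / (n : ℝ)) * ∑ l, h (x l)

lemma memLp_comp_of_map (hX : ∀ i, Measurable (X i)) (hμ : ∀ i, P.map (X i) = μ) {h : S → ℝ}
    (hh : MemLp h 2 μ) (i : ℕ) : MemLp (fun ω => h (X i ω)) 2 P :=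
  (memLp_map_measure_iff (by rw [hμ]; exact hh.1) (hX i).aemeasurable).1 (by rw [hμ]; exact hh)

lemma memLp_empMean (hX : ∀ i, Measurable (X i)) (hμ : ∀ i, P.map (X i) = μ) {h : S → ℝ}
    (hh : MemLp h 2 μ) (n : ℕ) :
    MemLp (fun ω => empMean (fun l : Fin n => X l ω) h) 2 P :=
  (memLp_finsetSum _ fun _ _ => memLp_comp_of_map hX hμ hh _).const_mul _

variable [IsProbabilityMeasure P]

lemma integral_empMean (hX : ∀ i, Measurable (X i)) (hμ : ∀ i, P.map (X i) = μ) {h : S → ℝ}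
    (hh : MemLp h 2 μ) {n : ℕ} (hn : 0 < n) :
    ∫ ω, empMean (fun l : Fin n => X l ω) h ∂P = ∫ z, h z ∂μ := by
  have h1 : ∀ i, ∫ ω, h (X i ω) ∂P = ∫ z, h z ∂μ := fun i => by
    rw [← hμ i, integral_map (hX i).aemeasurable (by rw [hμ]; exact hh.1)]
  have hn' : (n : ℝ) ≠ 0 := by positivity
  simp only [empMean]
  rw [integral_const_mul, integral_finsetSum _ fun l _ =>
    (memLp_comp_of_map hX hμ hh _).integrable one_le_two]
  simp only [h1, Finset.sum_const, Finset.card_univ, Fintype.card_fin, nsmul_eq_mul]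
  field_simp

lemma variance_empMean_le (hX : ∀ i, Measurable (X i)) (hμ : ∀ i, P.map (X i) = μ)
    (hind : iIndepFun X P) {h : S → ℝ} (hm : Measurable h) (hh : MemLp h 2 μ) {n : ℕ}
    (hn : 0 < n) :
    Var[fun ω => empMean (fun l : Fin n => X l ω) h; P] ≤ (1 / (n : ℝ)) * ∫ z, h z ^ 2 ∂μ := by
  have hn' : (n : ℝ) ≠ 0 := by positivity
  have hind' : iIndepFun (fun (l : Fin n) ω => h (X l ω)) P :=
    (hind.precomp Fin.val_injective).comp (fun _ => h) fun _ => hm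
  have h1 : Var[fun ω => ∑ l : Fin n, h (X l ω); P] = ∑ l : Fin n, Var[fun ω => h (X l ω); P] := by
    have := IndepFun.variance_sum (μ := P) (X := fun (l : Fin n) ω => h (X l ω))
      (s := Finset.univ) (fun l _ => memLp_comp_of_map hX hμ hh l)
      (fun l _ l' _ hne => hind'.indepFun hne)
    rw [← this]; congr 1; ext ω; simp
  have h2 : ∀ i, Var[fun ω => h (X i ω); P] ≤ ∫ z, h z ^ 2 ∂μ := by
    intro i
    refine (variance_le_expectation_sq (memLp_comp_of_map hX hμ hh i).1).trans (le_of_eq ?_)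
    rw [← hμ i, integral_map (hX i).aemeasurable (hm.pow_const 2).aestronglyMeasurable]
    rfl
  simp only [empMean]
  rw [variance_const_mul, h1]
  calc (1 / (n : ℝ)) ^ 2 * ∑ l : Fin n, Var[fun ω => h (X l ω); P]
      ≤ (1 / (n : ℝ)) ^ 2 * ∑ _l : Fin n, ∫ z, h z ^ 2 ∂μ := by
        gcongr with l; exact h2 l
    _ = _ := by
        simp only [Finset.sum_const, Finset.card_univ, Fintype.card_fin, nsmul_eq_mul]
        field_simp

lemma integral_sq_empMean_sub_le (hX : ∀ i, Measurable (X i)) (hμ : ∀ i, P.map (X i) = μ)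
    (hind : iIndepFun X P) {h : S → ℝ} (hm : Measurable h) (hh : MemLp h 2 μ) {n : ℕ}
    (hn : 0 < n) :
    ∫ ω, (empMean (fun l : Fin n => X l ω) h - ∫ z, h z ∂μ) ^ 2 ∂P
      ≤ (1 / (n : ℝ)) * ∫ z, h z ^ 2 ∂μ := by
  rw [← integral_empMean hX hμ hh hn,
    ← variance_eq_integral (memLp_empMean hX hμ hh n).1.aemeasurable]
  exact variance_empMean_le hX hμ hind hm hh hn

lemma integral_sq_empMean_le (hX : ∀ i, Measurable (X i)) (hμ : ∀ i, P.map (X i) = μ)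
    (hind : iIndepFun X P) {h : S → ℝ} (hm : Measurable h) (hh : MemLp h 2 μ) {n : ℕ}
    (hn : 0 < n) :
    ∫ ω, (empMean (fun l : Fin n => X l ω) h) ^ 2 ∂P
      ≤ (1 / (n : ℝ)) * ∫ z, h z ^ 2 ∂μ + (∫ z, h z ∂μ) ^ 2 := by
  have h1 := variance_eq_sub (memLp_empMean (P := P) hX hμ hh n)
  have h2 := variance_empMean_le hX hμ hind hm hh hn
  rw [integral_empMean hX hμ hh hn] at h1
  have h3 : ∫ ω, (empMean (fun l : Fin n => X l ω) h) ^ 2 ∂P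
    = ∫ ω, ((fun ω => empMean (fun l : Fin n => X l ω) h) ^ 2) ω ∂P := rfl
  rw [h3]; linarith

/-- Markov's inequality for a weighted sum of squares. -/
lemma measure_lt_sum_sq_le {ι : Type*} [Fintype ι] {Z : ι → Ω → ℝ} (hZ : ∀ a, MemLp (Z a) 2 P)
    {w B : ι → ℝ} (hw : ∀ a, 0 ≤ w a) (hB : ∀ a, ∫ ω, Z a ω ^ 2 ∂P ≤ B a) {t : ℝ} (ht : 0 < t) :
    P {ω | t < ∑ a, w a * Z a ω ^ 2} ≤ ENNReal.ofReal ((∑ a, w a * B a) / t) := by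
  have hint : Integrable (fun ω => ∑ a, w a * Z a ω ^ 2) P :=
    integrable_finsetSum _ fun a _ => (hZ a).integrable_sq.const_mul _
  have h1 := mul_meas_ge_le_integral_of_nonneg (μ := P) (f := fun ω => ∑ a, w a * Z a ω ^ 2)
    (Eventually.of_forall fun ω => Finset.sum_nonneg fun a _ => mul_nonneg (hw a) (sq_nonneg _))
    hint t
  have h2 : ∫ ω, ∑ a, w a * Z a ω ^ 2 ∂P ≤ ∑ a, w a * B a := by
    rw [integral_finsetSum _ fun a _ => (hZ a).integrable_sq.const_mul _]
    refine Finset.sum_le_sum fun a _ => ?_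
    rw [integral_const_mul]
    exact mul_le_mul_of_nonneg_left (hB a) (hw a)
  have h3 : P.real {ω | t < ∑ a, w a * Z a ω ^ 2} ≤ (∑ a, w a * B a) / t := by
    rw [le_div_iff₀' ht]
    refine le_trans (mul_le_mul_of_nonneg_left ?_ ht.le) (h1.trans h2)
    exact measureReal_mono fun ω (hω : t < _) => (le_of_lt hω : t ≤ _)
  rw [← ofReal_measureReal]
  exact ENNReal.ofReal_le_ofReal h3

end Empirical

/-! ### The law of a design point -/

/-- The law with density `q` on the unit square. -/
def designLaw (q : ℝ × ℝ → ℝ) : Measure (ℝ × ℝ) :=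
  (volume.restrict unitSquare).withDensity fun z => ENNReal.ofReal (q z)

lemma measurableSet_unitSquare : MeasurableSet unitSquare := measurableSet_Ioo.prod measurableSet_Ioo

lemma coord_mem {z : ℝ × ℝ} (hz : z ∈ unitSquare) (j : Fin 2) : coord j z ∈ Ioo (0 : ℝ) 1 := by
  unfold coord; split_ifs
  · exact hz.1
  · exact hz.2

lemma measurable_coord (j : Fin 2) : Measurable (coord j) := by
  unfold coord; split_ifs
  · exact measurable_fst
  · exact measurable_snd

lemma volume_restrict_unitSquare : (volume.restrict unitSquare : Measure (ℝ × ℝ))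
    = (volume.restrict (Ioo (0 : ℝ) 1)).prod (volume.restrict (Ioo (0 : ℝ) 1)) := by
  rw [Measure.prod_restrict]; rfl

instance : IsProbabilityMeasure (volume.restrict (Ioo (0 : ℝ) 1)) := ⟨by simp⟩

instance : IsProbabilityMeasure (volume.restrict unitSquare : Measure (ℝ × ℝ)) := by
  rw [volume_restrict_unitSquare]; infer_instance

section Law

variable {q : ℝ × ℝ → ℝ}

lemma ae_mem_unitSquare (q : ℝ × ℝ → ℝ) : ∀ᵐ z ∂designLaw q, z ∈ unitSquare :=
  (withDensity_absolutelyContinuous _ _).ae_le (ae_restrict_mem measurableSet_unitSquare)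

lemma integral_designLaw (hq : BddPos q) (h : ℝ × ℝ → ℝ) :
    ∫ z, h z ∂designLaw q = ∫ z in unitSquare, q z * h z := by
  obtain ⟨hm, c, C, hc, hb⟩ := hq
  rw [designLaw, integral_withDensity_eq_integral_toReal_smul (by fun_prop) (by simp)]
  refine setIntegral_congr_fun measurableSet_unitSquare fun z hz => ?_
  simp only [smul_eq_mul]
  rw [ENNReal.toReal_ofReal (hc.le.trans (hb z hz).1)]

lemma memLp_of_bdd {μ : Measure (ℝ × ℝ)} [IsFiniteMeasure μ] (hμ : ∀ᵐ z ∂μ, z ∈ unitSquare)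
    {h : ℝ × ℝ → ℝ} (hm : Measurable h) {C : ℝ} (hb : ∀ z ∈ unitSquare, |h z| ≤ C) (r : ℝ≥0∞) :
    MemLp h r μ :=
  MemLp.of_bound hm.aestronglyMeasurable C (hμ.mono fun z hz => hb z hz)

lemma integrable_of_bdd {μ : Measure (ℝ × ℝ)} [IsFiniteMeasure μ] (hμ : ∀ᵐ z ∂μ, z ∈ unitSquare)
    {h : ℝ × ℝ → ℝ} (hm : Measurable h) {C : ℝ} (hb : ∀ z ∈ unitSquare, |h z| ≤ C) :
    Integrable h μ := memLp_one_iff_integrable.1 (memLp_of_bdd hμ hm hb 1)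

lemma BddPos.abs_le {g : ℝ × ℝ → ℝ} (hg : BddPos g) : ∃ C : ℝ, 0 < C ∧ ∀ z ∈ unitSquare,
    |g z| ≤ C := by
  obtain ⟨hm, c, C, hc, hb⟩ := hg
  refine ⟨max C 1, by positivity, fun z hz => ?_⟩
  rw [abs_of_nonneg (hc.le.trans (hb z hz).1)]
  exact (hb z hz).2.trans (le_max_left _ _)

/-- Integrals against the design law are comparable with Lebesgue integrals. -/
lemma exists_integral_designLaw_comparable (hq : BddPos q) : ∃ c C : ℝ, 0 < c ∧ 0 < C ∧
    ∀ h : ℝ × ℝ → ℝ, Measurable h → (∃ M : ℝ, ∀ z ∈ unitSquare, |h z| ≤ M) →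
      (∀ z ∈ unitSquare, 0 ≤ h z) →
      c * (∫ z in unitSquare, h z) ≤ ∫ z, h z ∂designLaw q ∧
      ∫ z, h z ∂designLaw q ≤ C * ∫ z in unitSquare, h z := by
  obtain ⟨C', hC', hC'b⟩ := hq.abs_le
  have hq' := hq
  obtain ⟨hm, c, C, hc, hb⟩ := hq
  refine ⟨c, C', hc, hC', fun h hhm ⟨M, hM⟩ h0 => ?_⟩
  have hae : ∀ᵐ z ∂(volume.restrict unitSquare : Measure (ℝ × ℝ)), z ∈ unitSquare :=
    ae_restrict_mem measurableSet_unitSquare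
  have i1 : Integrable h (volume.restrict unitSquare) := integrable_of_bdd hae hhm hM
  have i2 : Integrable (fun z => q z * h z) (volume.restrict unitSquare) := by
    refine integrable_of_bdd hae (hm.mul hhm) (C := C' * M) fun z hz => ?_
    rw [abs_mul]
    exact mul_le_mul (hC'b z hz) (hM z hz) (abs_nonneg _) hC'.le
  rw [integral_designLaw hq', ← integral_const_mul, ← integral_const_mul]
  constructor
  · refine integral_mono_ae (i1.const_mul _) i2 (hae.mono fun z hz => ?_)
    exact mul_le_mul_of_nonneg_right (hb z hz).1 (h0 z hz)
  · refine integral_mono_ae i2 (i1.const_mul _) (hae.mono fun z hz => ?_)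
    exact mul_le_mul_of_nonneg_right ((le_abs_self _).trans (hC'b z hz)) (h0 z hz)

lemma integral_unitSquare_mul (g h : ℝ → ℝ) :
    ∫ z in unitSquare, g z.1 * h z.2 = (∫ t in (0 : ℝ)..1, g t) * ∫ t in (0 : ℝ)..1, h t := by
  rw [volume_restrict_unitSquare, integral_prod_mul,
    intervalIntegral.integral_of_le zero_le_one, intervalIntegral.integral_of_le zero_le_one,
    integral_Ioc_eq_integral_Ioo, integral_Ioc_eq_integral_Ioo]

lemma integral_unitSquare_coord (g : ℝ → ℝ) (j : Fin 2) :
    ∫ z in unitSquare, g (coord j z) = ∫ t in (0 : ℝ)..1, g t := by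
  unfold coord
  split_ifs
  · have := integral_unitSquare_mul g fun _ => 1
    simpa using this
  · have := integral_unitSquare_mul (fun _ => 1) g
    simpa using this

/-! ### Moment matrices of the splines under the design law. -/

/-- The population moment matrix `E[g(Z) B_i(Z_j) B_k(Z_j')]`. -/
def popMat (p K : ℕ) (q g : ℝ × ℝ → ℝ) (j j' : Fin 2) : Matrix (Fin (K + p)) (Fin (K + p)) ℝ :=
  Matrix.of fun i k => ∫ z, g z * bvec p K (coord j z) i * bvec p K (coord j' z) k ∂designLaw q

/-- The empirical moment matrix. -/
def empMat (p K : ℕ) {n : ℕ} (x : Fin n → ℝ × ℝ) (g : ℝ × ℝ → ℝ) (j j' : Fin 2) :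
    Matrix (Fin (K + p)) (Fin (K + p)) ℝ :=
  Matrix.of fun i k => empMean x fun z => g z * bvec p K (coord j z) i * bvec p K (coord j' z) k

lemma integral_marginal (hq : BddPos q) (g : ℝ → ℝ) (hg : Measurable g) {M : ℝ}
    (hM : ∀ t, |g t| ≤ M) (j : Fin 2) :
    ∫ t in (0 : ℝ)..1, g t * marginal q j t = ∫ z, g (coord j z) ∂designLaw q := by
  obtain ⟨C, hC, hCb⟩ := hq.abs_le
  have hae : ∀ᵐ z ∂(volume.restrict unitSquare : Measure (ℝ × ℝ)), z ∈ unitSquare :=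
    ae_restrict_mem measurableSet_unitSquare
  have hi : Integrable (fun z => q z * g (coord j z)) (volume.restrict unitSquare) := by
    refine integrable_of_bdd hae (hq.1.mul (hg.comp (measurable_coord j))) (C := C * M)
      fun z hz => ?_
    rw [abs_mul]
    exact mul_le_mul (hCb z hz) (hM _) (abs_nonneg _) hC.le
  rw [integral_designLaw hq, volume_restrict_unitSquare]
  rw [volume_restrict_unitSquare] at hi
  unfold coord marginal at *
  split_ifs with h
  · simp only [h, if_true] at hi ⊢
    rw [integral_prod _ hi, intervalIntegral.integral_of_le zero_le_one,
      integral_Ioc_eq_integral_Ioo]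
    congr 1; ext t
    change _ = ∫ y in Ioo 0 1, q (t, y) * g t
    rw [integral_mul_const, intervalIntegral.integral_of_le zero_le_one,
      integral_Ioc_eq_integral_Ioo, mul_comm]
  · simp only [h, if_false] at hi ⊢
    rw [integral_prod_symm _ hi, intervalIntegral.integral_of_le zero_le_one,
      integral_Ioc_eq_integral_Ioo]
    congr 1; ext t
    change _ = ∫ x in Ioo 0 1, q (x, t) * g t
    rw [integral_mul_const, intervalIntegral.integral_of_le zero_le_one,
      integral_Ioc_eq_integral_Ioo, mul_comm]

/-- Fubini identifies the matrix of marginal integrals with a moment matrix under the joint law,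
where all matrices are estimated in the same way. -/
lemma gram_eq_popMat (hq : BddPos q) {p K : ℕ} (hK : 0 < K) (j : Fin 2) :
    gram p K q j = popMat p K q (fun _ => 1) j j := by
  ext i k
  simp only [gram, popMat, Matrix.of_apply, one_mul]
  refine integral_marginal hq (fun t => bvec p K t i * bvec p K t k)
    ((measurable_bvec p K i).mul (measurable_bvec p K k)) (M := 1) (fun t => ?_) j
  rw [abs_mul]
  exact mul_le_one₀ (abs_bvec_le_one hK t i) (abs_nonneg _) (abs_bvec_le_one hK t k)

lemma measurable_moment {g : ℝ × ℝ → ℝ} (hg : Measurable g) (p K : ℕ) (j j' : Fin 2)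
    (i k : Fin (K + p)) :
    Measurable fun z => g z * bvec p K (coord j z) i * bvec p K (coord j' z) k :=
  (hg.mul ((measurable_bvec p K i).comp (measurable_coord j))).mul
    ((measurable_bvec p K k).comp (measurable_coord j'))

lemma abs_moment_le {p K : ℕ} (hK : 0 < K) {g : ℝ × ℝ → ℝ} {C : ℝ}
    (hg : ∀ z ∈ unitSquare, |g z| ≤ C) (j j' : Fin 2) (i k : Fin (K + p)) {z : ℝ × ℝ}
    (hz : z ∈ unitSquare) :
    |g z * bvec p K (coord j z) i * bvec p K (coord j' z) k|
      ≤ C * (bvec p K (coord j z) i * bvec p K (coord j' z) k) := by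
  rw [mul_assoc, abs_mul, abs_of_nonneg (mul_nonneg (bvec_nonneg hK _ i) (bvec_nonneg hK _ k))]
  exact mul_le_mul_of_nonneg_right (hg z hz) (mul_nonneg (bvec_nonneg hK _ i) (bvec_nonneg hK _ k))

lemma abs_moment_le' {p K : ℕ} (hK : 0 < K) {g : ℝ × ℝ → ℝ} {C : ℝ}
    (hg : ∀ z ∈ unitSquare, |g z| ≤ C) (j j' : Fin 2) (i k : Fin (K + p)) {z : ℝ × ℝ}
    (hz : z ∈ unitSquare) :
    |g z * bvec p K (coord j z) i * bvec p K (coord j' z) k| ≤ C := by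
  refine (abs_moment_le hK hg j j' i k hz).trans ?_
  have hC : 0 ≤ C := (abs_nonneg _).trans (hg z hz)
  exact mul_le_of_le_one_right hC
    (mul_le_one₀ (bvec_le_one hK _ i) (bvec_nonneg hK _ k) (bvec_le_one hK _ k))

lemma sigmaMat_eq_popMat (hq : BddPos q) {s2 : ℝ × ℝ → ℝ} (hs : BddPos s2) {p K : ℕ} (hK : 0 < K)
    (j : Fin 2) : sigmaMat p K q s2 j = popMat p K q s2 j j := by
  obtain ⟨C, hC, hCb⟩ := hq.abs_le
  obtain ⟨C', hC', hCb'⟩ := hs.abs_le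
  ext i k
  have hae : ∀ᵐ z ∂(volume.restrict unitSquare : Measure (ℝ × ℝ)), z ∈ unitSquare :=
    ae_restrict_mem measurableSet_unitSquare
  have hi : Integrable (fun z => q z * (s2 z * bvec p K (coord j z) i * bvec p K (coord j z) k))
      (volume.restrict unitSquare) := by
    refine integrable_of_bdd hae (hq.1.mul (measurable_moment hs.1 p K j j i k)) (C := C * C')
      fun z hz => ?_
    rw [abs_mul]
    exact mul_le_mul (hCb z hz) (abs_moment_le' hK hCb' j j i k hz) (abs_nonneg _) hC.le
  simp only [sigmaMat, popMat, Matrix.of_apply]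
  rw [integral_designLaw hq, volume_restrict_unitSquare]
  rw [volume_restrict_unitSquare] at hi
  rw [integral_prod _ hi, intervalIntegral.integral_of_le zero_le_one,
    integral_Ioc_eq_integral_Ioo]
  congr 1; ext u
  rw [intervalIntegral.integral_of_le zero_le_one, integral_Ioc_eq_integral_Ioo]
  congr 1; ext v; ring

end Law

/-! ### Population moment matrices -/

section Population

variable {q g : ℝ × ℝ → ℝ} {p K : ℕ}

lemma BddPos.one : BddPos fun _ => 1 :=
  ⟨measurable_const, 1, 1, one_pos, fun _ _ => ⟨le_rfl, le_rfl⟩⟩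

lemma BddPos.pos (hg : BddPos g) {z : ℝ × ℝ} (hz : z ∈ unitSquare) : 0 < g z := by
  obtain ⟨_, c, C, hc, hb⟩ := hg
  exact hc.trans_le (hb z hz).1

lemma popMat_transpose (j j' : Fin 2) : (popMat p K q g j j')ᵀ = popMat p K q g j' j := by
  ext i k
  simp only [popMat, Matrix.transpose_apply, Matrix.of_apply]
  congr 1; ext z; ring

lemma empMat_transpose {n : ℕ} (x : Fin n → ℝ × ℝ) (j j' : Fin 2) :
    (empMat p K x g j j')ᵀ = empMat p K x g j' j := by
  ext i k
  simp only [empMat, Matrix.transpose_apply, Matrix.of_apply]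
  congr 1; ext z; ring

lemma popMat_banded (hK : 0 < K) (j : Fin 2) : Banded p (popMat p K q g j j) := by
  intro i k h
  by_contra hc
  apply h
  simp only [popMat, Matrix.of_apply]
  rw [← integral_zero (ℝ × ℝ) ℝ (μ := designLaw q)]
  congr 1; ext z
  by_contra h0
  exact hc (bvec_close hK (right_ne_zero_of_mul (left_ne_zero_of_mul h0)) (right_ne_zero_of_mul h0))

lemma empMat_banded (hK : 0 < K) {n : ℕ} (x : Fin n → ℝ × ℝ) (j : Fin 2) :
    Banded p (empMat p K x g j j) := by
  intro i k h
  by_contra hc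
  apply h
  simp only [empMat, Matrix.of_apply, empMean]
  rw [Finset.sum_eq_zero fun l _ => ?_, mul_zero]
  by_contra h0
  exact hc (bvec_close hK (right_ne_zero_of_mul (left_ne_zero_of_mul h0)) (right_ne_zero_of_mul h0))

lemma moment_bilin_eq (j j' : Fin 2) (u v : Fin (K + p) → ℝ) (z : ℝ × ℝ) :
    g z * (bvec p K (coord j z) ⬝ᵥ u) * (bvec p K (coord j' z) ⬝ᵥ v) =
      ∑ i, ∑ k, u i * (g z * bvec p K (coord j z) i * bvec p K (coord j' z) k * v k) := by
  rw [mul_assoc, dotProduct, dotProduct, Finset.sum_mul_sum, Finset.mul_sum]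
  refine Finset.sum_congr rfl fun i _ => ?_
  rw [Finset.mul_sum]
  exact Finset.sum_congr rfl fun k _ => by ring

lemma popMat_bilin [IsFiniteMeasure (designLaw q)] (hK : 0 < K) (hg : BddPos g) (j j' : Fin 2)
    (u v : Fin (K + p) → ℝ) :
    u ⬝ᵥ (popMat p K q g j j' *ᵥ v) = ∫ z, g z * (bvec p K (coord j z) ⬝ᵥ u) *
      (bvec p K (coord j' z) ⬝ᵥ v) ∂designLaw q := by
  obtain ⟨C, hC, hCb⟩ := hg.abs_le
  have hi : ∀ i k, Integrable (fun z => g z * bvec p K (coord j z) i * bvec p K (coord j' z) k)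
      (designLaw q) := fun i k => integrable_of_bdd (ae_mem_unitSquare q)
        (measurable_moment hg.1 p K j j' i k) fun z hz => abs_moment_le' hK hCb j j' i k hz
  simp only [moment_bilin_eq]
  rw [integral_finsetSum _ fun i _ => integrable_finsetSum _ fun k _ =>
    ((hi i k).mul_const _).const_mul _]
  refine Finset.sum_congr rfl fun i _ => ?_
  rw [integral_finsetSum _ fun k _ => ((hi i k).mul_const _).const_mul _, Matrix.mulVec,
    dotProduct, Finset.mul_sum]
  refine Finset.sum_congr rfl fun k _ => ?_
  rw [integral_const_mul, integral_mul_const]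
  rfl

/-- The design law is dominated by Lebesgue measure on the square. One support of length O(1/K)
gives the general bound; for two different coordinates the supports form a rectangle of area
O(K^{-2}). -/
lemma abs_popMat_le [IsProbabilityMeasure (designLaw q)] (hq : BddPos q) (hg : BddPos g) (p : ℕ) :
    ∃ D : ℝ, 0 < D ∧ ∀ K : ℕ, 0 < K →
      (∀ j j' i k, |popMat p K q g j j' i k| ≤ D / K) ∧
      (∀ j j', j ≠ j' → ∀ i k, |popMat p K q g j j' i k| ≤ D / K ^ 2) ∧
      (∀ j j', j ≠ j' → ∀ i k, ∫ z, (g z * bvec p K (coord j z) i * bvec p K (coord j' z) k) ^ 2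
        ∂designLaw q ≤ D / K ^ 2) := by
  obtain ⟨C, hC, hCb⟩ := hg.abs_le
  obtain ⟨c', C', hc', hC', hcomp⟩ := exists_integral_designLaw_comparable hq
  -- Both conclusions come from the Lebesgue integral of B_i B_k: since 0 ≤ B_i B_k ≤ 1, the second
  -- moment is of no larger order than the first.
  have key : ∀ K : ℕ, 0 < K → ∀ (j j' : Fin 2) (i k : Fin (K + p)),
      (∀ b, (∫ z in unitSquare, bvec p K (coord j z) i * bvec p K (coord j' z) k) ≤ b →
        |popMat p K q g j j' i k| ≤ C * (C' * b) ∧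
        ∫ z, (g z * bvec p K (coord j z) i * bvec p K (coord j' z) k) ^ 2
        ∂designLaw q ≤ C ^ 2 * (C' * b)) := by
    intro K hK j j' i k b hb
    have hmm : Measurable fun z => bvec p K (coord j z) i * bvec p K (coord j' z) k := by
      have := measurable_moment (g := fun _ => 1) measurable_const p K j j' i k
      simpa using this
    have h01 : ∀ z, 0 ≤ bvec p K (coord j z) i * bvec p K (coord j' z) k ∧
        bvec p K (coord j z) i * bvec p K (coord j' z) k ≤ 1 := fun z =>
      ⟨mul_nonneg (bvec_nonneg hK _ i) (bvec_nonneg hK _ k),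
        mul_le_one₀ (bvec_le_one hK _ i) (bvec_nonneg hK _ k) (bvec_le_one hK _ k)⟩
    have h1 := (hcomp _ hmm ⟨1, fun z _ => by rw [abs_of_nonneg (h01 z).1]; exact (h01 z).2⟩
      fun z _ => (h01 z).1).2
    have h2 := h1.trans (mul_le_mul_of_nonneg_left hb hC'.le)
    have hi0 : Integrable (fun z => bvec p K (coord j z) i * bvec p K (coord j' z) k)
        (designLaw q) := integrable_of_bdd (ae_mem_unitSquare q) hmm (C := 1)
          fun z _ => by rw [abs_of_nonneg (h01 z).1]; exact (h01 z).2
    constructor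
    · simp only [popMat, Matrix.of_apply]
      refine (abs_integral_le_integral_abs).trans ?_
      refine le_trans ?_ (mul_le_mul_of_nonneg_left h2 hC.le)
      rw [← integral_const_mul]
      refine integral_mono_ae ?_ (hi0.const_mul _) ?_
      · exact (integrable_of_bdd (ae_mem_unitSquare q) (measurable_moment hg.1 p K j j' i k)
          fun z hz => abs_moment_le' hK hCb j j' i k hz).abs
      · filter_upwards [ae_mem_unitSquare q] with z hz
        exact abs_moment_le hK hCb j j' i k hz
    · refine le_trans ?_ (mul_le_mul_of_nonneg_left h2 (sq_nonneg C))
      rw [← integral_const_mul]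
      refine integral_mono_of_nonneg (Eventually.of_forall fun z => sq_nonneg _)
        (hi0.const_mul _) ?_
      filter_upwards [ae_mem_unitSquare q] with z hz
      have h3 := abs_moment_le hK hCb j j' i k hz
      rw [← sq_abs]
      calc _ ≤ (C * (bvec p K (coord j z) i * bvec p K (coord j' z) k)) ^ 2 :=
            pow_le_pow_left₀ (abs_nonneg _) h3 2
        _ = C ^ 2 * ((bvec p K (coord j z) i * bvec p K (coord j' z) k) *
            (bvec p K (coord j z) i * bvec p K (coord j' z) k)) := by ring
        _ ≤ C ^ 2 * ((bvec p K (coord j z) i * bvec p K (coord j' z) k) * 1) := by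
            gcongr
            · exact (h01 z).1
            · exact (h01 z).2
        _ = _ := by rw [mul_one]
  refine ⟨(C + C ^ 2) * C' * ((p + 1) + (p + 1) ^ 2), by positivity, fun K hK => ?_⟩
  have hK' : (0 : ℝ) < K := by exact_mod_cast hK
  have hI0 : ∀ i : Fin (K + p), 0 ≤ ∫ t in (0 : ℝ)..1, bvec p K t i := fun i =>
    intervalIntegral.integral_nonneg zero_le_one fun t _ => bvec_nonneg hK t i
  have cross : ∀ j j' : Fin 2, j ≠ j' → ∀ i k : Fin (K + p),
      (∫ z in unitSquare, bvec p K (coord j z) i * bvec p K (coord j' z) k)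
        ≤ ((p + 1) / K) ^ 2 := by
    have h00 : ∀ i k : Fin (K + p), (∫ t in (0 : ℝ)..1, bvec p K t i) *
        (∫ t in (0 : ℝ)..1, bvec p K t k) ≤ ((p + 1) / K) ^ 2 := fun i k => by
      rw [sq]
      exact mul_le_mul (integral_bvec_le hK i) (integral_bvec_le hK k) (hI0 k) (by positivity)
    intro j j' hj i k
    fin_cases j <;> fin_cases j'
    · exact absurd rfl hj
    · have := integral_unitSquare_mul (fun t => bvec p K t i) (fun t => bvec p K t k)
      simp only [coord, Fin.zero_eta, if_true, Fin.mk_one, one_ne_zero, if_false]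
      rw [this]; exact h00 i k
    · have := integral_unitSquare_mul (fun t => bvec p K t k) (fun t => bvec p K t i)
      simp only [coord, Fin.zero_eta, if_true, Fin.mk_one, one_ne_zero, if_false]
      simp only [mul_comm (bvec p K (Prod.snd _) i)]
      rw [this]; exact h00 k i
    · exact absurd rfl hj
  have diag : ∀ j j' : Fin 2, ∀ i k : Fin (K + p),
      (∫ z in unitSquare, bvec p K (coord j z) i * bvec p K (coord j' z) k) ≤ (p + 1) / K := by
    intro j j' i k
    refine le_trans ?_ (integral_bvec_le hK i)
    rw [← integral_unitSquare_coord _ j]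
    have hae : ∀ᵐ z ∂(volume.restrict unitSquare : Measure (ℝ × ℝ)), z ∈ unitSquare :=
      ae_restrict_mem measurableSet_unitSquare
    refine integral_mono_of_nonneg (Eventually.of_forall fun z =>
      mul_nonneg (bvec_nonneg hK _ i) (bvec_nonneg hK _ k)) ?_ (Eventually.of_forall fun z => ?_)
    · exact integrable_of_bdd hae ((measurable_bvec p K i).comp (measurable_coord j))
        fun z _ => abs_bvec_le_one hK _ i
    · exact mul_le_of_le_one_right (bvec_nonneg hK _ i) (bvec_le_one hK _ k)
  have hp0 : (0 : ℝ) ≤ p := by positivity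
  refine ⟨fun j j' i k => ((key K hK j j' i k _ (diag j j' i k)).1).trans ?_,
    fun j j' hj i k => ((key K hK j j' i k _ (cross j j' hj i k)).1).trans ?_,
    fun j j' hj i k => ((key K hK j j' i k _ (cross j j' hj i k)).2).trans ?_⟩
  · rw [mul_div_assoc', mul_div_assoc']
    refine div_le_div_of_nonneg_right ?_ (by positivity)
    have h1 : 0 ≤ C ^ 2 * C' * (p + 1) := by positivity
    have h2 : 0 ≤ (C + C ^ 2) * C' * (p + 1) ^ 2 := by positivity
    linarith
  · rw [div_pow, mul_div_assoc', mul_div_assoc']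
    refine div_le_div_of_nonneg_right ?_ (by positivity)
    have h1 : 0 ≤ C ^ 2 * C' * (p + 1) ^ 2 := by positivity
    have h2 : 0 ≤ (C + C ^ 2) * C' * (p + 1) := by positivity
    linarith
  · rw [div_pow, mul_div_assoc', mul_div_assoc']
    refine div_le_div_of_nonneg_right ?_ (by positivity)
    have h1 : 0 ≤ C * C' * (p + 1) ^ 2 := by positivity
    have h2 : 0 ≤ (C + C ^ 2) * C' * (p + 1) := by positivity
    linarith

lemma measurable_bvec_coord (u : Fin (K + p) → ℝ) (j : Fin 2) :
    Measurable fun z => bvec p K (coord j z) ⬝ᵥ u :=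
  (measurable_bvec_dotProduct u).comp (measurable_coord j)

/-- Coercivity of the diagonal population matrices. -/
lemma exists_popMat_coercive [IsProbabilityMeasure (designLaw q)] (hq : BddPos q) (hg : BddPos g)
    (p : ℕ) : ∃ c : ℝ, 0 < c ∧ ∀ K : ℕ, 0 < K → ∀ (j : Fin 2) (v : Fin (K + p) → ℝ),
      c / K * l2 v ^ 2 ≤ v ⬝ᵥ (popMat p K q g j j *ᵥ v) := by
  obtain ⟨c₁, C₁, hc₁, hC₁, hcomp⟩ := exists_integral_designLaw_comparable hq
  obtain ⟨c₂, hc₂, hst⟩ := exists_stability p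
  obtain ⟨Cg, hCg, hCgb⟩ := hg.abs_le
  have hg' := hg
  obtain ⟨hgm, c₃, C₃, hc₃, hgb⟩ := hg
  refine ⟨c₁ * c₃ * c₂, by positivity, fun K hK j v => ?_⟩
  have hK' : (0 : ℝ) < K := by exact_mod_cast hK
  rw [popMat_bilin hK hg']
  have hm1 := measurable_bvec_coord v j
  have hb1 : ∀ z : ℝ × ℝ, |bvec p K (coord j z) ⬝ᵥ v| ≤ ∑ k, |v k| := fun z =>
    abs_bvec_dotProduct_le_sum hK _ v
  have hae : ∀ᵐ z ∂(volume.restrict unitSquare : Measure (ℝ × ℝ)), z ∈ unitSquare :=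
    ae_restrict_mem measurableSet_unitSquare
  have hbd : ∀ z ∈ unitSquare, |g z * (bvec p K (coord j z) ⬝ᵥ v) * (bvec p K (coord j z) ⬝ᵥ v)|
      ≤ Cg * (∑ k, |v k|) * (∑ k, |v k|) := fun z hz => by
    rw [abs_mul, abs_mul]
    have := hCgb z hz
    have := hb1 z
    gcongr
  have h1 := (hcomp (fun z => g z * (bvec p K (coord j z) ⬝ᵥ v) * (bvec p K (coord j z) ⬝ᵥ v))
    ((hgm.mul hm1).mul hm1) ⟨_, hbd⟩ fun z hz => by
      rw [mul_assoc]; exact mul_nonneg (hg'.pos hz).le (mul_self_nonneg _)).1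
  refine le_trans ?_ h1
  have h2 : c₃ * ∫ z in unitSquare, (bvec p K (coord j z) ⬝ᵥ v) ^ 2 ≤
      ∫ z in unitSquare, g z * (bvec p K (coord j z) ⬝ᵥ v) * (bvec p K (coord j z) ⬝ᵥ v) := by
    rw [← integral_const_mul]
    refine integral_mono_ae (Integrable.const_mul ?_ _) ?_ ?_
    · refine integrable_of_bdd hae (hm1.pow_const 2) fun z _ => abs_bvec_dotProduct_sq_le hK _ v
    · exact integrable_of_bdd hae ((hgm.mul hm1).mul hm1) hbd
    · filter_upwards [hae] with z hz
      rw [mul_assoc, ← sq]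
      exact mul_le_mul_of_nonneg_right (hgb z hz).1 (sq_nonneg _)
  rw [integral_unitSquare_coord (fun t => (bvec p K t ⬝ᵥ v) ^ 2) j] at h2
  have h3 := (hst K hK v).1
  calc c₁ * c₃ * c₂ / K * l2 v ^ 2 = c₁ * (c₃ * (c₂ / K * l2 v ^ 2)) := by ring
    _ ≤ _ := by
      refine mul_le_mul_of_nonneg_left ((mul_le_mul_of_nonneg_left h3 hc₃.le).trans h2) hc₁.le

/-- The quadratic form of the additive model. -/
def jointForm {N : ℕ} (A₁ A₂ H : Matrix (Fin N) (Fin N) ℝ) (u v : Fin N → ℝ) : ℝ :=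
  u ⬝ᵥ (A₁ *ᵥ u) + 2 * (u ⬝ᵥ (H *ᵥ v)) + v ⬝ᵥ (A₂ *ᵥ v)

/-- Coercivity of the population form on pairs with one centred component. -/
lemma exists_popMat_joint_coercive [IsProbabilityMeasure (designLaw q)] (hq : BddPos q) (p : ℕ) :
    ∃ c : ℝ, 0 < c ∧ ∀ K : ℕ, 0 < K → ∀ u v : Fin (K + p) → ℝ,
      ((∫ t in (0 : ℝ)..1, bvec p K t ⬝ᵥ u) = 0 ∨ (∫ t in (0 : ℝ)..1, bvec p K t ⬝ᵥ v) = 0) →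
      c / K * (l2 u ^ 2 + l2 v ^ 2) ≤
        jointForm (popMat p K q (fun _ => 1) 0 0) (popMat p K q (fun _ => 1) 1 1)
          (popMat p K q (fun _ => 1) 0 1) u v := by
  obtain ⟨c₁, C₁, hc₁, hC₁, hcomp⟩ := exists_integral_designLaw_comparable hq
  obtain ⟨c₂, hc₂, hst⟩ := exists_stability p
  refine ⟨c₁ * c₂, by positivity, fun K hK u v h0 => ?_⟩
  have hK' : (0 : ℝ) < K := by exact_mod_cast hK
  simp only [jointForm, popMat_bilin hK BddPos.one]
  simp only [coord, one_mul, if_true, one_ne_zero, if_false]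
  set su : ℝ → ℝ := fun t => bvec p K t ⬝ᵥ u with hsu
  set sv : ℝ → ℝ := fun t => bvec p K t ⬝ᵥ v with hsv
  have hmu : Measurable su := measurable_bvec_dotProduct u
  have hmv : Measurable sv := measurable_bvec_dotProduct v
  set U := ∑ k, |u k|
  set V := ∑ k, |v k|
  have hbu : ∀ t, |su t| ≤ U := fun t => abs_bvec_dotProduct_le_sum hK t u
  have hbv : ∀ t, |sv t| ≤ V := fun t => abs_bvec_dotProduct_le_sum hK t v
  have hU : 0 ≤ U := (abs_nonneg _).trans (hbu 0)
  have hV : 0 ≤ V := (abs_nonneg _).trans (hbv 0)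
  have hint : ∀ μ : Measure (ℝ × ℝ), IsProbabilityMeasure μ → (∀ᵐ z ∂μ, z ∈ unitSquare) →
      Integrable (fun z : ℝ × ℝ => su z.1 * su z.1) μ ∧
      Integrable (fun z : ℝ × ℝ => su z.1 * sv z.2) μ ∧
      Integrable (fun z : ℝ × ℝ => sv z.2 * sv z.2) μ := by
    intro μ _ hμ
    refine ⟨integrable_of_bdd hμ (by fun_prop) (C := U * U) fun z _ => ?_,
      integrable_of_bdd hμ (by fun_prop) (C := U * V) fun z _ => ?_,
      integrable_of_bdd hμ (by fun_prop) (C := V * V) fun z _ => ?_⟩ <;> rw [abs_mul]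
    · exact mul_le_mul (hbu _) (hbu _) (abs_nonneg _) hU
    · exact mul_le_mul (hbu _) (hbv _) (abs_nonneg _) hU
    · exact mul_le_mul (hbv _) (hbv _) (abs_nonneg _) hV
  have hexp : ∀ μ : Measure (ℝ × ℝ), IsProbabilityMeasure μ → (∀ᵐ z ∂μ, z ∈ unitSquare) →
      ∫ z, (su z.1 + sv z.2) ^ 2 ∂μ = ∫ z, su z.1 * su z.1 ∂μ + 2 * ∫ z, su z.1 * sv z.2 ∂μ
        + ∫ z, sv z.2 * sv z.2 ∂μ := by
    intro μ hp hμ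
    obtain ⟨i1, i2, i3⟩ := hint μ hp hμ
    have i12 : Integrable (fun z : ℝ × ℝ => su z.1 * su z.1 + 2 * (su z.1 * sv z.2)) μ :=
      i1.add (i2.const_mul 2)
    rw [← integral_const_mul, ← integral_add i1 (i2.const_mul 2), ← integral_add i12 i3]
    congr 1; ext z; ring
  rw [← hexp _ inferInstance (ae_mem_unitSquare q)]
  have h1 := (hcomp (fun z => (su z.1 + sv z.2) ^ 2) (by fun_prop)
    ⟨(U + V) ^ 2, fun z _ => by
      rw [abs_pow]
      exact pow_le_pow_left₀ (abs_nonneg _) ((abs_add_le _ _).trans (add_le_add (hbu _) (hbv _))) 2⟩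
    fun z _ => sq_nonneg _).1
  refine le_trans ?_ h1
  rw [hexp _ inferInstance (ae_restrict_mem measurableSet_unitSquare),
    integral_unitSquare_mul su sv]
  have e1 := integral_unitSquare_coord (fun t => su t * su t) 0
  have e2 := integral_unitSquare_coord (fun t => sv t * sv t) 1
  simp only [coord, if_true, one_ne_zero, if_false] at e1 e2
  rw [e1, e2]
  -- Under Lebesgue measure on the square the coordinates are independent, so the cross term is a
  -- product of means and one centred component removes it.
  have hz : (∫ t in (0 : ℝ)..1, su t) * ∫ t in (0 : ℝ)..1, sv t = 0 := by
    rcases h0 with h | h <;> simp [h]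
  rw [hz, mul_zero, add_zero]
  have h2 := (hst K hK u).1
  have h3 := (hst K hK v).1
  simp only [← sq]
  calc c₁ * c₂ / K * (l2 u ^ 2 + l2 v ^ 2)
      = c₁ * (c₂ / K * l2 u ^ 2 + c₂ / K * l2 v ^ 2) := by ring
    _ ≤ _ := mul_le_mul_of_nonneg_left (add_le_add h2 h3) hc₁.le

end Population

/-! ### Concentration of the empirical moment matrices -/

section Concentration

variable {Ω : Type*} [MeasurableSpace Ω] {P : Measure Ω} [IsProbabilityMeasure P]
  {X : ℕ → Ω → ℝ × ℝ} {q g : ℝ × ℝ → ℝ}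

lemma isProbabilityMeasure_designLaw (hX : ∀ i, Measurable (X i))
    (hμ : ∀ i, P.map (X i) = designLaw q) : IsProbabilityMeasure (designLaw q) := by
  rw [← hμ 0]; exact Measure.isProbabilityMeasure_map (hX 0).aemeasurable

/-- Summed over all entries, the squared moments are bounded pointwise by C², because ∑ B_i² ≤ ∑ B_i
= 1. The expected squared Frobenius deviation is thus at most C²/n, without a factor of the
dimension. -/
lemma measure_frob_empMat_sub_popMat_le (hX : ∀ i, Measurable (X i))
    (hμ : ∀ i, P.map (X i) = designLaw q) (hind : iIndepFun X P) (hg : Measurable g) {C : ℝ}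
    (hgb : ∀ z ∈ unitSquare, |g z| ≤ C) {p K : ℕ} (hK : 0 < K) (j j' : Fin 2) {n : ℕ} (hn : 0 < n)
    {t : ℝ} (ht : 0 < t) :
    P {ω | t < frob (empMat p K (fun l : Fin n => X l ω) g j j' - popMat p K q g j j') ^ 2}
      ≤ ENNReal.ofReal (1 / n * C ^ 2 / t) := by
  have := isProbabilityMeasure_designLaw hX hμ
  set h : Fin (K + p) × Fin (K + p) → ℝ × ℝ → ℝ := fun a z =>
    g z * bvec p K (coord j z) a.1 * bvec p K (coord j' z) a.2 with hh
  have hm : ∀ a, Measurable (h a) := fun a => measurable_moment hg p K j j' a.1 a.2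
  have hL : ∀ a, MemLp (h a) 2 (designLaw q) := fun a =>
    memLp_of_bdd (ae_mem_unitSquare q) (hm a) (fun z hz => abs_moment_le' hK hgb j j' a.1 a.2 hz) 2
  have h1 := measure_lt_sum_sq_le (P := P)
    (Z := fun a ω => empMean (fun l : Fin n => X l ω) (h a) - ∫ z, h a z ∂designLaw q)
    (fun a => (memLp_empMean hX hμ (hL a) n).sub (memLp_const _)) (w := fun _ => 1)
    (fun _ => zero_le_one) (fun a => integral_sq_empMean_sub_le hX hμ hind (hm a) (hL a) hn) ht
  have e1 : ∀ ω, frob (empMat p K (fun l : Fin n => X l ω) g j j' - popMat p K q g j j') ^ 2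
      = ∑ a, 1 * (empMean (fun l : Fin n => X l ω) (h a) - ∫ z, h a z ∂designLaw q) ^ 2 := by
    intro ω
    rw [frob_sq, Fintype.sum_prod_type]
    simp only [one_mul]
    rfl
  simp only [e1]
  refine h1.trans (ENNReal.ofReal_le_ofReal ?_)
  refine div_le_div_of_nonneg_right ?_ ht.le
  simp only [one_mul]
  rw [← Finset.mul_sum]
  refine mul_le_mul_of_nonneg_left ?_ (by positivity)
  rw [← integral_finsetSum _ fun a _ => (hL a).integrable_sq]
  calc ∫ z, ∑ a, h a z ^ 2 ∂designLaw q ≤ ∫ _z, C ^ 2 ∂designLaw q := by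
        refine integral_mono_ae (integrable_finsetSum _ fun a _ => (hL a).integrable_sq)
          (integrable_const _) ?_
        filter_upwards [ae_mem_unitSquare q] with z hz
        have hb2 : ∀ j : Fin 2, ∑ i, bvec p K (coord j z) i ^ 2 ≤ 1 := fun j => by
          rw [← sum_bvec (p := p) hK (coord_mem hz j)]
          refine Finset.sum_le_sum fun i _ => ?_
          rw [sq]; exact mul_le_of_le_one_right (bvec_nonneg hK _ i) (bvec_le_one hK _ i)
        have e2 : ∑ a, h a z ^ 2 = g z ^ 2 * ((∑ i, bvec p K (coord j z) i ^ 2) *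
            ∑ k, bvec p K (coord j' z) k ^ 2) := by
          rw [Finset.sum_mul_sum, Fintype.sum_prod_type, Finset.mul_sum]
          refine Finset.sum_congr rfl fun i _ => ?_
          rw [Finset.mul_sum]
          exact Finset.sum_congr rfl fun k _ => by simp only [hh]; ring
        rw [e2]
        calc _ ≤ g z ^ 2 * 1 := by
              refine mul_le_mul_of_nonneg_left ?_ (sq_nonneg _)
              exact mul_le_one₀ (hb2 j) (Finset.sum_nonneg fun _ _ => sq_nonneg _) (hb2 j')
          _ ≤ C ^ 2 := by
              rw [mul_one, ← sq_abs]; exact pow_le_pow_left₀ (abs_nonneg _) (hgb z hz) 2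
    _ = C ^ 2 := by simp

/-- Each cross entry has second moment O(K^{-4}): the squared mean is of that order, and the
variance is at most n⁻¹·O(K^{-2}), which K² ≤ n brings down to it. Markov's inequality is then
applied to the weighted sum, which avoids any uniform bound over the entries. -/
lemma exists_measure_weighted_empMat_le (hX : ∀ i, Measurable (X i))
    (hμ : ∀ i, P.map (X i) = designLaw q) (hind : iIndepFun X P) (hq : BddPos q) (hg : BddPos g)
    (p : ℕ) : ∃ D : ℝ, 0 < D ∧ ∀ K : ℕ, 0 < K → ∀ n : ℕ, K ^ 2 ≤ n → ∀ j j' : Fin 2, j ≠ j' →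
      ∀ w : Fin (K + p) → Fin (K + p) → ℝ, (∀ i k, 0 ≤ w i k) → ∀ t : ℝ, 0 < t →
      P {ω | t < ∑ i, ∑ k, w i k * empMat p K (fun l : Fin n => X l ω) g j j' i k ^ 2}
        ≤ ENNReal.ofReal ((∑ i, ∑ k, w i k) * (D / K ^ 4) / t) := by
  have := isProbabilityMeasure_designLaw hX hμ
  obtain ⟨D, hD, hDb⟩ := abs_popMat_le hq hg p
  obtain ⟨C, hC, hCb⟩ := hg.abs_le
  refine ⟨D + D ^ 2, by positivity, fun K hK n hKn j j' hj w hw t ht => ?_⟩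
  have hK' : (0 : ℝ) < K := by exact_mod_cast hK
  have hn : 0 < n := lt_of_lt_of_le (by positivity) hKn
  have hKn' : (K : ℝ) ^ 2 ≤ n := by exact_mod_cast hKn
  obtain ⟨-, hD1, hD2⟩ := hDb K hK
  set h : Fin (K + p) × Fin (K + p) → ℝ × ℝ → ℝ := fun a z =>
    g z * bvec p K (coord j z) a.1 * bvec p K (coord j' z) a.2 with hh
  have hm : ∀ a, Measurable (h a) := fun a => measurable_moment hg.1 p K j j' a.1 a.2
  have hL : ∀ a, MemLp (h a) 2 (designLaw q) := fun a =>
    memLp_of_bdd (ae_mem_unitSquare q) (hm a) (fun z hz => abs_moment_le' hK hCb j j' a.1 a.2 hz) 2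
  have h1 := measure_lt_sum_sq_le (P := P)
    (Z := fun a ω => empMean (fun l : Fin n => X l ω) (h a))
    (fun a => memLp_empMean hX hμ (hL a) n) (w := fun a => w a.1 a.2) (fun a => hw _ _)
    (B := fun _ => (D + D ^ 2) / K ^ 4) (fun a => ?_) ht
  · rw [← Finset.sum_mul, Fintype.sum_prod_type] at h1
    refine le_trans (le_of_eq ?_) h1
    congr 1; ext ω
    simp only [Fintype.sum_prod_type]
    rfl
  · refine (integral_sq_empMean_le hX hμ hind (hm a) (hL a) hn).trans ?_
    have h2 := hD2 j j' hj a.1 a.2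
    have h3 := hD1 j j' hj a.1 a.2
    have h4 : (∫ z, h a z ∂designLaw q) ^ 2 ≤ D ^ 2 / K ^ 4 := by
      rw [← sq_abs]
      calc _ ≤ (D / K ^ 2) ^ 2 := pow_le_pow_left₀ (abs_nonneg _) h3 2
        _ = _ := by rw [div_pow]; ring
    have h5 : 1 / (n : ℝ) * ∫ z, h a z ^ 2 ∂designLaw q ≤ 1 / (K : ℝ) ^ 2 * (D / K ^ 2) := by
      refine mul_le_mul (by gcongr) h2 (integral_nonneg fun z => sq_nonneg _) (by positivity)
    have h6 : 1 / (K : ℝ) ^ 2 * (D / K ^ 2) = D / K ^ 4 := by field_simp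
    rw [add_div]; linarith

end Concentration

/-! ### The block system of the additive model -/

/-- A well-conditioned block system `(A₁ H; Hᵀ A₂)` whose only degeneracy is the exchange of
constants between the two components. -/
structure BlockSystem {N : ℕ} (L : ℕ) (κ c a : ℝ) (A₁ A₂ H : Matrix (Fin N) (Fin N) ℝ) :
    Prop where
  one_le : 1 ≤ κ
  c_pos : 0 < c
  a_pos : 0 < a
  card_le : (N : ℝ) ≤ a * κ
  symm₁ : A₁.IsSymm
  symm₂ : A₂.IsSymm
  band₁ : Banded L A₁
  band₂ : Banded L A₂
  bdd₁ : ∀ i k, |A₁ i k| ≤ a / κ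
  bdd₂ : ∀ i k, |A₂ i k| ≤ a / κ
  one₁ : A₁ *ᵥ 1 = H *ᵥ 1
  one₂ : A₂ *ᵥ 1 = Hᵀ *ᵥ 1
  total : 1 ⬝ᵥ (A₁ *ᵥ 1) = 1
  nonneg : ∀ u v, 0 ≤ jointForm A₁ A₂ H u v
  coercive : ∀ u v, ((H *ᵥ 1) ⬝ᵥ u = 0 ∨ (Hᵀ *ᵥ 1) ⬝ᵥ v = 0) →
    c / κ * (l2 u ^ 2 + l2 v ^ 2) ≤ jointForm A₁ A₂ H u v

/-- The block equations. -/
def IsSol {N : ℕ} (A₁ A₂ H : Matrix (Fin N) (Fin N) ℝ) (r₁ r₂ u v : Fin N → ℝ) : Prop :=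
  A₁ *ᵥ u + H *ᵥ v = r₁ ∧ Hᵀ *ᵥ u + A₂ *ᵥ v = r₂

lemma dotProduct_mulVec_comm {ι κ : Type*} [Fintype ι] [Fintype κ] (A : Matrix ι κ ℝ) (u : ι → ℝ)
    (v : κ → ℝ) : u ⬝ᵥ (A *ᵥ v) = (Aᵀ *ᵥ u) ⬝ᵥ v := by
  rw [Matrix.dotProduct_mulVec, Matrix.mulVec_transpose]

lemma jointForm_swap {N : ℕ} (A₁ A₂ H : Matrix (Fin N) (Fin N) ℝ) (u v : Fin N → ℝ) :
    jointForm A₂ A₁ Hᵀ v u = jointForm A₁ A₂ H u v := by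
  simp only [jointForm]
  rw [dotProduct_mulVec_comm Hᵀ, Matrix.transpose_transpose, dotProduct_comm (H *ᵥ v) u]
  ring

lemma IsSol.swap {N : ℕ} {A₁ A₂ H : Matrix (Fin N) (Fin N) ℝ} {r₁ r₂ u v : Fin N → ℝ}
    (h : IsSol A₁ A₂ H r₁ r₂ u v) : IsSol A₂ A₁ Hᵀ r₂ r₁ v u := by
  obtain ⟨h1, h2⟩ := h
  refine ⟨by rw [add_comm]; exact h2, by rw [Matrix.transpose_transpose, add_comm]; exact h1⟩

lemma IsSol.jointForm_eq {N : ℕ} {A₁ A₂ H : Matrix (Fin N) (Fin N) ℝ} {r₁ r₂ u v : Fin N → ℝ}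
    (h : IsSol A₁ A₂ H r₁ r₂ u v) : jointForm A₁ A₂ H u v = u ⬝ᵥ r₁ + v ⬝ᵥ r₂ := by
  obtain ⟨h1, h2⟩ := h
  rw [← h1, ← h2, dotProduct_add, dotProduct_add, dotProduct_mulVec_comm Hᵀ,
    Matrix.transpose_transpose, dotProduct_comm (H *ᵥ v) u, jointForm]
  ring

namespace BlockSystem

variable {N L : ℕ} {κ c a : ℝ} {A₁ A₂ H : Matrix (Fin N) (Fin N) ℝ}

lemma κ_pos (h : BlockSystem L κ c a A₁ A₂ H) : 0 < κ := one_pos.trans_le h.one_le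

lemma sum_mulVec₁ (h : BlockSystem L κ c a A₁ A₂ H) (u : Fin N → ℝ) :
    1 ⬝ᵥ (A₁ *ᵥ u) = (H *ᵥ 1) ⬝ᵥ u := by
  rw [dotProduct_mulVec_comm, h.symm₁, h.one₁]

lemma sum_mulVec₂ (h : BlockSystem L κ c a A₁ A₂ H) (v : Fin N → ℝ) :
    1 ⬝ᵥ (A₂ *ᵥ v) = (Hᵀ *ᵥ 1) ⬝ᵥ v := by
  rw [dotProduct_mulVec_comm, h.symm₂, h.one₂]

lemma sum_cross (h : BlockSystem L κ c a A₁ A₂ H) : (Hᵀ *ᵥ 1) ⬝ᵥ 1 = 1 := by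
  rw [← dotProduct_mulVec_comm, ← h.one₁, h.total]

/-- The assumptions are symmetric in the two components, so estimates need proof for the first one
only; the disjunction in `coercive` is what makes this possible. -/
lemma swap (h : BlockSystem L κ c a A₁ A₂ H) : BlockSystem L κ c a A₂ A₁ Hᵀ where
  one_le := h.one_le
  c_pos := h.c_pos
  a_pos := h.a_pos
  card_le := h.card_le
  symm₁ := h.symm₂
  symm₂ := h.symm₁
  band₁ := h.band₂
  band₂ := h.band₁
  bdd₁ := h.bdd₂
  bdd₂ := h.bdd₁
  one₁ := h.one₂
  one₂ := by rw [Matrix.transpose_transpose]; exact h.one₁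
  total := by rw [h.one₂, dotProduct_comm, h.sum_cross]
  nonneg u v := by rw [jointForm_swap]; exact h.nonneg v u
  coercive u v huv := by
    rw [jointForm_swap, add_comm (l2 u ^ 2)]
    rw [Matrix.transpose_transpose] at huv
    exact h.coercive v u huv.symm

lemma coercive₁ (h : BlockSystem L κ c a A₁ A₂ H) (u : Fin N → ℝ) :
    c / κ * l2 u ^ 2 ≤ u ⬝ᵥ (A₁ *ᵥ u) := by
  have := h.coercive u 0 (Or.inr (by simp))
  simpa [jointForm, l2_zero] using this

lemma coercive₂ (h : BlockSystem L κ c a A₁ A₂ H) (v : Fin N → ℝ) :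
    c / κ * l2 v ^ 2 ≤ v ⬝ᵥ (A₂ *ᵥ v) := h.swap.coercive₁ v

lemma isUnit_det_of_coercive {A : Matrix (Fin N) (Fin N) ℝ} {b : ℝ} (hb : 0 < b)
    (h : ∀ u, b * l2 u ^ 2 ≤ u ⬝ᵥ (A *ᵥ u)) : IsUnit A.det := by
  rw [isUnit_iff_ne_zero]
  intro h0
  obtain ⟨v, hv, hv0⟩ := Matrix.exists_mulVec_eq_zero_iff.2 h0
  have h1 := h v
  rw [hv0, dotProduct_zero] at h1
  apply hv
  have h2 : l2 v = 0 := by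
    have := l2_nonneg v
    by_contra h3
    have : 0 < l2 v := lt_of_le_of_ne this (Ne.symm h3)
    have : 0 < b * l2 v ^ 2 := by positivity
    linarith
  ext i
  have := abs_apply_le_l2 v i
  rw [h2] at this
  exact abs_eq_zero.1 (le_antisymm this (abs_nonneg _))

lemma isUnit₁ (h : BlockSystem L κ c a A₁ A₂ H) : IsUnit A₁.det :=
  isUnit_det_of_coercive (div_pos h.c_pos h.κ_pos) h.coercive₁

lemma isUnit₂ (h : BlockSystem L κ c a A₁ A₂ H) : IsUnit A₂.det := h.swap.isUnit₁

lemma le_add_of_quadratic {x y R T : ℝ} (hR : 0 ≤ R) (hT : 0 ≤ T)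
    (h : x ^ 2 + y ^ 2 ≤ R * x + T * y) : x ≤ R + T := by
  by_contra! hlt
  nlinarith [sq_nonneg (y - T / 2), mul_pos (by linarith : 0 < x - R) (by linarith : 0 < x)]

/-- The a priori bound for the block equations. -/
lemma l2_le (h : BlockSystem L κ c a A₁ A₂ H) {r₁ r₂ u v : Fin N → ℝ}
    (hs : IsSol A₁ A₂ H r₁ r₂ u v) :
    l2 u ≤ κ / c * (l2 r₁ + l2 r₂) + |(Hᵀ *ᵥ 1) ⬝ᵥ v| * √N ∧
    l2 v ≤ κ / c * (l2 r₁ + l2 r₂) + |(Hᵀ *ᵥ 1) ⬝ᵥ v| * √N := by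
  set μ := (Hᵀ *ᵥ 1) ⬝ᵥ v with hμ
  have hc := h.c_pos
  have hκ := h.κ_pos
  -- Moving along the kernel direction (1, -1) centres the second component without changing the
  -- equations, so coercivity applies. Undoing the shift costs |μ|√N.
  have hs' : IsSol A₁ A₂ H r₁ r₂ (u + μ • 1) (v - μ • 1) := by
    constructor
    · rw [← hs.1, Matrix.mulVec_add, Matrix.mulVec_sub, Matrix.mulVec_smul, Matrix.mulVec_smul,
        h.one₁]; abel
    · rw [← hs.2, Matrix.mulVec_add, Matrix.mulVec_sub, Matrix.mulVec_smul, Matrix.mulVec_smul,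
        h.one₂]; abel
  have hz : (Hᵀ *ᵥ 1) ⬝ᵥ (v - μ • 1) = 0 := by
    rw [dotProduct_sub, dotProduct_smul, h.sum_cross, ← hμ, smul_eq_mul, mul_one, sub_self]
  have h1 := h.coercive (u + μ • 1) _ (Or.inr hz)
  rw [hs'.jointForm_eq] at h1
  set u' := u + μ • (1 : Fin N → ℝ)
  set v' := v - μ • (1 : Fin N → ℝ)
  have h2 := dotProduct_le_l2 u' r₁
  have h3 := dotProduct_le_l2 v' r₂
  have h4 : l2 u' ^ 2 + l2 v' ^ 2 ≤ (κ / c * l2 r₁) * l2 u' + (κ / c * l2 r₂) * l2 v' := by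
    have h5 : c / κ * (l2 u' ^ 2 + l2 v' ^ 2) ≤ l2 u' * l2 r₁ + l2 v' * l2 r₂ := by linarith
    have h6 := mul_le_mul_of_nonneg_left h5 (div_pos hκ hc).le
    have h7 : κ / c * (c / κ * (l2 u' ^ 2 + l2 v' ^ 2)) = l2 u' ^ 2 + l2 v' ^ 2 := by
      field_simp
    rw [h7] at h6
    linarith
  have n1 := l2_nonneg r₁
  have n2 := l2_nonneg r₂
  have hR : 0 ≤ κ / c * l2 r₁ := by positivity
  have hT : 0 ≤ κ / c * l2 r₂ := by positivity
  have b1 := le_add_of_quadratic hR hT h4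
  have b2 := le_add_of_quadratic (x := l2 v') (y := l2 u') hT hR (by linarith)
  have hone : l2 (μ • (1 : Fin N → ℝ)) = |μ| * √N := by
    rw [l2_smul]; simp [l2]
  constructor
  · have : l2 u ≤ l2 u' + l2 (μ • (1 : Fin N → ℝ)) := by
      have e : u = u' - μ • 1 := by simp [u']
      conv_lhs => rw [e]
      exact l2_sub_le _ _
    rw [hone] at this; linarith
  · have : l2 v ≤ l2 v' + l2 (μ • (1 : Fin N → ℝ)) := by
      have e : v = v' + μ • 1 := by simp [v']
      conv_lhs => rw [e]
      exact l2_add_le _ _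
    rw [hone] at this; linarith

/-- The a priori bound applied to a difference: the mean of the second component is the only free
parameter of the solution set. Linearity of the backfitting limit in the data rests on this. -/
lemma eq_of_isSol (h : BlockSystem L κ c a A₁ A₂ H) {r₁ r₂ u v u' v' : Fin N → ℝ}
    (hs : IsSol A₁ A₂ H r₁ r₂ u v) (hs' : IsSol A₁ A₂ H r₁ r₂ u' v')
    (hμ : (Hᵀ *ᵥ 1) ⬝ᵥ v = (Hᵀ *ᵥ 1) ⬝ᵥ v') : u = u' ∧ v = v' := by
  have hd : IsSol A₁ A₂ H 0 0 (u - u') (v - v') := by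
    constructor
    · rw [Matrix.mulVec_sub, Matrix.mulVec_sub]
      have := hs.1.trans hs'.1.symm
      rw [← sub_eq_zero] at this; rw [← this]; abel
    · rw [Matrix.mulVec_sub, Matrix.mulVec_sub]
      have := hs.2.trans hs'.2.symm
      rw [← sub_eq_zero] at this; rw [← this]; abel
  have h1 := h.l2_le hd
  rw [dotProduct_sub, hμ, sub_self, abs_zero, zero_mul, l2_zero, add_zero, add_zero,
    mul_zero] at h1
  have key : ∀ w : Fin N → ℝ, l2 w ≤ 0 → w = 0 := fun w hw => by
    ext i
    exact abs_eq_zero.1 (le_antisymm ((abs_apply_le_l2 w i).trans hw) (abs_nonneg _))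
  exact ⟨sub_eq_zero.1 (key _ h1.1), sub_eq_zero.1 (key _ h1.2)⟩

/-- Obtained by summing the first block equation; it transfers control of the mean from one
component to the other. -/
lemma sum_eq (h : BlockSystem L κ c a A₁ A₂ H) {r₁ r₂ u v : Fin N → ℝ}
    (hs : IsSol A₁ A₂ H r₁ r₂ u v) : (H *ᵥ 1) ⬝ᵥ u + (Hᵀ *ᵥ 1) ⬝ᵥ v = 1 ⬝ᵥ r₁ := by
  rw [← hs.1, dotProduct_add, h.sum_mulVec₁, dotProduct_mulVec_comm H]

/-- Convergence of block Gauss–Seidel iterations. -/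
lemma exists_tendsto (h : BlockSystem L κ c a A₁ A₂ H) {r₁ r₂ : Fin N → ℝ}
    (hr : 1 ⬝ᵥ r₁ = 1 ⬝ᵥ r₂) {u v : ℕ → Fin N → ℝ}
    (hu : ∀ l, A₁ *ᵥ u (l + 1) + H *ᵥ v l = r₁)
    (hv : ∀ l, Hᵀ *ᵥ u (l + 1) + A₂ *ᵥ v (l + 1) = r₂) :
    ∃ u' v', Tendsto u atTop (𝓝 u') ∧ Tendsto v atTop (𝓝 v') ∧ IsSol A₁ A₂ H r₁ r₂ u' v' ∧
      (Hᵀ *ᵥ 1) ⬝ᵥ v' = (Hᵀ *ᵥ 1) ⬝ᵥ v 0 := by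
  have hc := h.c_pos
  have ha := h.a_pos
  have hκ := h.κ_pos
  -- Summing both half-steps and using that r₁ and r₂ have the same total shows that the mean of v
  -- never changes. This selects the limit among all solutions and centres the increments.
  have hcons : ∀ l, (Hᵀ *ᵥ 1) ⬝ᵥ v (l + 1) = (Hᵀ *ᵥ 1) ⬝ᵥ v l := by
    intro l
    have h1 := congrArg (fun w => (1 : Fin N → ℝ) ⬝ᵥ w) (hu l)
    have h2 := congrArg (fun w => (1 : Fin N → ℝ) ⬝ᵥ w) (hv l)
    simp only [dotProduct_add, h.sum_mulVec₁, h.sum_mulVec₂] at h1 h2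
    rw [dotProduct_mulVec_comm H] at h1
    rw [dotProduct_mulVec_comm Hᵀ, Matrix.transpose_transpose] at h2
    linarith
  set δ : ℕ → Fin N → ℝ := fun l => v (l + 1) - v l with hδ
  set η : ℕ → Fin N → ℝ := fun l => u (l + 2) - u (l + 1) with hη
  have hδ0 : ∀ l, (Hᵀ *ᵥ 1) ⬝ᵥ δ l = 0 := fun l => by
    simp only [hδ]; rw [dotProduct_sub, hcons, sub_self]
  have e1 : ∀ l, A₁ *ᵥ η l + H *ᵥ δ l = 0 := fun l => by
    simp only [hη, hδ, Matrix.mulVec_sub]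
    have := (hu (l + 1)).trans (hu l).symm
    rw [← sub_eq_zero] at this; rw [← this]; abel
  have e2 : ∀ l, Hᵀ *ᵥ η l + A₂ *ᵥ δ (l + 1) = 0 := fun l => by
    simp only [hη, hδ, Matrix.mulVec_sub]
    have := (hv (l + 1)).trans (hv l).symm
    rw [← sub_eq_zero] at this; rw [← this]; abel
  set E : ℕ → ℝ := fun l => δ l ⬝ᵥ (A₂ *ᵥ δ l) with hE
  have hEc : ∀ l, c / κ * l2 (δ l) ^ 2 ≤ E l := fun l => h.coercive₂ _
  have hE0 : ∀ l, 0 ≤ E l := fun l => le_trans (by positivity) (hEc l)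
  set τ := c / ((2 * L + 1) * a) with hτ
  have hτ0 : 0 < τ := by positivity
  have hEb : ∀ l, τ * E l ≤ c / κ * l2 (δ l) ^ 2 := fun l => by
    have h1 := (le_abs_self _).trans (h.band₂.abs_bilin_le h.bdd₂ (by positivity) (δ l) (δ l))
    have h2 := mul_le_mul_of_nonneg_left h1 hτ0.le
    refine h2.trans (le_of_eq ?_)
    rw [hτ]; field_simp
  -- Testing the two equations with η_l and δ_{l+1}: nonnegativity at (η_l, δ_{l+1}) gives E_{l+1} ≤
  -- η_l·A₁η_l, and coercivity at (η_l, δ_l) gives η_l·A₁η_l ≤ E_l - (c/κ)|δ_l|².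
  have hstep : ∀ l, E (l + 1) ≤ (1 - τ) * E l := by
    intro l
    have d1 := congrArg (fun w => η l ⬝ᵥ w) (e1 l)
    have d2 := congrArg (fun w => δ (l + 1) ⬝ᵥ w) (e2 l)
    simp only [dotProduct_add, dotProduct_zero] at d1 d2
    have c1 := h.coercive (η l) (δ l) (Or.inr (hδ0 l))
    have c2 := h.nonneg (η l) (δ (l + 1))
    simp only [jointForm] at c1 c2
    rw [dotProduct_mulVec_comm Hᵀ, Matrix.transpose_transpose, dotProduct_comm (H *ᵥ _)] at d2
    have hb := hEb l
    have : 0 ≤ c / κ * l2 (η l) ^ 2 := by positivity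
    simp only [hE] at hb ⊢
    linarith
  -- The maximum with 1/2 keeps the ratio positive even if τ exceeds 1.
  set ρ := max (1 - τ) (1 / 2) with hρ
  have hρ1 : ρ < 1 := max_lt (by linarith) (by norm_num)
  have hρ0 : 0 < ρ := lt_of_lt_of_le (by norm_num) (le_max_right _ _)
  have hgeo : ∀ l, E l ≤ E 0 * ρ ^ l := by
    intro l
    induction l with
    | zero => simp
    | succ l ih =>
      calc E (l + 1) ≤ (1 - τ) * E l := hstep l
        _ ≤ ρ * E l := mul_le_mul_of_nonneg_right (le_max_left _ _) (hE0 l)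
        _ ≤ ρ * (E 0 * ρ ^ l) := mul_le_mul_of_nonneg_left ih hρ0.le
        _ = _ := by ring
  have hdist : ∀ l, dist (v l) (v (l + 1)) ≤ √(κ / c * E 0) * (√ρ) ^ l := by
    intro l
    have h1 : dist (v l) (v (l + 1)) ≤ l2 (δ l) := by
      rw [dist_comm, dist_eq_norm, pi_norm_le_iff_of_nonneg (l2_nonneg _)]
      exact fun i => abs_apply_le_l2 (δ l) i
    refine h1.trans ?_
    refine (pow_le_pow_iff_left₀ (l2_nonneg _) (by positivity) two_ne_zero).1 ?_
    have hx : 0 ≤ κ / c * E 0 := mul_nonneg (by positivity) (hE0 0)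
    rw [mul_pow, ← pow_mul, mul_comm l 2, pow_mul, Real.sq_sqrt hx, Real.sq_sqrt hρ0.le]
    have h2 := (hEc l).trans (hgeo l)
    have h3 := mul_le_mul_of_nonneg_left h2 (div_pos hκ hc).le
    have h4 : κ / c * (c / κ * l2 (δ l) ^ 2) = l2 (δ l) ^ 2 := by field_simp
    rw [h4] at h3
    linarith
  have hcau : CauchySeq v := cauchySeq_of_le_geometric (√ρ) _ (by
    rw [Real.sqrt_lt' one_pos]; simpa using hρ1) hdist
  obtain ⟨v', hv'⟩ := cauchySeq_tendsto_of_complete hcau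
  have hueq : ∀ l, u (l + 1) = A₁⁻¹ *ᵥ (r₁ - H *ᵥ v l) := fun l => by
    rw [← hu l, add_sub_cancel_right, Matrix.mulVec_mulVec, Matrix.nonsing_inv_mul _ h.isUnit₁,
      Matrix.one_mulVec]
  have hcont : Continuous fun w : Fin N → ℝ => A₁⁻¹ *ᵥ (r₁ - H *ᵥ w) := by fun_prop
  have hu1 : Tendsto (fun l => u (l + 1)) atTop (𝓝 (A₁⁻¹ *ᵥ (r₁ - H *ᵥ v'))) := by
    simp only [hueq]
    exact (hcont.tendsto v').comp hv'
  have hv1 := (tendsto_add_atTop_iff_nat 1).2 hv'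
  refine ⟨_, v', (tendsto_add_atTop_iff_nat 1).1 hu1, hv', ⟨?_, ?_⟩, ?_⟩
  · rw [Matrix.mulVec_mulVec, Matrix.mul_nonsing_inv _ h.isUnit₁, Matrix.one_mulVec,
      sub_add_cancel]
  · have c1 : Continuous fun w : (Fin N → ℝ) × (Fin N → ℝ) => Hᵀ *ᵥ w.1 + A₂ *ᵥ w.2 := by fun_prop
    have t1 := (c1.tendsto _).comp (hu1.prodMk_nhds hv1)
    have t2 : (fun w : (Fin N → ℝ) × (Fin N → ℝ) => Hᵀ *ᵥ w.1 + A₂ *ᵥ w.2) ∘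
        (fun l => (u (l + 1), v (l + 1))) = fun _ => r₂ := funext fun l => hv l
    rw [t2] at t1
    exact (tendsto_nhds_unique t1 tendsto_const_nhds)
  · have c1 : Continuous fun w : Fin N → ℝ => (Hᵀ *ᵥ 1) ⬝ᵥ w := by fun_prop
    have t1 := (c1.tendsto _).comp hv'
    have t2 : (fun w : Fin N → ℝ => (Hᵀ *ᵥ 1) ⬝ᵥ w) ∘ v = fun _ => (Hᵀ *ᵥ 1) ⬝ᵥ v 0 := by
      funext l
      induction l with
      | zero => rfl
      | succ l ih => exact (hcons l).trans ih
    rw [t2] at t1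
    exact tendsto_nhds_unique t1 tendsto_const_nhds

end BlockSystem

/-! ### Localized estimates for the block system -/

/-- The cross matrix is smoothing: it maps localized vectors to small ones. -/
structure CrossBound {N : ℕ} (κ b : ℝ) (W₁ W₂ : Fin N → ℝ) (H : Matrix (Fin N) (Fin N) ℝ) :
    Prop where
  row : ∀ v, l2 (Hᵀ *ᵥ v) ≤ b / (κ * √κ) * l2 (W₁ * v)
  col : ∀ v, l2 (H *ᵥ v) ≤ b / (κ * √κ) * l2 (W₂ * v)
  both : ∀ u v, |u ⬝ᵥ (H *ᵥ v)| ≤ b / κ ^ 2 * l2 (W₁ * u) * l2 (W₂ * v)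

lemma CrossBound.swap {N : ℕ} {κ b : ℝ} {W₁ W₂ : Fin N → ℝ} {H : Matrix (Fin N) (Fin N) ℝ}
    (h : CrossBound κ b W₁ W₂ H) : CrossBound κ b W₂ W₁ Hᵀ where
  row v := by rw [Matrix.transpose_transpose]; exact h.col v
  col v := h.row v
  both u v := by
    rw [dotProduct_mulVec_comm, Matrix.transpose_transpose, dotProduct_comm]
    have := h.both v u
    linarith

namespace BlockSystem

variable {N L : ℕ} {κ c a b : ℝ} {A₁ A₂ H : Matrix (Fin N) (Fin N) ℝ}

lemma sqrt_card_le (h : BlockSystem L κ c a A₁ A₂ H) : √(N : ℝ) ≤ √a * √κ := by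
  rw [← Real.sqrt_mul h.a_pos.le]; exact Real.sqrt_le_sqrt h.card_le

/-- Pointwise bound for solutions with a small right-hand side. -/
lemma abs_dotProduct_le (h : BlockSystem L κ c a A₁ A₂ H) (hb : 0 ≤ b) {r₁ r₂ u v w : Fin N → ℝ}
    (hs : IsSol A₁ A₂ H r₁ r₂ u v) (hr₁ : ∀ i, |r₁ i| ≤ b / κ ^ 2) (hr₂ : ∀ i, |r₂ i| ≤ b / κ ^ 2)
    (hμ : |(Hᵀ *ᵥ 1) ⬝ᵥ v| ≤ b / κ) (hw : l2 (Hᵀ *ᵥ w) ≤ b / √κ) (hw1 : ∑ i, |w i| ≤ b * κ) :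
    |(A₁ *ᵥ w) ⬝ᵥ u| ≤ (b ^ 2 + b * ((2 / c + 1) * b * √a)) / κ := by
  have hc := h.c_pos
  have hκ := h.κ_pos
  -- With s = √κ as a variable, all powers of κ become integral powers of s and the rate bookkeeping
  -- is rational.
  obtain ⟨s, hs0, hsκ⟩ : ∃ s : ℝ, 0 < s ∧ s ^ 2 = κ := ⟨√κ, Real.sqrt_pos.2 hκ, Real.sq_sqrt hκ.le⟩
  have hsq : √κ = s := by rw [← hsκ, Real.sqrt_sq hs0.le]
  have hN := h.sqrt_card_le
  rw [hsq] at hN hw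
  have hl : ∀ r : Fin N → ℝ, (∀ i, |r i| ≤ b / κ ^ 2) → l2 r ≤ √a * s * (b / κ ^ 2) := by
    intro r hr
    refine (l2_le_of_abs_le hr (by positivity)).trans ?_
    rw [Fintype.card_fin]
    gcongr
  have h1 := (h.l2_le hs).2
  have hv : l2 v ≤ (2 / c + 1) * b * √a / s := by
    refine h1.trans ?_
    calc κ / c * (l2 r₁ + l2 r₂) + |(Hᵀ *ᵥ 1) ⬝ᵥ v| * √N
        ≤ κ / c * (√a * s * (b / κ ^ 2) + √a * s * (b / κ ^ 2)) + b / κ * (√a * s) := by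
          gcongr
          · exact hl r₁ hr₁
          · exact hl r₂ hr₂
      _ = _ := by rw [← hsκ]; field_simp; ring
  -- The first term pairs the ℓ¹ norm O(κ) of w with entries O(κ^{-2}); the second pairs two vectors
  -- of Euclidean norm O(κ^{-1/2}). Both are O(1/κ).
  have e : (A₁ *ᵥ w) ⬝ᵥ u = w ⬝ᵥ r₁ - (Hᵀ *ᵥ w) ⬝ᵥ v := by
    rw [← hs.1, dotProduct_add, dotProduct_mulVec_comm A₁, h.symm₁, dotProduct_mulVec_comm H]
    ring
  rw [e]
  have b1 : |w ⬝ᵥ r₁| ≤ b * κ * (b / κ ^ 2) := by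
    calc |w ⬝ᵥ r₁| ≤ ∑ i, |w i| * (b / κ ^ 2) := by
          refine (Finset.abs_sum_le_sum_abs _ _).trans (Finset.sum_le_sum fun i _ => ?_)
          rw [abs_mul]; exact mul_le_mul_of_nonneg_left (hr₁ i) (abs_nonneg _)
      _ ≤ _ := by
          rw [← Finset.sum_mul]; exact mul_le_mul_of_nonneg_right hw1 (by positivity)
  have b2 : |(Hᵀ *ᵥ w) ⬝ᵥ v| ≤ b / s * ((2 / c + 1) * b * √a / s) :=
    (AddSpline.abs_dotProduct_le _ _).trans (mul_le_mul hw hv (l2_nonneg _) (by positivity))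
  refine (abs_sub _ _).trans ((add_le_add b1 b2).trans (le_of_eq ?_))
  rw [← hsκ]; field_simp

/-- The response of one component, tested against a smoothed vector, to data localized in the other
component. -/
lemma abs_dotProduct_local_le (h : BlockSystem L κ c a A₁ A₂ H) (hb : 0 ≤ b) {ρ : ℝ} (hρ : 0 ≤ ρ)
    {W₁ W₂ : Fin N → ℝ} (hH : CrossBound κ b W₁ W₂ H) {r₁ r₂ u v w t : Fin N → ℝ}
    (hs : IsSol A₁ A₂ H r₁ r₂ u v) (ht : A₂ *ᵥ t = r₂) (hw : l2 (W₁ * w) ≤ b * κ)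
    (htl : l2 (W₂ * t) ≤ b * κ * ρ) (hr₁ : l2 r₁ ≤ b * ρ / √κ)
    (hμ : |(Hᵀ *ᵥ 1) ⬝ᵥ v - (Hᵀ *ᵥ 1) ⬝ᵥ t| ≤ b * ρ) :
    |(Hᵀ *ᵥ w) ⬝ᵥ v| ≤ (b ^ 3 + b ^ 2 * ((b + b ^ 2) / c + b * √a)) * ρ := by
  have hc := h.c_pos
  have hκ := h.κ_pos
  obtain ⟨s, hs0, hsκ⟩ : ∃ s : ℝ, 0 < s ∧ s ^ 2 = κ := ⟨√κ, Real.sqrt_pos.2 hκ, Real.sq_sqrt hκ.le⟩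
  have hsq : √κ = s := by rw [← hsκ, Real.sqrt_sq hs0.le]
  have hN := h.sqrt_card_le
  have hrow := hH.row w
  have hcol := hH.col t
  have hboth := hH.both w t
  rw [hsq] at hN hr₁ hrow hcol
  -- Removing the decoupled response t of the second component leaves data small in the plain norm,
  -- to which the a priori bound applies. The part t is localized, so its pairing with w uses the
  -- doubly weighted bound on H.
  have hs' : IsSol A₁ A₂ H (r₁ - H *ᵥ t) 0 u (v - t) := by
    constructor
    · rw [← hs.1, Matrix.mulVec_sub]; abel
    · rw [Matrix.mulVec_sub, ht, ← hs.2]; abel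
  have h1 := (h.l2_le hs').2
  rw [l2_zero, add_zero, dotProduct_sub] at h1
  have hHt : l2 (H *ᵥ t) ≤ b / (κ * s) * (b * κ * ρ) :=
    hcol.trans (mul_le_mul_of_nonneg_left htl (by positivity))
  have hz : l2 (Hᵀ *ᵥ w) ≤ b / (κ * s) * (b * κ) :=
    hrow.trans (mul_le_mul_of_nonneg_left hw (by positivity))
  have hv : l2 (v - t) ≤ ((b + b ^ 2) / c + b * √a) * s * ρ := by
    refine h1.trans ?_
    calc _ ≤ κ / c * (b * ρ / s + b / (κ * s) * (b * κ * ρ)) + b * ρ * (√a * s) := by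
          gcongr
          exact (l2_sub_le _ _).trans (add_le_add hr₁ hHt)
      _ = _ := by rw [← hsκ]; field_simp
  have b1 : |(Hᵀ *ᵥ w) ⬝ᵥ (v - t)|
      ≤ b / (κ * s) * (b * κ) * (((b + b ^ 2) / c + b * √a) * s * ρ) :=
    (AddSpline.abs_dotProduct_le _ _).trans (mul_le_mul hz hv (l2_nonneg _) (by positivity))
  have b2 : |(Hᵀ *ᵥ w) ⬝ᵥ t| ≤ b / κ ^ 2 * (b * κ) * (b * κ * ρ) := by
    rw [← dotProduct_mulVec_comm]
    refine hboth.trans ?_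
    have := l2_nonneg (W₂ * t)
    gcongr
  have e : (Hᵀ *ᵥ w) ⬝ᵥ v = (Hᵀ *ᵥ w) ⬝ᵥ t + (Hᵀ *ᵥ w) ⬝ᵥ (v - t) := by
    rw [← dotProduct_add]; congr 1; abel
  rw [e]
  refine (abs_add_le _ _).trans ((add_le_add b2 b1).trans (le_of_eq ?_))
  rw [← hsκ]; field_simp

/-- Least-squares bound for solutions with design right-hand side. -/
lemma sq_le_of_design (h : BlockSystem L κ c a A₁ A₂ H) {n : ℕ}
    {X₁ X₂ : Matrix (Fin n) (Fin N) ℝ}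
    (hX : ∀ u v, (1 / (n : ℝ)) * l2 (X₁ *ᵥ u + X₂ *ᵥ v) ^ 2 ≤ jointForm A₁ A₂ H u v)
    {e : Fin n → ℝ} {u v : Fin N → ℝ}
    (hs : IsSol A₁ A₂ H ((1 / (n : ℝ)) • (X₁ᵀ *ᵥ e)) ((1 / (n : ℝ)) • (X₂ᵀ *ᵥ e)) u v)
    (hv : (Hᵀ *ᵥ 1) ⬝ᵥ v = 0) :
    l2 u ^ 2 ≤ κ / c * ((1 / (n : ℝ)) * l2 e ^ 2) ∧
    l2 v ^ 2 ≤ κ / c * ((1 / (n : ℝ)) * l2 e ^ 2) := by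
  have hc := h.c_pos
  have hκ := h.κ_pos
  have h1 := h.coercive u v (Or.inr hv)
  have h2 := hX u v
  have e1 := hs.jointForm_eq
  have e2 : jointForm A₁ A₂ H u v = (1 / (n : ℝ)) * ((X₁ *ᵥ u + X₂ *ᵥ v) ⬝ᵥ e) := by
    rw [e1, dotProduct_smul, dotProduct_smul, dotProduct_mulVec_comm, dotProduct_mulVec_comm,
      Matrix.transpose_transpose, Matrix.transpose_transpose, add_dotProduct, smul_eq_mul,
      smul_eq_mul]
    ring
  have h3 := dotProduct_le_l2 (X₁ *ᵥ u + X₂ *ᵥ v) e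
  set x := l2 (X₁ *ᵥ u + X₂ *ᵥ v)
  set y := l2 e
  have hn : (0 : ℝ) ≤ 1 / (n : ℝ) := by positivity
  -- Young's inequality; the fitted part x²/n is dominated by the form itself and is absorbed,
  -- leaving only the norm of the data.
  have h4 : jointForm A₁ A₂ H u v ≤ (1 / (n : ℝ)) * ((x ^ 2 + y ^ 2) / 2) := by
    rw [e2]
    refine mul_le_mul_of_nonneg_left (h3.trans ?_) hn
    nlinarith [sq_nonneg (x - y)]
  have h5 : c / κ * (l2 u ^ 2 + l2 v ^ 2) ≤ (1 / (n : ℝ)) * y ^ 2 := by linarith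
  have h6 := mul_le_mul_of_nonneg_left h5 (div_pos hκ hc).le
  have h7 : κ / c * (c / κ * (l2 u ^ 2 + l2 v ^ 2)) = l2 u ^ 2 + l2 v ^ 2 := by field_simp
  rw [h7] at h6
  have := sq_nonneg (l2 u)
  have := sq_nonneg (l2 v)
  constructor <;> linarith

end BlockSystem

/-- A block system from a design, with weights `W₁`, `W₂` adapted to two points and vectors `w₁`,
`w₂` localized there. -/
structure LocalizedSystem {N n : ℕ} (L : ℕ) (κ c a b : ℝ) (A₁ A₂ H : Matrix (Fin N) (Fin N) ℝ)
    (X₁ X₂ : Matrix (Fin n) (Fin N) ℝ) (S : Fin n → ℝ) (W₁ W₂ w₁ w₂ : Fin N → ℝ) : Prop where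
  sys : BlockSystem L κ c a A₁ A₂ H
  n_pos : 0 < n
  one_le : 1 ≤ b
  fit : ∀ u v, (1 / (n : ℝ)) * l2 (X₁ *ᵥ u + X₂ *ᵥ v) ^ 2 ≤ jointForm A₁ A₂ H u v
  S_le : ∀ l, |S l| ≤ b
  cross : CrossBound κ b W₁ W₂ H
  crossS : CrossBound κ b W₁ W₂ ((1 / (n : ℝ)) • (X₁ᵀ * Matrix.diagonal S * X₂))
  loc₁ : l2 (W₁ * w₁) ≤ b * κ
  loc₂ : l2 (W₂ * w₂) ≤ b * κ
  le₁ : ∀ v, l2 v ≤ l2 (W₁ * v)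
  le₂ : ∀ v, l2 v ≤ l2 (W₂ * v)
  sum₁ : ∀ v, ∑ i, |v i| ≤ b * l2 (W₁ * v)
  sum₂ : ∀ v, ∑ i, |v i| ≤ b * l2 (W₂ * v)
  solve₁ : ∀ t, l2 (W₁ * t) ≤ b * κ * l2 (W₁ * (A₁ *ᵥ t))
  solve₂ : ∀ t, l2 (W₂ * t) ≤ b * κ * l2 (W₂ * (A₂ *ᵥ t))
  mul₁ : ∀ v, l2 (W₁ * (((1 / (n : ℝ)) • (X₁ᵀ * Matrix.diagonal S * X₁)) *ᵥ v))
    ≤ b / κ * l2 (W₁ * v)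
  mul₂ : ∀ v, l2 (W₂ * (((1 / (n : ℝ)) • (X₂ᵀ * Matrix.diagonal S * X₂)) *ᵥ v))
    ≤ b / κ * l2 (W₂ * v)

namespace LocalizedSystem

variable {N n L : ℕ} {κ c a b : ℝ} {A₁ A₂ H : Matrix (Fin N) (Fin N) ℝ}
  {X₁ X₂ : Matrix (Fin n) (Fin N) ℝ} {S : Fin n → ℝ} {W₁ W₂ w₁ w₂ : Fin N → ℝ}

lemma swap (h : LocalizedSystem L κ c a b A₁ A₂ H X₁ X₂ S W₁ W₂ w₁ w₂) :
    LocalizedSystem L κ c a b A₂ A₁ Hᵀ X₂ X₁ S W₂ W₁ w₂ w₁ where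
  sys := h.sys.swap
  n_pos := h.n_pos
  one_le := h.one_le
  fit u v := by rw [jointForm_swap, add_comm]; exact h.fit v u
  S_le := h.S_le
  cross := h.cross.swap
  crossS := by
    have := h.crossS.swap
    rwa [Matrix.transpose_smul, Matrix.transpose_mul, Matrix.transpose_mul,
      Matrix.transpose_transpose, Matrix.diagonal_transpose, ← Matrix.mul_assoc] at this
  loc₁ := h.loc₂
  loc₂ := h.loc₁
  le₁ := h.le₂
  le₂ := h.le₁
  sum₁ := h.sum₂
  sum₂ := h.sum₁
  solve₁ := h.solve₂
  solve₂ := h.solve₁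
  mul₁ := h.mul₂
  mul₂ := h.mul₁

/-- The cross matrix averages over the other coordinate: a localized vector of norm O(κ) is sent to
one of norm κ^{-3/2}·κ. This gain makes the coupling between the components negligible. -/
lemma l2_smooth_le (h : LocalizedSystem L κ c a b A₁ A₂ H X₁ X₂ S W₁ W₂ w₁ w₂) :
    l2 (Hᵀ *ᵥ w₁) ≤ b ^ 2 / √κ := by
  have hκ := h.sys.κ_pos
  have hb : 0 < b := one_pos.trans_le h.one_le
  have hs : 0 < √κ := Real.sqrt_pos.2 hκ
  refine (h.cross.row w₁).trans ((mul_le_mul_of_nonneg_left h.loc₁ (by positivity)).trans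
    (le_of_eq ?_))
  field_simp

/-- The local part of the estimator's weights has squared norm of the order κ/n of the variance: the
quadratic form at (w₁, 0) dominates the fit and is bounded through the band. -/
lemma l2_design_sq_le (h : LocalizedSystem L κ c a b A₁ A₂ H X₁ X₂ S W₁ W₂ w₁ w₂) :
    l2 ((1 / (n : ℝ)) • (X₁ *ᵥ w₁)) ^ 2 ≤ ((2 * L + 1) * a * b ^ 2) * κ / n := by
  have hκ := h.sys.κ_pos
  have ha := h.sys.a_pos
  have hb : 0 < b := one_pos.trans_le h.one_le
  have hn : (0 : ℝ) < n := by exact_mod_cast h.n_pos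
  have h1 := h.fit w₁ 0
  rw [Matrix.mulVec_zero, add_zero] at h1
  have h2 : jointForm A₁ A₂ H w₁ 0 = w₁ ⬝ᵥ (A₁ *ᵥ w₁) := by simp [jointForm]
  have h3 := (le_abs_self _).trans (h.sys.band₁.abs_bilin_le h.sys.bdd₁ (by positivity) w₁ w₁)
  have h4 := (h.le₁ w₁).trans h.loc₁
  have h5 : l2 (X₁ *ᵥ w₁) ^ 2 * (1 / n) ≤ (2 * L + 1) * (a / κ) * (b * κ) * (b * κ) := by
    have h6 : (2 * L + 1) * (a / κ) * l2 w₁ * l2 w₁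
        ≤ (2 * L + 1) * (a / κ) * (b * κ) * (b * κ) := by
      have := l2_nonneg w₁
      gcongr
    linarith
  rw [l2_smul, mul_pow, sq_abs]
  calc (1 / (n : ℝ)) ^ 2 * l2 (X₁ *ᵥ w₁) ^ 2 = (1 / n) * (l2 (X₁ *ᵥ w₁) ^ 2 * (1 / n)) := by ring
    _ ≤ (1 / n) * ((2 * L + 1) * (a / κ) * (b * κ) * (b * κ)) := by gcongr
    _ = _ := by field_simp

/-- The part of the first estimator that is carried by the second component has a small coefficient
vector. -/
lemma l2_remainder_sq_le (h : LocalizedSystem L κ c a b A₁ A₂ H X₁ X₂ S W₁ W₂ w₁ w₂)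
    {v : (Fin n → ℝ) → Fin N → ℝ}
    (hv : ∀ e, l2 (v e) ^ 2 ≤ κ / c * ((1 / (n : ℝ)) * l2 e ^ 2))
    {α : Fin n → ℝ} (hα : ∀ e, α ⬝ᵥ e = (Hᵀ *ᵥ w₁) ⬝ᵥ v e) :
    l2 α ^ 2 ≤ b ^ 4 / c / n := by
  have hκ := h.sys.κ_pos
  have hc := h.sys.c_pos
  have hs : 0 < √κ := Real.sqrt_pos.2 hκ
  have hb : 0 < b := one_pos.trans_le h.one_le
  have hn : (0 : ℝ) < n := by exact_mod_cast h.n_pos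
  -- The vector α is tested against itself: it is the representer of a functional of the response v,
  -- and v α is controlled by α.
  have h1 : l2 α ^ 2 ≤ l2 (Hᵀ *ᵥ w₁) * l2 (v α) := by
    rw [l2_sq_eq_dotProduct, hα]; exact dotProduct_le_l2 _ _
  have h2 : (l2 α ^ 2) ^ 2 ≤ (b ^ 4 / c / n) * l2 α ^ 2 := by
    calc (l2 α ^ 2) ^ 2 ≤ (l2 (Hᵀ *ᵥ w₁) * l2 (v α)) ^ 2 := by gcongr
      _ = l2 (Hᵀ *ᵥ w₁) ^ 2 * l2 (v α) ^ 2 := by ring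
      _ ≤ (b ^ 2 / √κ) ^ 2 * (κ / c * ((1 / (n : ℝ)) * l2 α ^ 2)) := by
        have := l2_nonneg (Hᵀ *ᵥ w₁)
        have := h.l2_smooth_le
        have := hv α
        gcongr
      _ = _ := by
        rw [div_pow, Real.sq_sqrt hκ.le]; field_simp
  rcases (sq_nonneg (l2 α)).eq_or_lt with h0 | h0
  · rw [← h0]; positivity
  · rw [sq (l2 α ^ 2)] at h2
    exact le_of_mul_le_mul_right h2 h0

lemma abs_sum_weighted_le {S x y : Fin n → ℝ} (hb : 0 ≤ b) (hS : ∀ l, |S l| ≤ b) :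
    |∑ l, S l * x l * y l| ≤ b * (l2 x * l2 y) := by
  calc |∑ l, S l * x l * y l| ≤ ∑ l, b * (|x l| * |y l|) := by
        refine (Finset.abs_sum_le_sum_abs _ _).trans (Finset.sum_le_sum fun l _ => ?_)
        rw [abs_mul, abs_mul, mul_assoc]
        exact mul_le_mul_of_nonneg_right (hS l) (by positivity)
    _ ≤ _ := by
        rw [← Finset.mul_sum]
        exact mul_le_mul_of_nonneg_left (sum_abs_mul_le x y) hb

lemma mul_le_of_sq_le {x y A B : ℝ} (hy : 0 ≤ y) (hx2 : x ^ 2 ≤ A) (hy2 : y ^ 2 ≤ B) :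
    x * y ≤ √A * √B :=
  mul_le_mul ((le_abs_self x).trans (Real.abs_le_sqrt hx2))
    ((le_abs_self y).trans (Real.abs_le_sqrt hy2)) hy (Real.sqrt_nonneg _)

lemma weighted_design_bilin (X Y : Matrix (Fin n) (Fin N) ℝ) (S : Fin n → ℝ) (w w' : Fin N → ℝ) :
    ∑ l, S l * ((1 / (n : ℝ)) • (X *ᵥ w)) l * ((1 / (n : ℝ)) • (Y *ᵥ w')) l
      = (1 / (n : ℝ)) * (w ⬝ᵥ (((1 / (n : ℝ)) • (Xᵀ * Matrix.diagonal S * Y)) *ᵥ w')) := by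
  rw [Matrix.smul_mulVec, dotProduct_smul, ← Matrix.mulVec_mulVec, ← Matrix.mulVec_mulVec,
    dotProduct_mulVec_comm Xᵀ, Matrix.transpose_transpose, dotProduct, smul_eq_mul, Finset.mul_sum,
    Finset.mul_sum]
  refine Finset.sum_congr rfl fun l _ => ?_
  simp only [Pi.smul_apply, smul_eq_mul, Matrix.mulVec_diagonal]
  ring

/-- The variance of the first estimator is that of its local part up to a factor `κ^{-1/2}`. -/
lemma abs_variance_sub_le (h : LocalizedSystem L κ c a b A₁ A₂ H X₁ X₂ S W₁ W₂ w₁ w₂)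
    {v : (Fin n → ℝ) → Fin N → ℝ}
    (hv : ∀ e, l2 (v e) ^ 2 ≤ κ / c * ((1 / (n : ℝ)) * l2 e ^ 2))
    {α : Fin n → ℝ} (hα : ∀ e, α ⬝ᵥ e = (Hᵀ *ᵥ w₁) ⬝ᵥ v e) :
    |∑ l, S l * ((1 / (n : ℝ)) • (X₁ *ᵥ w₁) - α) l * ((1 / (n : ℝ)) • (X₁ *ᵥ w₁) - α) l
      - (1 / (n : ℝ)) * (w₁ ⬝ᵥ (((1 / (n : ℝ)) • (X₁ᵀ * Matrix.diagonal S * X₁)) *ᵥ w₁))|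
      ≤ b * (2 * √((2 * L + 1) * a * b ^ 2) * √(b ^ 4 / c) + b ^ 4 / c) * (√κ / n) := by
  have hκ := h.sys.κ_pos
  have hc := h.sys.c_pos
  have ha := h.sys.a_pos
  have hb : 0 < b := one_pos.trans_le h.one_le
  have hn : (0 : ℝ) < n := by exact_mod_cast h.n_pos
  have hα2 := h.l2_remainder_sq_le hv hα
  have hy2 := h.l2_design_sq_le
  set y := (1 / (n : ℝ)) • (X₁ *ᵥ w₁) with hy
  have e : ∑ l, S l * (y - α) l * (y - α) l
      - (1 / (n : ℝ)) * (w₁ ⬝ᵥ (((1 / (n : ℝ)) • (X₁ᵀ * Matrix.diagonal S * X₁)) *ᵥ w₁))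
      = ∑ l, S l * α l * α l - 2 * ∑ l, S l * y l * α l := by
    rw [← weighted_design_bilin, ← hy, Finset.mul_sum, ← Finset.sum_sub_distrib,
      ← Finset.sum_sub_distrib]
    exact Finset.sum_congr rfl fun l _ => by simp only [Pi.sub_apply]; ring
  rw [e]
  have b1 := abs_sum_weighted_le (x := α) (y := α) hb.le h.S_le
  have b2 := abs_sum_weighted_le (x := y) (y := α) hb.le h.S_le
  have b3 := mul_le_of_sq_le (l2_nonneg α) hy2 hα2
  have hs1 : 1 ≤ √κ := by rw [Real.one_le_sqrt]; exact h.sys.one_le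
  -- The mixed term is the geometric mean of κ/n and 1/n, hence smaller than the variance by √κ.
  have e3 : √((2 * L + 1) * a * b ^ 2 * κ / n) * √(b ^ 4 / c / n)
      = √((2 * L + 1) * a * b ^ 2) * √(b ^ 4 / c) * (√κ / n) := by
    rw [Real.sqrt_div (by positivity), Real.sqrt_div (by positivity : 0 ≤ b ^ 4 / c),
      Real.sqrt_mul (by positivity) κ]
    have := Real.mul_self_sqrt hn.le
    have hsn : 0 < √(n : ℝ) := Real.sqrt_pos.2 hn
    field_simp
    rw [Real.sq_sqrt hn.le]
  rw [e3] at b3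
  have b4 : l2 α * l2 α ≤ b ^ 4 / c * (√κ / n) := by
    rw [← sq]
    refine hα2.trans ?_
    rw [mul_div_assoc', div_le_div_iff_of_pos_right hn]
    exact le_mul_of_one_le_right (by positivity) hs1
  refine (abs_sub _ _).trans ?_
  rw [abs_mul, abs_two]
  have b5 := mul_le_mul_of_nonneg_left b3 hb.le
  have b6 := mul_le_mul_of_nonneg_left b4 hb.le
  linarith

/-- Cross term of the covariance: the smooth part of the first estimator against the local part of
the second one. -/
lemma abs_cross_le (h : LocalizedSystem L κ c a b A₁ A₂ H X₁ X₂ S W₁ W₂ w₁ w₂)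
    {u v : Fin N → ℝ}
    (hs : IsSol A₁ A₂ H ((1 / (n : ℝ)) • (X₁ᵀ *ᵥ (S * (1 / (n : ℝ)) • (X₂ *ᵥ w₂))))
      ((1 / (n : ℝ)) • (X₂ᵀ *ᵥ (S * (1 / (n : ℝ)) • (X₂ *ᵥ w₂)))) u v)
    (hμ : (Hᵀ *ᵥ 1) ⬝ᵥ v = 0 ∨ (H *ᵥ 1) ⬝ᵥ u = 0) :
    |(Hᵀ *ᵥ w₁) ⬝ᵥ v| ≤ (b ^ 3 + b ^ 2 * ((b + b ^ 2) / c + b * √a)) * (b ^ 3 / n) := by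
  have hκ := h.sys.κ_pos
  have hb : 0 < b := one_pos.trans_le h.one_le
  have hn : (0 : ℝ) < n := by exact_mod_cast h.n_pos
  have hsk : 0 < √κ := Real.sqrt_pos.2 hκ
  have er : ∀ Y : Matrix (Fin n) (Fin N) ℝ,
      (1 / (n : ℝ)) • (Yᵀ *ᵥ (S * (1 / (n : ℝ)) • (X₂ *ᵥ w₂)))
      = (1 / (n : ℝ)) • (((1 / (n : ℝ)) • (Yᵀ * Matrix.diagonal S * X₂)) *ᵥ w₂) := by
    intro Y
    congr 1
    have e0 : S * (1 / (n : ℝ)) • (X₂ *ᵥ w₂)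
        = (1 / (n : ℝ)) • (Matrix.diagonal S *ᵥ (X₂ *ᵥ w₂)) := by
      ext l
      simp only [Pi.mul_apply, Pi.smul_apply, smul_eq_mul, Matrix.mulVec_diagonal]
      ring
    rw [Matrix.smul_mulVec, ← Matrix.mulVec_mulVec, ← Matrix.mulVec_mulVec, e0, Matrix.mulVec_smul]
  have hw₂ := h.loc₂
  rw [er, er] at hs
  set r₁ := (1 / (n : ℝ)) • (((1 / (n : ℝ)) • (X₁ᵀ * Matrix.diagonal S * X₂)) *ᵥ w₂) with hr₁
  set r₂ := (1 / (n : ℝ)) • (((1 / (n : ℝ)) • (X₂ᵀ * Matrix.diagonal S * X₂)) *ᵥ w₂) with hr₂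
  -- The response of the second component alone; as r₂ is localized near the second point, so is t,
  -- by `solve₂`.
  set t := A₂⁻¹ *ᵥ r₂ with ht
  have hAt : A₂ *ᵥ t = r₂ := by
    rw [ht, Matrix.mulVec_mulVec, Matrix.mul_nonsing_inv _ h.sys.isUnit₂, Matrix.one_mulVec]
  have hn1 : |1 / (n : ℝ)| = 1 / n := abs_of_pos (by positivity)
  have hl₁ : l2 r₁ ≤ b ^ 2 / n / √κ := by
    rw [hr₁, l2_smul, hn1]
    calc 1 / (n : ℝ) * l2 (((1 / (n : ℝ)) • (X₁ᵀ * Matrix.diagonal S * X₂)) *ᵥ w₂)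
        ≤ 1 / (n : ℝ) * (b / (κ * √κ) * (b * κ)) := by
          gcongr
          exact (h.crossS.col w₂).trans (mul_le_mul_of_nonneg_left hw₂ (by positivity))
      _ = _ := by field_simp
  have hl₂ : l2 (W₂ * r₂) ≤ b ^ 2 / n := by
    rw [hr₂, mul_smul_comm, l2_smul, hn1]
    calc 1 / (n : ℝ) * l2 (W₂ * (((1 / (n : ℝ)) • (X₂ᵀ * Matrix.diagonal S * X₂)) *ᵥ w₂))
        ≤ 1 / (n : ℝ) * (b / κ * (b * κ)) := by
          gcongr
          exact (h.mul₂ w₂).trans (mul_le_mul_of_nonneg_left hw₂ (by positivity))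
      _ = _ := by field_simp
  have h23 : b ^ 2 / n ≤ b ^ 3 / (n : ℝ) := by
    refine div_le_div_of_nonneg_right ?_ hn.le
    exact pow_le_pow_right₀ h.one_le (by norm_num)
  have hs2 : |1 ⬝ᵥ r₂| ≤ b ^ 3 / n := by
    have h1 : |1 ⬝ᵥ r₂| ≤ ∑ i, |r₂ i| := by
      simp only [dotProduct, Pi.one_apply, one_mul]; exact Finset.abs_sum_le_sum_abs _ _
    refine h1.trans ((h.sum₂ r₂).trans ((mul_le_mul_of_nonneg_left hl₂ hb.le).trans
      (le_of_eq ?_)))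
    ring
  have hbb : b ^ 3 / n ≤ b * (b ^ 3 / (n : ℝ)) := le_mul_of_one_le_left (by positivity) h.one_le
  refine h.sys.abs_dotProduct_local_le hb.le (by positivity) h.cross hs hAt h.loc₁ ?_ ?_ ?_
  · refine (h.solve₂ t).trans ?_
    rw [hAt]
    exact mul_le_mul_of_nonneg_left (hl₂.trans h23) (by positivity)
  · refine hl₁.trans ?_
    exact div_le_div_of_nonneg_right (h23.trans hbb) hsk.le
  · have e1 : (Hᵀ *ᵥ 1) ⬝ᵥ t = 1 ⬝ᵥ r₂ := by rw [← h.sys.sum_mulVec₂, hAt]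
    rw [e1]
    -- The solutions of interest have a centred second component. When the roles are exchanged this
    -- becomes a condition on the other component, and `sum_eq` then makes the two means agree
    -- exactly.
    rcases hμ with h0 | h0
    · rw [h0, zero_sub, abs_neg]; exact hs2.trans hbb
    · have := h.sys.swap.sum_eq hs.swap
      rw [Matrix.transpose_transpose, h0, add_zero] at this
      rw [this, sub_self, abs_zero]; positivity

/-- The covariance bound. -/
lemma abs_covariance_le (h : LocalizedSystem L κ c a b A₁ A₂ H X₁ X₂ S W₁ W₂ w₁ w₂)
    {u v : (Fin n → ℝ) → Fin N → ℝ}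
    (hs : ∀ e, IsSol A₁ A₂ H ((1 / (n : ℝ)) • (X₁ᵀ *ᵥ e)) ((1 / (n : ℝ)) • (X₂ᵀ *ᵥ e)) (u e) (v e))
    (hμ : ∀ e, (Hᵀ *ᵥ 1) ⬝ᵥ v e = 0) {α β : Fin n → ℝ}
    (hα : ∀ e, α ⬝ᵥ e = (Hᵀ *ᵥ w₁) ⬝ᵥ v e) (hβ : ∀ e, β ⬝ᵥ e = (H *ᵥ w₂) ⬝ᵥ u e) :
    |∑ l, S l * ((1 / (n : ℝ)) • (X₁ *ᵥ w₁) - α) l * ((1 / (n : ℝ)) • (X₂ *ᵥ w₂) - β) l|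
      ≤ (b ^ 3 + 2 * ((b ^ 3 + b ^ 2 * ((b + b ^ 2) / c + b * √a)) * b ^ 3) + b * (b ^ 4 / c))
        / n := by
  have hκ := h.sys.κ_pos
  have hc := h.sys.c_pos
  have hb : 0 < b := one_pos.trans_le h.one_le
  have hn : (0 : ℝ) < n := by exact_mod_cast h.n_pos
  have hα2 := h.l2_remainder_sq_le (fun e => (h.sys.sq_le_of_design h.fit (hs e) (hμ e)).2) hα
  have hβ2 := h.swap.l2_remainder_sq_le (α := β) (v := u)
    (fun e => (h.sys.sq_le_of_design h.fit (hs e) (hμ e)).1) (by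
      rw [Matrix.transpose_transpose]; exact hβ)
  set y := (1 / (n : ℝ)) • (X₁ *ᵥ w₁) with hy
  set z := (1 / (n : ℝ)) • (X₂ *ᵥ w₂) with hz
  have e : ∑ l, S l * (y - α) l * (z - β) l = ∑ l, S l * y l * z l - α ⬝ᵥ (S * z) - β ⬝ᵥ (S * y)
      + ∑ l, S l * α l * β l := by
    simp only [dotProduct, ← Finset.sum_sub_distrib, ← Finset.sum_add_distrib]
    exact Finset.sum_congr rfl fun l _ => by simp only [Pi.sub_apply, Pi.mul_apply]; ring
  have t1 : |∑ l, S l * y l * z l| ≤ b ^ 3 / n := by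
    rw [hy, hz, weighted_design_bilin, abs_mul, abs_of_pos (by positivity : 0 < 1 / (n : ℝ))]
    calc _ ≤ 1 / (n : ℝ) * (b / κ ^ 2 * (b * κ) * (b * κ)) := by
          gcongr
          refine (h.crossS.both w₁ w₂).trans ?_
          have := h.loc₁
          have := h.loc₂
          have := l2_nonneg (W₂ * w₂)
          gcongr
      _ = _ := by field_simp
  -- Cauchy–Schwarz would give √κ/n only. Reading α as a response functional evaluated at data
  -- localized in the second coordinate recovers the factor.
  have t2 : |α ⬝ᵥ (S * z)| ≤ (b ^ 3 + b ^ 2 * ((b + b ^ 2) / c + b * √a)) * (b ^ 3 / n) := by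
    rw [hα]
    exact h.abs_cross_le (hs _) (Or.inl (hμ _))
  have t3 : |β ⬝ᵥ (S * y)| ≤ (b ^ 3 + b ^ 2 * ((b + b ^ 2) / c + b * √a)) * (b ^ 3 / n) := by
    rw [hβ]
    have := h.swap.abs_cross_le (hs _).swap (Or.inr (hμ _))
    rwa [Matrix.transpose_transpose] at this
  have t4 : |∑ l, S l * α l * β l| ≤ b * (b ^ 4 / c / n) := by
    refine (abs_sum_weighted_le hb.le h.S_le).trans (mul_le_mul_of_nonneg_left ?_ hb.le)
    have := mul_le_of_sq_le (l2_nonneg β) hα2 hβ2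
    rwa [Real.mul_self_sqrt (by positivity)] at this
  rw [e]
  calc _ ≤ |∑ l, S l * y l * z l| + |α ⬝ᵥ (S * z)| + |β ⬝ᵥ (S * y)| + |∑ l, S l * α l * β l| := by
        refine (abs_add_le _ _).trans (add_le_add ((abs_sub _ _).trans (add_le_add
          ((abs_sub _ _).trans le_rfl) le_rfl)) le_rfl)
    _ ≤ _ := add_le_add (add_le_add (add_le_add t1 t2) t3) t4
    _ = _ := by ring

end LocalizedSystem

/-! ### The block system of a design -/

section Design

variable {p m K n : ℕ}

/-- The normalized penalized moment matrix `Λ_j / n`. -/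
def penMat (p m K : ℕ) {n : ℕ} (lam : Fin 2 → ℝ) (x : Fin n → ℝ × ℝ) (j : Fin 2) :
    Matrix (Fin (K + p)) (Fin (K + p)) ℝ := (1 / (n : ℝ)) • Lam p m K lam x j

lemma empMat_eq (x : Fin n → ℝ × ℝ) (g : ℝ × ℝ → ℝ) (j j' : Fin 2) :
    empMat p K x g j j' = (1 / (n : ℝ)) • ((designMatrix p K x j)ᵀ *
      Matrix.diagonal (fun l => g (x l)) * designMatrix p K x j') := by
  ext i k
  simp only [empMat, empMean, Matrix.of_apply, Matrix.smul_apply, smul_eq_mul]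
  congr 1
  rw [Matrix.mul_apply]
  refine Finset.sum_congr rfl fun l _ => ?_
  rw [Matrix.mul_diagonal]
  simp only [Matrix.transpose_apply, designMatrix, Matrix.of_apply]
  ring

lemma empMat_one_eq (x : Fin n → ℝ × ℝ) (j j' : Fin 2) :
    empMat p K x (fun _ => 1) j j' = (1 / (n : ℝ)) • ((designMatrix p K x j)ᵀ *
      designMatrix p K x j') := by
  rw [empMat_eq, Matrix.diagonal_one, Matrix.mul_one]

lemma penMat_eq (lam : Fin 2 → ℝ) (x : Fin n → ℝ × ℝ) (j : Fin 2) :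
    penMat p m K lam x j = empMat p K x (fun _ => 1) j j + (lam j / n) • penalty m (K + p) := by
  rw [penMat, Lam, empMat_one_eq, smul_add, smul_smul]
  congr 2; ring

lemma designMatrix_mulVec_one (hK : 0 < K) {x : Fin n → ℝ × ℝ} (hx : ∀ l, x l ∈ unitSquare)
    (j : Fin 2) : designMatrix p K x j *ᵥ 1 = 1 :=
  funext fun l => bvec_dotProduct_one hK (coord_mem (hx l) j)

lemma empForm_eq (x : Fin n → ℝ × ℝ) (u v : Fin (K + p) → ℝ) :
    jointForm (empMat p K x (fun _ => 1) 0 0) (empMat p K x (fun _ => 1) 1 1)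
      (empMat p K x (fun _ => 1) 0 1) u v
      = (1 / (n : ℝ)) * l2 (designMatrix p K x 0 *ᵥ u + designMatrix p K x 1 *ᵥ v) ^ 2 := by
  have key : ∀ j j' (w w' : Fin (K + p) → ℝ), w ⬝ᵥ (empMat p K x (fun _ => 1) j j' *ᵥ w')
      = (1 / (n : ℝ)) * ((designMatrix p K x j *ᵥ w) ⬝ᵥ (designMatrix p K x j' *ᵥ w')) := by
    intro j j' w w'
    rw [empMat_one_eq, Matrix.smul_mulVec, dotProduct_smul, ← Matrix.mulVec_mulVec,
      dotProduct_mulVec_comm, Matrix.transpose_transpose, smul_eq_mul]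
  rw [jointForm, key, key, key, l2_sq_eq_dotProduct]
  simp only [add_dotProduct, dotProduct_add]
  rw [dotProduct_comm (designMatrix p K x 1 *ᵥ v) (designMatrix p K x 0 *ᵥ u)]
  ring

lemma empForm_le_jointForm {lam : Fin 2 → ℝ} (hlam : ∀ j, 0 ≤ lam j) (x : Fin n → ℝ × ℝ)
    (u v : Fin (K + p) → ℝ) :
    (1 / (n : ℝ)) * l2 (designMatrix p K x 0 *ᵥ u + designMatrix p K x 1 *ᵥ v) ^ 2
      ≤ jointForm (penMat p m K lam x 0) (penMat p m K lam x 1)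
        (empMat p K x (fun _ => 1) 0 1) u v := by
  rw [← empForm_eq]
  simp only [jointForm, penMat_eq, Matrix.add_mulVec, Matrix.smul_mulVec, dotProduct_add,
    dotProduct_smul, smul_eq_mul]
  have h1 := mul_nonneg (div_nonneg (hlam 0) (Nat.cast_nonneg (α := ℝ) n))
    (penalty_nonneg (m := m) u)
  have h2 := mul_nonneg (div_nonneg (hlam 1) (Nat.cast_nonneg (α := ℝ) n))
    (penalty_nonneg (m := m) v)
  linarith

lemma penMat_isSymm (lam : Fin 2 → ℝ) (x : Fin n → ℝ × ℝ) (j : Fin 2) :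
    (penMat p m K lam x j).IsSymm := by
  rw [Matrix.IsSymm, penMat_eq, Matrix.transpose_add, Matrix.transpose_smul, empMat_transpose,
    penalty_isSymm]

lemma penMat_banded (hK : 0 < K) (lam : Fin 2 → ℝ) (x : Fin n → ℝ × ℝ) (j : Fin 2) :
    Banded (max p m) (penMat p m K lam x j) := by
  rw [penMat_eq]
  exact ((empMat_banded hK x j).mono (le_max_left _ _)).add
    ((penalty_banded.mono (le_max_right _ _)).smul _)

/-- Both design matrices send the vector of ones to itself, by the partition of unity, and the
penalty kills it; with j ≠ j' this puts (1, -1) into the kernel of the block system. -/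
lemma penMat_mulVec_one (hK : 0 < K) (hm : 1 ≤ m) (lam : Fin 2 → ℝ) {x : Fin n → ℝ × ℝ}
    (hx : ∀ l, x l ∈ unitSquare) (j j' : Fin 2) :
    penMat p m K lam x j *ᵥ 1 = empMat p K x (fun _ => 1) j j' *ᵥ 1 := by
  rw [penMat_eq, Matrix.add_mulVec, Matrix.smul_mulVec, penalty_mulVec_one hm, smul_zero, add_zero,
    empMat_one_eq, empMat_one_eq, Matrix.smul_mulVec, Matrix.smul_mulVec, ← Matrix.mulVec_mulVec,
    ← Matrix.mulVec_mulVec, designMatrix_mulVec_one hK hx, designMatrix_mulVec_one hK hx]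

/-- The empirical moments with weight `g` are close to the population moments, and the cross moments
are small near two given indices. -/
structure GoodMoments (p K : ℕ) (q g : ℝ × ℝ → ℝ) (ε M θ : ℝ) (i₁ i₂ : ℕ) {n : ℕ}
    (x : Fin n → ℝ × ℝ) : Prop where
  dev : ∀ j j', frob (empMat p K x g j j' - popMat p K q g j j') ≤ ε / K
  row : ∑ i, ∑ k, (wt (K + p) θ i₁ i ^ 2)⁻¹ * empMat p K x g 0 1 i k ^ 2 ≤ M / K ^ 3
  col : ∑ i, ∑ k, (wt (K + p) θ i₂ k ^ 2)⁻¹ * empMat p K x g 0 1 i k ^ 2 ≤ M / K ^ 3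
  both : ∑ i, ∑ k, (wt (K + p) θ i₁ i ^ 2)⁻¹ * (wt (K + p) θ i₂ k ^ 2)⁻¹ *
    empMat p K x g 0 1 i k ^ 2 ≤ M / K ^ 4

/-- Square roots of the weighted sums of squares are operator bounds between weighted spaces: K^{-3}
yields K^{-3/2} for one weight, and K^{-4} yields K^{-2} for two. -/
lemma GoodMoments.crossBound {q g : ℝ × ℝ → ℝ} {ε M θ : ℝ} {i₁ i₂ : ℕ} {x : Fin n → ℝ × ℝ}
    (h : GoodMoments p K q g ε M θ i₁ i₂ x) (hK : 0 < K) (hθ : 0 ≤ θ) (hM : 0 ≤ M) {b : ℝ}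
    (hb : √M ≤ b) :
    CrossBound (K : ℝ) b (wt (K + p) θ i₁) (wt (K + p) θ i₂) (empMat p K x g 0 1) := by
  have hK' : (0 : ℝ) < K := by exact_mod_cast hK
  have e3 : √(M / K ^ 3) ≤ b / (K * √K) := by
    rw [Real.sqrt_div hM, show (K : ℝ) ^ 3 = K ^ 2 * K by ring, Real.sqrt_mul (by positivity),
      Real.sqrt_sq hK'.le]
    gcongr
  have e4 : √(M / K ^ 4) ≤ b / K ^ 2 := by
    rw [Real.sqrt_div hM, show (K : ℝ) ^ 4 = (K ^ 2) ^ 2 by ring, Real.sqrt_sq (by positivity)]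
    gcongr
  refine ⟨fun v => ?_, fun v => ?_, fun u v => ?_⟩
  · exact (l2_transpose_mulVec_le_weighted _ _ (wt_pos hθ i₁) v h.row).trans
      (mul_le_mul_of_nonneg_right e3 (l2_nonneg _))
  · have hc := h.col
    rw [Finset.sum_comm] at hc
    have := l2_transpose_mulVec_le_weighted (empMat p K x g 0 1)ᵀ _ (wt_pos hθ i₂) v
      (b := M / K ^ 3) (by simpa using hc)
    rw [Matrix.transpose_transpose] at this
    exact this.trans (mul_le_mul_of_nonneg_right e3 (l2_nonneg _))
  · refine (abs_bilin_le_weighted _ _ _ (wt_pos hθ i₁) (wt_pos hθ i₂) u v h.both).trans ?_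
    have := l2_nonneg (wt (K + p) θ i₁ * u)
    have := l2_nonneg (wt (K + p) θ i₂ * v)
    gcongr

lemma abs_penMat_le {q : ℝ × ℝ → ℝ} {ε D : ℝ} {lam : Fin 2 → ℝ} {x : Fin n → ℝ × ℝ} {j : Fin 2}
    (hD : ∀ i k, |popMat p K q (fun _ => 1) j j i k| ≤ D / K)
    (hdev : frob (empMat p K x (fun _ => 1) j j - popMat p K q (fun _ => 1) j j) ≤ ε / K)
    (hlam0 : 0 ≤ lam j) (hlam : lam j / n ≤ 1 / K) (i k : Fin (K + p)) :
    |penMat p m K lam x j i k| ≤ (D + ε + (m + 1) * 4 ^ m) / K := by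
  have h1 := (abs_apply_le_frob _ i k).trans hdev
  have h2 := hD i k
  have h3 : |lam j / n * penalty m (K + p) i k| ≤ 1 / K * ((m + 1) * 4 ^ m) := by
    rw [abs_mul, abs_of_nonneg (by positivity)]
    exact mul_le_mul hlam (abs_penalty_le i k) (abs_nonneg _) (by positivity)
  have e : penMat p m K lam x j i k = popMat p K q (fun _ => 1) j j i k
      + (empMat p K x (fun _ => 1) j j - popMat p K q (fun _ => 1) j j) i k
      + lam j / n * penalty m (K + p) i k := by
    rw [penMat_eq]; simp
  rw [e]
  calc _ ≤ D / K + ε / K + 1 / K * ((m + 1) * 4 ^ m) :=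
        (abs_add_le _ _).trans (add_le_add ((abs_add_le _ _).trans (add_le_add h2 h1)) h3)
    _ = _ := by ring

/-- Each block changes by at most its Frobenius deviation; 2|u||v| ≤ |u|² + |v|² absorbs the cross
block and explains the factor 2. -/
lemma empForm_ge_popForm {q : ℝ × ℝ → ℝ} {ε : ℝ} {x : Fin n → ℝ × ℝ}
    (hdev : ∀ j j', frob (empMat p K x (fun _ => 1) j j' - popMat p K q (fun _ => 1) j j') ≤ ε / K)
    (u v : Fin (K + p) → ℝ) :
    jointForm (popMat p K q (fun _ => 1) 0 0) (popMat p K q (fun _ => 1) 1 1)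
        (popMat p K q (fun _ => 1) 0 1) u v - 2 * (ε / K) * (l2 u ^ 2 + l2 v ^ 2) ≤
      jointForm (empMat p K x (fun _ => 1) 0 0) (empMat p K x (fun _ => 1) 1 1)
        (empMat p K x (fun _ => 1) 0 1) u v := by
  have key : ∀ j j' (w w' : Fin (K + p) → ℝ), w ⬝ᵥ (popMat p K q (fun _ => 1) j j' *ᵥ w')
      - ε / K * (l2 w * l2 w') ≤ w ⬝ᵥ (empMat p K x (fun _ => 1) j j' *ᵥ w') := by
    intro j j' w w'
    have h1 := (neg_le_abs _).trans (abs_bilin_le_frob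
      (empMat p K x (fun _ => 1) j j' - popMat p K q (fun _ => 1) j j') w w')
    rw [Matrix.sub_mulVec, dotProduct_sub] at h1
    have h2 := mul_le_mul_of_nonneg_right (hdev j j') (mul_nonneg (l2_nonneg w) (l2_nonneg w'))
    linarith
  have k1 := key 0 0 u u
  have k2 := key 0 1 u v
  have k3 := key 1 1 v v
  simp only [jointForm]
  have hε : 0 ≤ ε / K := (frob_nonneg _).trans (hdev 0 0)
  have h4 := mul_nonneg hε (sq_nonneg (l2 u - l2 v))
  nlinarith

/-- Recentring by constants costs a bounded factor. -/
lemma recentre_sq_le {u₀ v₀ u v T : ℝ} (hT : 0 ≤ T) (hu0 : 0 ≤ u) (hv0 : 0 ≤ v)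
    (hu : u ≤ u₀ + T * v₀) (hv : v ≤ v₀ + T * v₀) :
    u ^ 2 + v ^ 2 ≤ 4 * (1 + T) ^ 2 * (u₀ ^ 2 + v₀ ^ 2) := by
  have h1 : u ^ 2 ≤ (u₀ + T * v₀) ^ 2 := by gcongr
  have h2 : v ^ 2 ≤ (v₀ + T * v₀) ^ 2 := by gcongr
  have h3 : (u₀ + T * v₀) ^ 2 ≤ 2 * u₀ ^ 2 + 2 * T ^ 2 * v₀ ^ 2 := by
    nlinarith [sq_nonneg (u₀ - T * v₀)]
  have h4 := sq_nonneg u₀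
  have h5 : 0 ≤ T * u₀ ^ 2 := by positivity
  have h6 : 0 ≤ T ^ 2 * u₀ ^ 2 := by positivity
  have h7 : 0 ≤ T * v₀ ^ 2 := by positivity
  have h8 : 0 ≤ T ^ 2 * v₀ ^ 2 := by positivity
  have h9 := sq_nonneg v₀
  nlinarith

lemma intervalIntegral_bvec_sub (hK : 0 < K) (u : Fin (K + p) → ℝ) (β : ℝ) :
    ∫ t in (0 : ℝ)..1, bvec p K t ⬝ᵥ (u - β • 1) = (∫ t in (0 : ℝ)..1, bvec p K t ⬝ᵥ u) - β := by
  have h1 : ∫ t in (0 : ℝ)..1, bvec p K t ⬝ᵥ (u - β • 1)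
      = ∫ t in (0 : ℝ)..1, (bvec p K t ⬝ᵥ u - β) := by
    rw [intervalIntegral.integral_of_le zero_le_one, intervalIntegral.integral_of_le zero_le_one,
      integral_Ioc_eq_integral_Ioo, integral_Ioc_eq_integral_Ioo]
    refine setIntegral_congr_fun measurableSet_Ioo fun t ht => ?_
    simp only [dotProduct_sub, dotProduct_smul, bvec_dotProduct_one hK ht, smul_eq_mul, mul_one]
  rw [h1, intervalIntegral.integral_sub (intervalIntegrable_of_measurable_bdd
    (measurable_bvec_dotProduct u) (fun t => abs_bvec_dotProduct_le_sum hK t u) _ _) (by simp)]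
  simp

/-- Good designs lead to well-conditioned block systems. -/
lemma exists_blockSystem {q : ℝ × ℝ → ℝ} [IsProbabilityMeasure (designLaw q)] (hq : BddPos q)
    (p : ℕ) {m : ℕ} (hm : 1 ≤ m) : ∃ ε₀ c a : ℝ, 0 < ε₀ ∧ 0 < c ∧ 0 < a ∧
      ∀ (K n : ℕ) (lam : Fin 2 → ℝ) (x : Fin n → ℝ × ℝ), 0 < K → 0 < n → (∀ j, 0 ≤ lam j) →
        (∀ j, lam j / n ≤ 1 / K) → (∀ l, x l ∈ unitSquare) →
        (∀ j j', frob (empMat p K x (fun _ => 1) j j' - popMat p K q (fun _ => 1) j j')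
          ≤ ε₀ / K) →
        BlockSystem (max p m) (K : ℝ) c a (penMat p m K lam x 0) (penMat p m K lam x 1)
          (empMat p K x (fun _ => 1) 0 1) := by
  obtain ⟨D, hD, hDb⟩ := abs_popMat_le hq BddPos.one p
  obtain ⟨c₀, hc₀, hco⟩ := exists_popMat_joint_coercive hq p
  set a : ℝ := D + 1 + (m + 1) * 4 ^ m + (p + 1) with ha
  set T : ℝ := (2 * (max p m : ℕ) + 1) * a * a with hT
  have ha0 : 0 < a := by positivity
  have hT0 : 0 ≤ T := by positivity
  -- A deviation of c₀/4 costs at most half of the population constant, and 4(1 + T)² is the price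
  -- of passing from Lebesgue centring to empirical centring.
  refine ⟨min 1 (c₀ / 4), c₀ / 2 / (4 * (1 + T) ^ 2), a, by positivity, by positivity, ha0,
    fun K n lam x hK hn hlam0 hlam hx hdev => ?_⟩
  have hK' : (0 : ℝ) < K := by exact_mod_cast hK
  have hn' : (0 : ℝ) < n := by exact_mod_cast hn
  have hK1 : (1 : ℝ) ≤ K := by exact_mod_cast hK
  set L := max p m with hL
  have hbdd : ∀ j i k, |penMat p m K lam x j i k| ≤ a / K := fun j i k => by
    refine (abs_penMat_le ((hDb K hK).1 j j) (hdev j j) (hlam0 j) (hlam j) i k).trans ?_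
    refine div_le_div_of_nonneg_right ?_ hK'.le
    have := min_le_left 1 (c₀ / 4)
    have : (0 : ℝ) ≤ p := by positivity
    linarith
  have hcard : ((K + p : ℕ) : ℝ) ≤ a * K := by
    have h1 : ((p : ℝ) + 1) * K ≤ a * K := by
      refine mul_le_mul_of_nonneg_right ?_ hK'.le
      rw [ha]; have : 0 ≤ D + 1 + ((m : ℝ) + 1) * 4 ^ m := by positivity
      linarith
    have h2 : (p : ℝ) * 1 ≤ p * K := by gcongr
    push_cast; linarith
  have hsq : √((K + p : ℕ) : ℝ) ≤ √a * √K := by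
    rw [← Real.sqrt_mul ha0.le]; exact Real.sqrt_le_sqrt hcard
  have hone : ∀ j, l2 (penMat p m K lam x j *ᵥ 1) * √((K + p : ℕ) : ℝ) ≤ T := by
    intro j
    have h1 := (penMat_banded hK lam x j).l2_mulVec_le (hbdd j) (by positivity) 1
    have h2 : l2 (1 : Fin (K + p) → ℝ) = √((K + p : ℕ) : ℝ) := by simp [l2]
    rw [h2] at h1
    calc _ ≤ ((2 * (L : ℕ) + 1) * (a / K) * √((K + p : ℕ) : ℝ)) * √((K + p : ℕ) : ℝ) := by gcongr
      _ = (2 * (L : ℕ) + 1) * (a / K) * ((K + p : ℕ) : ℝ) := by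
        rw [mul_assoc, Real.mul_self_sqrt (by positivity)]
      _ ≤ (2 * (L : ℕ) + 1) * (a / K) * (a * K) := by gcongr
      _ = T := by rw [hT]; field_simp
  have hcentred : ∀ u v : Fin (K + p) → ℝ,
      ((∫ t in (0 : ℝ)..1, bvec p K t ⬝ᵥ u) = 0 ∨ (∫ t in (0 : ℝ)..1, bvec p K t ⬝ᵥ v) = 0) →
      c₀ / 2 / K * (l2 u ^ 2 + l2 v ^ 2) ≤
        (1 / (n : ℝ)) * l2 (designMatrix p K x 0 *ᵥ u + designMatrix p K x 1 *ᵥ v) ^ 2 := by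
    intro u v huv
    rw [← empForm_eq]
    refine le_trans ?_ (empForm_ge_popForm hdev u v)
    have h1 := hco K hK u v huv
    have h2 : 2 * (min 1 (c₀ / 4) / K) * (l2 u ^ 2 + l2 v ^ 2)
        ≤ 2 * (c₀ / 4 / K) * (l2 u ^ 2 + l2 v ^ 2) := by
      gcongr; exact min_le_right _ _
    have h3 : 2 * (c₀ / 4 / K) * (l2 u ^ 2 + l2 v ^ 2) = c₀ / K * (l2 u ^ 2 + l2 v ^ 2)
      - c₀ / 2 / K * (l2 u ^ 2 + l2 v ^ 2) := by ring
    linarith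
  have hshift : ∀ (u v : Fin (K + p) → ℝ) (β : ℝ),
      designMatrix p K x 0 *ᵥ (u + β • 1) + designMatrix p K x 1 *ᵥ (v - β • 1)
        = designMatrix p K x 0 *ᵥ u + designMatrix p K x 1 *ᵥ v := by
    intro u v β
    rw [Matrix.mulVec_add, Matrix.mulVec_sub, Matrix.mulVec_smul, Matrix.mulVec_smul,
      designMatrix_mulVec_one hK hx, designMatrix_mulVec_one hK hx]
    abel
  have htot : ∀ j, (1 : Fin (K + p) → ℝ) ⬝ᵥ (penMat p m K lam x j *ᵥ 1) = 1 := by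
    intro j
    rw [penMat_mulVec_one hK hm lam hx j j, empMat_one_eq, Matrix.smul_mulVec, dotProduct_smul,
      ← Matrix.mulVec_mulVec, dotProduct_mulVec_comm, Matrix.transpose_transpose,
      designMatrix_mulVec_one hK hx]
    simp [dotProduct, hn'.ne']
  have hl1 : ∀ β : ℝ, l2 (β • (1 : Fin (K + p) → ℝ)) = |β| * √((K + p : ℕ) : ℝ) := fun β => by
    rw [l2_smul]; simp [l2]
  -- a component annihilated by the empirical mean is controlled by its recentred version
  have hrec : ∀ (j : Fin 2) (v : Fin (K + p) → ℝ) (β : ℝ),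
      (penMat p m K lam x j *ᵥ 1) ⬝ᵥ v = 0 → |β| * √((K + p : ℕ) : ℝ) ≤ T * l2 (v - β • 1) := by
    intro j v β h0
    have h1 : (penMat p m K lam x j *ᵥ 1) ⬝ᵥ (v - β • 1) = -β := by
      rw [dotProduct_sub, h0, dotProduct_smul, dotProduct_comm, htot, smul_eq_mul, mul_one,
        zero_sub]
    have h2 := abs_dotProduct_le (penMat p m K lam x j *ᵥ 1) (v - β • 1)
    rw [h1, abs_neg] at h2
    calc |β| * √((K + p : ℕ) : ℝ)
        ≤ (l2 (penMat p m K lam x j *ᵥ 1) * l2 (v - β • 1)) * √((K + p : ℕ) : ℝ) := by gcongr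
      _ = (l2 (penMat p m K lam x j *ᵥ 1) * √((K + p : ℕ) : ℝ)) * l2 (v - β • 1) := by ring
      _ ≤ T * l2 (v - β • 1) := mul_le_mul_of_nonneg_right (hone j) (l2_nonneg _)
  have hfin : ∀ y z F : ℝ, y ≤ 4 * (1 + T) ^ 2 * z → c₀ / 2 / K * z ≤ F →
      c₀ / 2 / (4 * (1 + T) ^ 2) / K * y ≤ F := by
    intro y z F hy hF
    refine le_trans ?_ hF
    calc c₀ / 2 / (4 * (1 + T) ^ 2) / K * y
        ≤ c₀ / 2 / (4 * (1 + T) ^ 2) / K * (4 * (1 + T) ^ 2 * z) := by gcongr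
      _ = _ := by field_simp
  refine
    { one_le := hK1
      c_pos := by positivity
      a_pos := ha0
      card_le := hcard
      symm₁ := penMat_isSymm _ _ _
      symm₂ := penMat_isSymm _ _ _
      band₁ := penMat_banded hK _ _ _
      band₂ := penMat_banded hK _ _ _
      bdd₁ := hbdd 0
      bdd₂ := hbdd 1
      one₁ := penMat_mulVec_one hK hm lam hx 0 1
      one₂ := by rw [empMat_transpose]; exact penMat_mulVec_one hK hm lam hx 1 0
      total := htot 0
      nonneg := fun u v => le_trans (by positivity) (empForm_le_jointForm hlam0 x u v)
      coercive := fun u v huv => ?_ }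
  refine le_trans ?_ (empForm_le_jointForm hlam0 x u v)
  rw [empMat_transpose, ← penMat_mulVec_one hK hm lam hx 0 1,
    ← penMat_mulVec_one hK hm lam hx 1 0] at huv
  -- Coercivity is known for Lebesgue-centred components, the hypothesis is empirical centring.
  -- Exchanging the Lebesgue mean β between the components leaves the fit unchanged, and `hrec`
  -- bounds β by the recentred vector.
  rcases huv with h0 | h0
  · set β := ∫ t in (0 : ℝ)..1, bvec p K t ⬝ᵥ u with hβ
    have h1 := hcentred (u - β • 1) (v + β • 1) (Or.inl (by
      rw [intervalIntegral_bvec_sub hK, ← hβ, sub_self]))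
    have h2 := hshift u v (-β)
    rw [neg_smul, ← sub_eq_add_neg, sub_neg_eq_add] at h2
    rw [h2] at h1
    have h3 := hrec 0 u β h0
    have h4 : l2 u ≤ l2 (u - β • 1) + T * l2 (u - β • 1) := by
      calc l2 u = l2 ((u - β • 1) + β • 1) := by rw [sub_add_cancel]
        _ ≤ _ := (l2_add_le _ _).trans (by rw [hl1]; linarith)
    have h5 : l2 v ≤ l2 (v + β • 1) + T * l2 (u - β • 1) := by
      calc l2 v = l2 ((v + β • 1) - β • 1) := by rw [add_sub_cancel_right]
        _ ≤ _ := (l2_sub_le _ _).trans (by rw [hl1]; linarith)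
    have h6 := recentre_sq_le hT0 (l2_nonneg v) (l2_nonneg u) h5 h4
    exact hfin _ (l2 (u - β • 1) ^ 2 + l2 (v + β • 1) ^ 2) _ (by linarith) h1
  · set β := ∫ t in (0 : ℝ)..1, bvec p K t ⬝ᵥ v with hβ
    have h1 := hcentred (u + β • 1) (v - β • 1) (Or.inr (by
      rw [intervalIntegral_bvec_sub hK, ← hβ, sub_self]))
    rw [hshift u v β] at h1
    have h3 := hrec 1 v β h0
    have h4 : l2 v ≤ l2 (v - β • 1) + T * l2 (v - β • 1) := by
      calc l2 v = l2 ((v - β • 1) + β • 1) := by rw [sub_add_cancel]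
        _ ≤ _ := (l2_add_le _ _).trans (by rw [hl1]; linarith)
    have h5 : l2 u ≤ l2 (u + β • 1) + T * l2 (v - β • 1) := by
      calc l2 u = l2 ((u + β • 1) - β • 1) := by rw [add_sub_cancel_right]
        _ ≤ _ := (l2_sub_le _ _).trans (by rw [hl1]; linarith)
    have h6 := recentre_sq_le hT0 (l2_nonneg u) (l2_nonneg v) h5 h4
    exact hfin _ _ _ h6 h1

end Design

/-! ### Localization of smoothing vectors -/

section Localization

variable {p m K n : ℕ}

/-- `ν` is the index of the knot cell of `t`. -/
def IsCell (K : ℕ) (t : ℝ) (ν : ℕ) : Prop := (ν : ℝ) < K * t ∧ K * t ≤ ν + 1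

lemma l2_wt_bvec_le (hK : 0 < K) {t : ℝ} (ht : t ∈ Ioo (0 : ℝ) 1) {ν : ℕ} (hν : IsCell K t ν)
    {θ : ℝ} (hθ : 0 ≤ θ) : l2 (wt (K + p) θ ν * bvec p K t) ≤ 1 + θ * p := by
  obtain ⟨h0, h1⟩ := hν
  refine abs_le_of_sq_le_sq' ?_ (by positivity) |>.2
  rw [l2_sq]
  have hb : ∀ k, ((wt (K + p) θ ν * bvec p K t) k) ^ 2 ≤ (1 + θ * p) ^ 2 * bvec p K t k := by
    intro k
    by_cases hk : bvec p K t k = 0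
    · simp [hk]
    · obtain ⟨h2, h3⟩ := bvec_support hK hk
      have h4 : ((k : ℕ) : ℝ) < ν + p + 1 := by linarith
      have h5 : (ν : ℝ) < k + 1 := by linarith
      have h6 : (k : ℕ) < ν + p + 1 := by exact_mod_cast h4
      have h7 : ν < (k : ℕ) + 1 := by exact_mod_cast h5
      have h8 : wt (K + p) θ ν k ≤ 1 + θ * p := by
        have h9 : ((k : ℕ) : ℝ) ≤ ν + p := by exact_mod_cast (by omega : (k : ℕ) ≤ ν + p)
        have h10 : (ν : ℝ) ≤ (k : ℕ) := by exact_mod_cast (by omega : ν ≤ (k : ℕ))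
        have : |((k : ℕ) : ℝ) - ν| ≤ p := by
          rw [abs_of_nonneg (by linarith)]; linarith
        exact add_le_add le_rfl (mul_le_mul_of_nonneg_left this hθ)
      have h11 : bvec p K t k ^ 2 ≤ bvec p K t k := by
        rw [sq]; exact mul_le_of_le_one_left (bvec_nonneg hK _ _) (bvec_le_one hK _ _)
      have h12 := (wt_pos hθ ν k).le
      rw [Pi.mul_apply, mul_pow]
      gcongr
  calc _ ≤ ∑ k, (1 + θ * p) ^ 2 * bvec p K t k := Finset.sum_le_sum fun k _ => hb k
    _ = _ := by rw [← Finset.mul_sum, sum_bvec hK ht, mul_one]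

/-- Entries and coercivity constant both scale like 1/κ, so one slope serves all dimensions. -/
lemma exists_weight_slope (L : ℕ) {a c : ℝ} (ha : 0 < a) (hc : 0 < c) :
    ∃ θ : ℝ, 0 < θ ∧ ∀ κ : ℝ, 0 < κ → (θ * L) ^ 2 * ((2 * L + 1) * (a / κ)) ≤ c / κ := by
  set B : ℝ := (L : ℝ) ^ 2 * ((2 * L + 1) * a) with hB
  have hB0 : 0 ≤ B := by positivity
  -- Adding 1 to B covers bandwidth zero.
  refine ⟨√(c / (B + 1)), Real.sqrt_pos.2 (by positivity), fun κ hκ => ?_⟩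
  rw [mul_pow, Real.sq_sqrt (by positivity)]
  have : c / (B + 1) * L ^ 2 * ((2 * L + 1) * (a / κ)) = c / κ * (B / (B + 1)) := by
    rw [hB]; field_simp
  rw [this]
  refine mul_le_of_le_one_right (by positivity) ?_
  rw [div_le_one (by positivity)]; linarith

lemma mulVec_nonsing_inv_mulVec {N : ℕ} {A : Matrix (Fin N) (Fin N) ℝ} (hA : IsUnit A.det)
    (v : Fin N → ℝ) : A *ᵥ (A⁻¹ *ᵥ v) = v := by
  rw [Matrix.mulVec_mulVec, Matrix.mul_nonsing_inv _ hA, Matrix.one_mulVec]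

lemma GoodMoments.mono {q g : ℝ × ℝ → ℝ} {ε ε' M θ : ℝ} {i₁ i₂ : ℕ} {x : Fin n → ℝ × ℝ}
    (h : GoodMoments p K q g ε M θ i₁ i₂ x) (hε : ε ≤ ε') : GoodMoments p K q g ε' M θ i₁ i₂ x :=
  ⟨fun j j' => (h.dev j j').trans (by gcongr), h.row, h.col, h.both⟩

/-- Good designs lead to localized systems. -/
lemma exists_localizedSystem {q s2 : ℝ × ℝ → ℝ} [IsProbabilityMeasure (designLaw q)]
    (hq : BddPos q) (hs : BddPos s2) (p : ℕ) {m : ℕ} (hm : 1 ≤ m) :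
    ∃ ε₀ c a θ : ℝ, 0 < ε₀ ∧ ε₀ ≤ 1 ∧ 0 < c ∧ 0 < a ∧ 0 < θ ∧ ∀ M : ℝ, 0 ≤ M → ∃ b : ℝ, 1 ≤ b ∧
      ∀ (K n : ℕ) (lam : Fin 2 → ℝ) (x : Fin n → ℝ × ℝ) (t : Fin 2 → ℝ) (ν : Fin 2 → ℕ),
        0 < K → 0 < n → (∀ j, 0 ≤ lam j) → (∀ j, lam j / n ≤ 1 / K) → (∀ l, x l ∈ unitSquare) →
        (∀ j, t j ∈ Ioo (0 : ℝ) 1) → (∀ j, IsCell K (t j) (ν j)) →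
        GoodMoments p K q (fun _ => 1) ε₀ M θ (ν 0) (ν 1) x →
        GoodMoments p K q s2 ε₀ M θ (ν 0) (ν 1) x →
        LocalizedSystem (max p m) (K : ℝ) c a b (penMat p m K lam x 0) (penMat p m K lam x 1)
          (empMat p K x (fun _ => 1) 0 1) (designMatrix p K x 0) (designMatrix p K x 1)
          (fun l => s2 (x l)) (wt (K + p) θ (ν 0)) (wt (K + p) θ (ν 1))
          ((penMat p m K lam x 0)⁻¹ *ᵥ bvec p K (t 0))
          ((penMat p m K lam x 1)⁻¹ *ᵥ bvec p K (t 1)) := by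
  obtain ⟨ε₀, c, a, hε₀, hc, ha, hsys⟩ := exists_blockSystem hq p hm
  obtain ⟨D, hD, hDb⟩ := abs_popMat_le hq hs p
  obtain ⟨Cs, hCs, hsb⟩ := hs.abs_le
  obtain ⟨θ, hθ, hslope⟩ := exists_weight_slope (max p m) ha hc
  obtain ⟨S, hS, hSb⟩ := exists_sum_wt_le hθ
  -- The slope θ has to be fixed before M, since the weights it defines enter the event whose
  -- probability M controls.
  refine ⟨min ε₀ 1, c, a, θ, by positivity, min_le_right _ _, hc, ha, hθ, fun M hM => ?_⟩
  set b : ℝ := 1 + Cs + √M + √S + 2 / c + 2 / c * (1 + θ * p)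
    + (1 + θ * p) * ((2 * p + 1) * (D + 1)) with hb
  have hM' := Real.sqrt_nonneg M
  have hS' := Real.sqrt_nonneg S
  have h2c : 0 < 2 / c := by positivity
  have h2cθ : 0 < 2 / c * (1 + θ * p) := by positivity
  have hmul : 0 < (1 + θ * p) * ((2 * p + 1) * (D + 1)) := by positivity
  refine ⟨b, by linarith, fun K n lam x t ν hK hn hlam0 hlam hx ht hν h₁ h₂ => ?_⟩
  have hK' : (0 : ℝ) < K := by exact_mod_cast hK
  have sys := hsys K n lam x hK hn hlam0 hlam hx (fun j j' =>
    (h₁.dev j j').trans (div_le_div_of_nonneg_right (min_le_left _ _) hK'.le))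
  have hsolve : ∀ (j : Fin 2) (i₀ : ℕ) (w : Fin (K + p) → ℝ),
      l2 (wt (K + p) θ i₀ * w) ≤ 2 / c * K * l2 (wt (K + p) θ i₀ * (penMat p m K lam x j *ᵥ w)) := by
    intro j i₀ w
    have hbdd : ∀ i k, |penMat p m K lam x j i k| ≤ a / K := by
      fin_cases j
      exacts [sys.bdd₁, sys.bdd₂]
    have hco : ∀ v, c / K * l2 v ^ 2 ≤ v ⬝ᵥ (penMat p m K lam x j *ᵥ v) := by
      fin_cases j
      exacts [sys.coercive₁, sys.coercive₂]
    have := (penMat_banded hK lam x j).l2_wt_le_of_coercive (penMat_isSymm lam x j) hbdd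
      (by positivity) (by positivity : 0 < c / (K : ℝ)) hco hθ.le (hslope K hK') i₀ w
    rwa [show 2 / (c / (K : ℝ)) = 2 / c * K by field_simp] at this
  have hloc : ∀ j, IsUnit (penMat p m K lam x j).det →
      l2 (wt (K + p) θ (ν j) * ((penMat p m K lam x j)⁻¹ *ᵥ bvec p K (t j))) ≤ b * K := by
    intro j hj
    refine (hsolve j (ν j) _).trans ?_
    rw [mulVec_nonsing_inv_mulVec hj]
    calc 2 / c * K * l2 (wt (K + p) θ (ν j) * bvec p K (t j)) ≤ 2 / c * K * (1 + θ * p) := by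
          gcongr; exact l2_wt_bvec_le hK (ht j) (hν j) hθ.le
      _ = 2 / c * (1 + θ * p) * K := by ring
      _ ≤ b * K := by gcongr; linarith
  have hmul' : ∀ (j : Fin 2) (i₀ : ℕ) (v : Fin (K + p) → ℝ), l2 (wt (K + p) θ i₀ *
      (((1 / (n : ℝ)) • ((designMatrix p K x j)ᵀ * Matrix.diagonal (fun l => s2 (x l)) *
        designMatrix p K x j)) *ᵥ v)) ≤ b / K * l2 (wt (K + p) θ i₀ * v) := by
    intro j i₀ v
    have hbdd : ∀ i k, |empMat p K x s2 j j i k| ≤ (D + 1) / K := by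
      intro i k
      have e : empMat p K x s2 j j i k = popMat p K q s2 j j i k
        + (empMat p K x s2 j j - popMat p K q s2 j j) i k := by simp
      rw [e, add_div]
      refine (abs_add_le _ _).trans (add_le_add ((hDb K hK).1 j j i k) ?_)
      exact (abs_apply_le_frob _ i k).trans ((h₂.dev j j).trans
        (div_le_div_of_nonneg_right (min_le_right _ _) hK'.le))
    rw [← empMat_eq]
    refine ((empMat_banded hK x j).l2_wt_mulVec_le hbdd (by positivity) hθ.le i₀ v).trans ?_
    refine mul_le_mul_of_nonneg_right ?_ (l2_nonneg _)
    calc _ = (1 + θ * p) * ((2 * p + 1) * (D + 1)) / K := by ring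
      _ ≤ b / K := by gcongr; linarith
  have hcross : √M ≤ b := by linarith
  have hsolve' : ∀ (j : Fin 2) (i₀ : ℕ) (w : Fin (K + p) → ℝ), l2 (wt (K + p) θ i₀ * w)
      ≤ b * K * l2 (wt (K + p) θ i₀ * (penMat p m K lam x j *ᵥ w)) := by
    intro j i₀ w
    refine (hsolve j i₀ w).trans ?_
    have := l2_nonneg (wt (K + p) θ i₀ * (penMat p m K lam x j *ᵥ w))
    gcongr; linarith
  have hsum : ∀ (i₀ : ℕ) (v : Fin (K + p) → ℝ), ∑ i, |v i| ≤ b * l2 (wt (K + p) θ i₀ * v) :=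
    fun i₀ v => (sum_abs_le_wt hθ.le (hSb _ i₀) v).trans
      (mul_le_mul_of_nonneg_right (by linarith) (l2_nonneg _))
  exact
    { sys := sys
      n_pos := hn
      one_le := by linarith
      fit := empForm_le_jointForm hlam0 x
      S_le := fun l => (hsb _ (hx l)).trans (by linarith)
      cross := h₁.crossBound hK hθ.le hM hcross
      crossS := by rw [← empMat_eq]; exact h₂.crossBound hK hθ.le hM hcross
      loc₁ := hloc 0 sys.isUnit₁
      loc₂ := hloc 1 sys.isUnit₂
      le₁ := l2_le_l2_wt hθ.le _
      le₂ := l2_le_l2_wt hθ.le _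
      sum₁ := hsum _
      sum₂ := hsum _
      solve₁ := hsolve' 0 _
      solve₂ := hsolve' 1 _
      mul₁ := hmul' 0 _
      mul₂ := hmul' 1 _ }

/-! ### Population smoothing vectors -/

/-- The population Gram matrices are well conditioned with localized inverses, and the leading
variance is at least of order `K / n`. -/
lemma exists_gram_bound {q s2 : ℝ × ℝ → ℝ} [IsProbabilityMeasure (designLaw q)] (hq : BddPos q)
    (hs : BddPos s2) (p : ℕ) : ∃ c C : ℝ, 0 < c ∧ 0 < C ∧ ∀ K : ℕ, 0 < K → ∀ j : Fin 2,
      IsUnit (gram p K q j).det ∧ ∀ t ∈ Ioo (0 : ℝ) 1,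
        l2 ((gram p K q j)⁻¹ *ᵥ bvec p K t) ≤ C * K ∧
        ∑ i, |((gram p K q j)⁻¹ *ᵥ bvec p K t) i| ≤ C * K ∧
        ∀ n : ℕ, leadVar p K n q s2 j t = (1 / (n : ℝ)) * (((gram p K q j)⁻¹ *ᵥ bvec p K t) ⬝ᵥ
            (popMat p K q s2 j j *ᵥ ((gram p K q j)⁻¹ *ᵥ bvec p K t))) ∧
          c * (K / n) ≤ leadVar p K n q s2 j t := by
  obtain ⟨c₁, hc₁, hco₁⟩ := exists_popMat_coercive hq BddPos.one p
  obtain ⟨c₂, hc₂, hco₂⟩ := exists_popMat_coercive hq hs p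
  obtain ⟨D, hD, hDb⟩ := abs_popMat_le hq BddPos.one p
  obtain ⟨θ, hθ, hslope⟩ := exists_weight_slope p hD hc₁
  obtain ⟨S, hS, hSb⟩ := exists_sum_wt_le hθ
  set C₀ : ℝ := 2 / c₁ * (1 + θ * p) with hC₀
  have hC₀0 : 0 < C₀ := by positivity
  refine ⟨c₂ / ((2 * p + 1) * D * (p + 1)) ^ 2, (1 + √S) * C₀, by positivity, by positivity,
    fun K hK j => ?_⟩
  have hK' : (0 : ℝ) < K := by exact_mod_cast hK
  have hG : gram p K q j = popMat p K q (fun _ => 1) j j := gram_eq_popMat hq hK j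
  have hbdd : ∀ i k, |gram p K q j i k| ≤ D / K := fun i k => by
    rw [hG]; exact (hDb K hK).1 j j i k
  have hco : ∀ v, c₁ / K * l2 v ^ 2 ≤ v ⬝ᵥ (gram p K q j *ᵥ v) := fun v => by
    rw [hG]; exact hco₁ K hK j v
  have hband : Banded p (gram p K q j) := by rw [hG]; exact popMat_banded hK j
  have hsymm : (gram p K q j).IsSymm := by rw [hG]; exact popMat_transpose j j
  have hu : IsUnit (gram p K q j).det :=
    BlockSystem.isUnit_det_of_coercive (by positivity : 0 < c₁ / (K : ℝ)) hco
  refine ⟨hu, fun t ht => ?_⟩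
  obtain ⟨ν, -, h0, h1⟩ := exists_cell hK ht
  set g := (gram p K q j)⁻¹ *ᵥ bvec p K t with hg
  have hGg : gram p K q j *ᵥ g = bvec p K t := mulVec_nonsing_inv_mulVec hu _
  have hW : l2 (wt (K + p) θ ν * g) ≤ C₀ * K := by
    have := hband.l2_wt_le_of_coercive hsymm hbdd (by positivity)
      (by positivity : 0 < c₁ / (K : ℝ)) hco hθ.le (hslope K hK') ν g
    rw [show 2 / (c₁ / (K : ℝ)) = 2 / c₁ * K by field_simp, hGg] at this
    refine this.trans ?_
    calc 2 / c₁ * K * l2 (wt (K + p) θ ν * bvec p K t) ≤ 2 / c₁ * K * (1 + θ * p) := by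
          gcongr; exact l2_wt_bvec_le hK ht ⟨h0, h1⟩ hθ.le
      _ = C₀ * K := by rw [hC₀]; ring
  have hS' := Real.sqrt_nonneg S
  have hCK : 0 < C₀ * K := by positivity
  have hlead : ∀ n : ℕ, leadVar p K n q s2 j t
      = (1 / (n : ℝ)) * (g ⬝ᵥ (popMat p K q s2 j j *ᵥ g)) := by
    intro n
    rw [leadVar, sigmaMat_eq_popMat hq hs hK, ← Matrix.mulVec_mulVec, ← Matrix.mulVec_mulVec, ← hg,
      dotProduct_mulVec_comm (gram p K q j)⁻¹, Matrix.transpose_nonsing_inv, hsymm.eq, ← hg]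
  refine ⟨?_, ?_, fun n => ⟨hlead n, ?_⟩⟩
  · refine (l2_le_l2_wt hθ.le ν g).trans (hW.trans ?_)
    have := mul_nonneg hS' hCK.le
    linarith
  · refine (sum_abs_le_wt hθ.le (hSb _ ν) g).trans
      ((mul_le_mul_of_nonneg_left hW hS').trans ?_)
    linarith
  · have h2 := hband.l2_mulVec_le hbdd (by positivity) g
    rw [hGg] at h2
    -- At most p + 1 entries of B(t) are nonzero and they sum to one, so B(t) stays away from zero.
    -- As G g = B(t) and G has norm O(1/K), g has norm at least of order K, which bounds the
    -- variance from below.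
    have h3 : 1 ≤ (p + 1) * l2 (bvec p K t) := by
      have e1 : ∑ i, |bvec p K t i| = 1 := by
        rw [← sum_bvec hK ht]
        exact Finset.sum_congr rfl fun i _ => abs_of_nonneg (bvec_nonneg hK _ _)
      have hcard : (Finset.univ.filter fun i : Fin (K + p) => bvec p K t i ≠ 0).card ≤ p + 1 := by
        have hc : (Finset.Icc ν (ν + p)).card = p + 1 := by simp; omega
        rw [← hc]
        refine Finset.card_le_card_of_injOn (fun k => (k : ℕ)) ?_ (fun _ _ _ _ h => Fin.ext h)
        intro k hk
        simp only [Finset.coe_filter, Set.mem_ofPred_eq, Finset.mem_univ, true_and] at hk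
        obtain ⟨h5, h6⟩ := bvec_support hK hk
        have h7 : ((k : ℕ) : ℝ) < ν + p + 1 := by linarith
        have h8 : (ν : ℝ) < k + 1 := by linarith
        have h9 : (k : ℕ) < ν + p + 1 := by exact_mod_cast h7
        have h10 : ν < (k : ℕ) + 1 := by exact_mod_cast h8
        simp only [Finset.coe_Icc, Set.mem_Icc]; omega
      calc (1 : ℝ) = ∑ i ∈ Finset.univ.filter fun i : Fin (K + p) => |bvec p K t i| ≠ 0,
            |bvec p K t i| := by rw [Finset.sum_filter_ne_zero, e1]
        _ ≤ ∑ i ∈ Finset.univ.filter fun i : Fin (K + p) => |bvec p K t i| ≠ 0,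
            l2 (bvec p K t) := Finset.sum_le_sum fun i _ => abs_apply_le_l2 _ i
        _ ≤ _ := by
          rw [Finset.sum_const, nsmul_eq_mul]
          refine mul_le_mul_of_nonneg_right ?_ (l2_nonneg _)
          simp only [ne_eq, abs_eq_zero]
          exact_mod_cast hcard
    set T : ℝ := (2 * p + 1) * D * (p + 1) with hT
    have h4 : K ≤ T * l2 g := by
      have h5 : (p + 1) * l2 (bvec p K t) ≤ (p + 1) * ((2 * p + 1) * (D / K) * l2 g) := by gcongr
      have h6 : 1 ≤ T * l2 g / K := by
        refine h3.trans (h5.trans (le_of_eq ?_))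
        rw [hT]; ring
      rwa [le_div_iff₀ hK', one_mul] at h6
    rw [hlead]
    have hT0 : 0 < T := by positivity
    have h5 : c₂ / T ^ 2 * K ≤ g ⬝ᵥ (popMat p K q s2 j j *ᵥ g) := by
      refine le_trans ?_ (hco₂ K hK j g)
      have h6 : (K : ℝ) ^ 2 ≤ (T * l2 g) ^ 2 := by gcongr
      calc c₂ / T ^ 2 * K = c₂ / K * ((K : ℝ) ^ 2 / T ^ 2) := by field_simp
        _ ≤ c₂ / K * ((T * l2 g) ^ 2 / T ^ 2) := by gcongr
        _ = _ := by field_simp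
    calc c₂ / T ^ 2 * (K / n) = 1 / (n : ℝ) * (c₂ / T ^ 2 * K) := by ring
      _ ≤ _ := by gcongr

end Localization

/-! ### The limit of backfitting -/

section Backfitting

variable {p m K n L : ℕ} {c a : ℝ} {lam : Fin 2 → ℝ} {x : Fin n → ℝ × ℝ}

/-- The block system of a design. -/
abbrev DesignSystem (L p m K : ℕ) (c a : ℝ) (lam : Fin 2 → ℝ) {n : ℕ} (x : Fin n → ℝ × ℝ) : Prop :=
  BlockSystem L (K : ℝ) c a (penMat p m K lam x 0) (penMat p m K lam x 1)
    (empMat p K x (fun _ => 1) 0 1)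

/-- The normalized right-hand side `X_j' y / n`. -/
def designRhs (p K : ℕ) {n : ℕ} (x : Fin n → ℝ × ℝ) (j : Fin 2) (y : Fin n → ℝ) :
    Fin (K + p) → ℝ := (1 / (n : ℝ)) • ((designMatrix p K x j)ᵀ *ᵥ y)

lemma designRhs_add (j : Fin 2) (y z : Fin n → ℝ) :
    designRhs p K x j (y + z) = designRhs p K x j y + designRhs p K x j z := by
  simp only [designRhs, Matrix.mulVec_add, smul_add]

lemma designRhs_sub (j : Fin 2) (y z : Fin n → ℝ) :
    designRhs p K x j (y - z) = designRhs p K x j y - designRhs p K x j z := by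
  simp only [designRhs, Matrix.mulVec_sub, smul_sub]

lemma designRhs_smul (j : Fin 2) (r : ℝ) (y : Fin n → ℝ) :
    designRhs p K x j (r • y) = r • designRhs p K x j y := by
  simp only [designRhs, Matrix.mulVec_smul, smul_comm r]

lemma designRhs_designMatrix (j j' : Fin 2) (u : Fin (K + p) → ℝ) :
    designRhs p K x j (designMatrix p K x j' *ᵥ u) = empMat p K x (fun _ => 1) j j' *ᵥ u := by
  rw [designRhs, empMat_one_eq, Matrix.smul_mulVec, Matrix.mulVec_mulVec]

lemma dotProduct_designRhs (j : Fin 2) (w : Fin (K + p) → ℝ) (y : Fin n → ℝ) :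
    w ⬝ᵥ designRhs p K x j y = ((1 / (n : ℝ)) • (designMatrix p K x j *ᵥ w)) ⬝ᵥ y := by
  rw [designRhs, dotProduct_smul, dotProduct_mulVec_comm, Matrix.transpose_transpose,
    smul_dotProduct]

lemma one_dotProduct_designRhs (hK : 0 < K) (hx : ∀ l, x l ∈ unitSquare) (j : Fin 2)
    (y : Fin n → ℝ) : 1 ⬝ᵥ designRhs p K x j y = (1 / (n : ℝ)) * ∑ l, y l := by
  rw [dotProduct_designRhs, designMatrix_mulVec_one hK hx, smul_dotProduct, smul_eq_mul]
  simp [dotProduct]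

lemma isUnit_det_Lam {j : Fin 2} (h : IsUnit (penMat p m K lam x j).det) :
    IsUnit (Lam p m K lam x j).det := by
  rw [penMat, Matrix.det_smul] at h
  exact (IsUnit.mul_iff.1 h).2

lemma penMat_mulVec_fitCoef {j : Fin 2} (h : IsUnit (penMat p m K lam x j).det) (r : Fin n → ℝ) :
    penMat p m K lam x j *ᵥ fitCoef p m K lam x j r = designRhs p K x j r := by
  rw [penMat, fitCoef, Matrix.smul_mulVec, mulVec_nonsing_inv_mulVec (isUnit_det_Lam h), designRhs]

/-- The functional conserved by the iteration is the empirical mean of the second fitted component,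
the quantity that the condition on the initial value controls. -/
lemma cross_one_dotProduct (hK : 0 < K) (hx : ∀ l, x l ∈ unitSquare) (v : Fin (K + p) → ℝ) :
    ((empMat p K x (fun _ => 1) 0 1)ᵀ *ᵥ 1) ⬝ᵥ v
      = (1 / (n : ℝ)) * ∑ l, bvec p K (x l).2 ⬝ᵥ v := by
  rw [← dotProduct_mulVec_comm, ← designRhs_designMatrix, one_dotProduct_designRhs hK hx]
  rfl

/-- Backfitting converges to a solution of the block equations. -/
lemma exists_backfit_limit (h : DesignSystem L p m K c a lam x) (hK : 0 < K)
    (hx : ∀ l, x l ∈ unitSquare) (y : Fin n → ℝ) (b0 : Fin (K + p) → ℝ) :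
    ∃ b, Tendsto (backfit p m K lam x y b0) atTop (𝓝 b) ∧
      IsSol (penMat p m K lam x 0) (penMat p m K lam x 1) (empMat p K x (fun _ => 1) 0 1)
        (designRhs p K x 0 y) (designRhs p K x 1 y) b.1 b.2 ∧
      ((empMat p K x (fun _ => 1) 0 1)ᵀ *ᵥ 1) ⬝ᵥ b.2
        = ((empMat p K x (fun _ => 1) 0 1)ᵀ *ᵥ 1) ⬝ᵥ b0 := by
  obtain ⟨u', v', hu, hv, hsol, hμ⟩ := h.exists_tendsto (r₁ := designRhs p K x 0 y)
    (r₂ := designRhs p K x 1 y)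
    (by rw [one_dotProduct_designRhs hK hx, one_dotProduct_designRhs hK hx])
    (u := fun l => (backfit p m K lam x y b0 l).1) (v := fun l => (backfit p m K lam x y b0 l).2)
    (fun l => by
      simp only [backfit]
      rw [penMat_mulVec_fitCoef h.isUnit₁, designRhs_sub, designRhs_designMatrix, sub_add_cancel])
    (fun l => by
      simp only [backfit]
      rw [penMat_mulVec_fitCoef h.isUnit₂, designRhs_sub, designRhs_designMatrix, empMat_transpose,
        add_sub_cancel])
  exact ⟨(u', v'), hu.prodMk_nhds hv, hsol, hμ⟩

lemma DesignSystem.wellPosed (h : DesignSystem L p m K c a lam x) (hK : 0 < K)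
    (hx : ∀ l, x l ∈ unitSquare) : WellPosed p m K lam x := by
  refine ⟨fun j => isUnit_det_Lam ?_, fun y b0 => ?_⟩
  · fin_cases j
    exacts [h.isUnit₁, h.isUnit₂]
  · obtain ⟨b, hb, -⟩ := exists_backfit_limit h hK hx y b0
    exact ⟨b, hb⟩

lemma isSol_backfitLimit (h : DesignSystem L p m K c a lam x) (hK : 0 < K)
    (hx : ∀ l, x l ∈ unitSquare) (y : Fin n → ℝ) (b0 : Fin (K + p) → ℝ) :
    IsSol (penMat p m K lam x 0) (penMat p m K lam x 1) (empMat p K x (fun _ => 1) 0 1)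
        (designRhs p K x 0 y) (designRhs p K x 1 y) (backfitLimit p m K lam x y b0).1
        (backfitLimit p m K lam x y b0).2 ∧
      ((empMat p K x (fun _ => 1) 0 1)ᵀ *ᵥ 1) ⬝ᵥ (backfitLimit p m K lam x y b0).2
        = ((empMat p K x (fun _ => 1) 0 1)ᵀ *ᵥ 1) ⬝ᵥ b0 := by
  obtain ⟨b, hb, h1, h2⟩ := exists_backfit_limit h hK hx y b0
  rw [backfitLimit, hb.limUnder_eq]
  exact ⟨h1, h2⟩

lemma IsSol.add {N : ℕ} {A₁ A₂ H : Matrix (Fin N) (Fin N) ℝ} {r₁ r₂ u v r₁' r₂' u' v' : Fin N → ℝ}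
    (h : IsSol A₁ A₂ H r₁ r₂ u v) (h' : IsSol A₁ A₂ H r₁' r₂' u' v') :
    IsSol A₁ A₂ H (r₁ + r₁') (r₂ + r₂') (u + u') (v + v') := by
  refine ⟨?_, ?_⟩
  · rw [← h.1, ← h'.1, Matrix.mulVec_add, Matrix.mulVec_add]; abel
  · rw [← h.2, ← h'.2, Matrix.mulVec_add, Matrix.mulVec_add]; abel

lemma IsSol.smul {N : ℕ} {A₁ A₂ H : Matrix (Fin N) (Fin N) ℝ} {r₁ r₂ u v : Fin N → ℝ}
    (h : IsSol A₁ A₂ H r₁ r₂ u v) (t : ℝ) :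
    IsSol A₁ A₂ H (t • r₁) (t • r₂) (t • u) (t • v) := by
  refine ⟨?_, ?_⟩
  · rw [← h.1, Matrix.mulVec_smul, Matrix.mulVec_smul, smul_add]
  · rw [← h.2, Matrix.mulVec_smul, Matrix.mulVec_smul, smul_add]

/-- For A₁w = B(t) this splits the estimator at t into the univariate penalized fit and a smoothed
response of the other component. -/
lemma IsSol.dotProduct_eq {N : ℕ} {A₁ A₂ H : Matrix (Fin N) (Fin N) ℝ}
    {r₁ r₂ u v : Fin N → ℝ} (h : IsSol A₁ A₂ H r₁ r₂ u v) (hA : A₁.IsSymm) (w : Fin N → ℝ) :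
    (A₁ *ᵥ w) ⬝ᵥ u = w ⬝ᵥ r₁ - (Hᵀ *ᵥ w) ⬝ᵥ v := by
  rw [← h.1, dotProduct_add, dotProduct_mulVec_comm A₁, hA.eq, dotProduct_mulVec_comm H]
  ring

/-- The response of backfitting to noise is linear. -/
lemma exists_noise_response (h : DesignSystem L p m K c a lam x) (hK : 0 < K)
    (hx : ∀ l, x l ∈ unitSquare) : ∃ u v : (Fin n → ℝ) →ₗ[ℝ] (Fin (K + p) → ℝ),
      (∀ e, IsSol (penMat p m K lam x 0) (penMat p m K lam x 1) (empMat p K x (fun _ => 1) 0 1)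
        (designRhs p K x 0 e) (designRhs p K x 1 e) (u e) (v e)) ∧
      (∀ e, ((empMat p K x (fun _ => 1) 0 1)ᵀ *ᵥ 1) ⬝ᵥ v e = 0) ∧
      ∀ y e b0, (backfitLimit p m K lam x (y + e) b0).1
          = (backfitLimit p m K lam x y b0).1 + u e ∧
        (backfitLimit p m K lam x (y + e) b0).2 = (backfitLimit p m K lam x y b0).2 + v e := by
  -- Noise is propagated from the initial value 0, so its response is centred; linearity follows
  -- from uniqueness and not from the iterates.
  have hs := fun e => isSol_backfitLimit h hK hx e 0
  simp only [dotProduct_zero] at hs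
  have hadd : ∀ e e', (backfitLimit p m K lam x (e + e') 0).1
      = (backfitLimit p m K lam x e 0).1 + (backfitLimit p m K lam x e' 0).1 ∧
      (backfitLimit p m K lam x (e + e') 0).2
      = (backfitLimit p m K lam x e 0).2 + (backfitLimit p m K lam x e' 0).2 := fun e e' => by
    refine h.eq_of_isSol (hs (e + e')).1 ?_ (by
      rw [dotProduct_add, (hs _).2, (hs _).2, (hs _).2, add_zero])
    rw [designRhs_add, designRhs_add]
    exact (hs e).1.add (hs e').1
  have hsmul : ∀ (t : ℝ) (e), (backfitLimit p m K lam x (t • e) 0).1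
      = t • (backfitLimit p m K lam x e 0).1 ∧
      (backfitLimit p m K lam x (t • e) 0).2 = t • (backfitLimit p m K lam x e 0).2 := fun t e => by
    refine h.eq_of_isSol (hs (t • e)).1 ?_ (by
      rw [dotProduct_smul, (hs _).2, (hs _).2, smul_zero])
    rw [designRhs_smul, designRhs_smul]
    exact (hs e).1.smul t
  refine ⟨⟨⟨fun e => (backfitLimit p m K lam x e 0).1, fun e e' => (hadd e e').1⟩,
      fun t e => (hsmul t e).1⟩,
    ⟨⟨fun e => (backfitLimit p m K lam x e 0).2, fun e e' => (hadd e e').2⟩,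
      fun t e => (hsmul t e).2⟩, fun e => (hs e).1, fun e => (hs e).2, fun y e b0 => ?_⟩
  have h1 := isSol_backfitLimit h hK hx y b0
  have h2 := isSol_backfitLimit h hK hx (y + e) b0
  refine h.eq_of_isSol h2.1 ?_ (by
    change _ = _ ⬝ᵥ (_ + (backfitLimit p m K lam x e 0).2)
    rw [dotProduct_add, h1.2, h2.2, (hs e).2, add_zero])
  rw [designRhs_add, designRhs_add]
  exact h1.1.add (hs e).1

lemma exists_dotProduct_eq {n N : ℕ} (v : (Fin n → ℝ) →ₗ[ℝ] (Fin N → ℝ)) (w : Fin N → ℝ) :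
    ∃ α : Fin n → ℝ, ∀ e, α ⬝ᵥ e = w ⬝ᵥ v e := by
  refine ⟨fun l => w ⬝ᵥ v (Pi.single l 1), fun e => ?_⟩
  rw [LinearMap.pi_apply_eq_sum_univ v e, dotProduct_sum]
  simp only [dotProduct_smul, smul_eq_mul]
  refine Finset.sum_congr rfl fun l _ => ?_
  have h : (Pi.single l 1 : Fin n → ℝ) = fun i => if l = i then 1 else 0 := by
    ext i; simp [Pi.single_apply, eq_comm]
  simp only [h, mul_comm]

/-! ### The bias -/

/-- B-splines are nonnegative, so |X'y| ≤ δ X'1 entrywise. As X'1/n = A 1 and A is banded with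
entries O(1/K), a uniform bound holds with no further probabilistic input. -/
lemma abs_designRhs_le (hK : 0 < K) (hm : 1 ≤ m) (hx : ∀ l, x l ∈ unitSquare) (hn : 0 < n)
    {j : Fin 2} (hA : ∀ i k, |penMat p m K lam x j i k| ≤ a / K) {y : Fin n → ℝ} {δ : ℝ}
    (hy : ∀ l, |y l| ≤ δ) (i : Fin (K + p)) :
    |designRhs p K x j y i| ≤ (2 * (max p m : ℕ) + 1) * a * δ / K := by
  have hδ : 0 ≤ δ := (abs_nonneg _).trans (hy ⟨0, hn⟩)
  have h1 : designRhs p K x j 1 = penMat p m K lam x j *ᵥ 1 := by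
    rw [penMat_mulVec_one hK hm lam hx j j, ← designRhs_designMatrix, designMatrix_mulVec_one hK hx]
  have h2 := (penMat_banded hK lam x j).abs_mulVec_le hA (v := 1) zero_le_one (by simp) i
  rw [← h1] at h2
  have h3 : |designRhs p K x j y i| ≤ δ * designRhs p K x j 1 i := by
    simp only [designRhs, Pi.smul_apply, smul_eq_mul, Matrix.mulVec, dotProduct,
      Matrix.transpose_apply, Pi.one_apply, mul_one]
    rw [abs_mul, abs_of_nonneg (by positivity : 0 ≤ 1 / (n : ℝ)), mul_left_comm]
    refine mul_le_mul_of_nonneg_left ?_ (by positivity)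
    rw [Finset.mul_sum]
    refine (Finset.abs_sum_le_sum_abs _ _).trans (Finset.sum_le_sum fun l _ => ?_)
    have h4 : 0 ≤ designMatrix p K x j l i := bvec_nonneg hK _ _
    rw [abs_mul, abs_of_nonneg h4, mul_comm]
    exact mul_le_mul_of_nonneg_right (hy l) h4
  calc _ ≤ δ * designRhs p K x j 1 i := h3
    _ ≤ δ * ((2 * (max p m : ℕ) + 1) * (a / K) * 1) :=
      mul_le_mul_of_nonneg_left ((le_abs_self _).trans h2) hδ
    _ = _ := by ring

/-- The limit of backfitting for noiseless data, minus the coefficients of spline approximations,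
solves the block equations with small right-hand sides. -/
lemma exists_isSol_residual (h : DesignSystem (max p m) p m K c a lam x) (hK : 0 < K) (hn : 0 < n)
    (hm : 1 ≤ m) (hlam0 : ∀ j, 0 ≤ lam j) (hlam : ∀ j, lam j / n ≤ 1 / K)
    (hx : ∀ l, x l ∈ unitSquare) {f : Fin 2 → ℝ → ℝ} {C : NNReal}
    (hf : ∀ j, LipschitzOnWith C (f j) (Icc 0 1)) {M : ℝ}
    (hmean : |(1 / (n : ℝ)) * ∑ l, f 1 (x l).2| ≤ M / K) {b0 : Fin (K + p) → ℝ}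
    (hb0 : |(1 / (n : ℝ)) * ∑ l, bvec p K (x l).2 ⬝ᵥ b0| ≤ M / K) :
    ∃ r₁ r₂ : Fin (K + p) → ℝ,
      IsSol (penMat p m K lam x 0) (penMat p m K lam x 1) (empMat p K x (fun _ => 1) 0 1) r₁ r₂
        ((backfitLimit p m K lam x (response f x 0) b0).1 - knotCoef p K (f 0))
        ((backfitLimit p m K lam x (response f x 0) b0).2 - knotCoef p K (f 1)) ∧
      (∀ i, |r₁ i| ≤ ((2 * (max p m : ℕ) + 1) * a * (2 * C * (p + 1))
        + (2 * m + 1) * ((m + 1) * 4 ^ m) * (C * m)) / (K : ℝ) ^ 2) ∧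
      (∀ i, |r₂ i| ≤ ((2 * (max p m : ℕ) + 1) * a * (2 * C * (p + 1))
        + (2 * m + 1) * ((m + 1) * 4 ^ m) * (C * m)) / (K : ℝ) ^ 2) ∧
      |((empMat p K x (fun _ => 1) 0 1)ᵀ *ᵥ 1) ⬝ᵥ
        ((backfitLimit p m K lam x (response f x 0) b0).2 - knotCoef p K (f 1))|
          ≤ (2 * M + C * (p + 1)) / K := by
  have hK' : (0 : ℝ) < K := by exact_mod_cast hK
  have hn' : (0 : ℝ) < n := by exact_mod_cast hn
  obtain ⟨hs, hμ⟩ := isSol_backfitLimit h hK hx (response f x 0) b0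
  set y := response f x 0 with hy
  -- What remains of the noiseless data after subtracting the splines with knot values is O(1/K) at
  -- every observation.
  set z : Fin n → ℝ := y - designMatrix p K x 0 *ᵥ knotCoef p K (f 0)
    - designMatrix p K x 1 *ᵥ knotCoef p K (f 1) with hz
  have hap : ∀ j l, |f j (coord j (x l)) - (designMatrix p K x j *ᵥ knotCoef p K (f j)) l|
      ≤ C * (p + 1) / K := fun j l => abs_sub_knotCoef_le hK (hf j) (coord_mem (hx l) j)
  have hzb : ∀ l, |z l| ≤ 2 * C * (p + 1) / K := by
    intro l
    have e : z l = (f 0 (coord 0 (x l)) - (designMatrix p K x 0 *ᵥ knotCoef p K (f 0)) l)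
        + (f 1 (coord 1 (x l)) - (designMatrix p K x 1 *ᵥ knotCoef p K (f 1)) l) := by
      simp only [hz, hy, response, Pi.sub_apply, Pi.zero_apply, coord, if_true, one_ne_zero,
        if_false]
      ring
    rw [e]
    refine (abs_add_le _ _).trans ((add_le_add (hap 0 l) (hap 1 l)).trans (le_of_eq ?_))
    ring
  have hpen : ∀ j i, |((lam j / n) • (penalty m (K + p) *ᵥ knotCoef p K (f j))) i|
      ≤ (2 * m + 1) * ((m + 1) * 4 ^ m) * (C * m) / (K : ℝ) ^ 2 := by
    intro j i
    have h1 := abs_penalty_mulVec_le (N := K + p) hm (c := knotCoef p K (f j)) (δ := C / K)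
      (fun i k => by
        have := knotCoef_sub_le (p := p) (K := K) (hf j) i k
        rwa [mul_div_right_comm] at this) (by positivity) i
    rw [Pi.smul_apply, smul_eq_mul, abs_mul,
      abs_of_nonneg (div_nonneg (hlam0 j) hn'.le)]
    refine (mul_le_mul (hlam j) h1 (abs_nonneg _) (by positivity)).trans (le_of_eq ?_)
    field_simp
  have hrhs : ∀ j, (∀ i k, |penMat p m K lam x j i k| ≤ a / K) → ∀ i,
      |(designRhs p K x j z - (lam j / n) • (penalty m (K + p) *ᵥ knotCoef p K (f j))) i|
        ≤ ((2 * (max p m : ℕ) + 1) * a * (2 * C * (p + 1))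
        + (2 * m + 1) * ((m + 1) * 4 ^ m) * (C * m)) / (K : ℝ) ^ 2 := by
    intro j hj i
    rw [Pi.sub_apply]
    refine (abs_sub _ _).trans ((add_le_add (abs_designRhs_le hK hm hx hn hj hzb i)
      (hpen j i)).trans (le_of_eq ?_))
    field_simp
  refine ⟨_, _, ⟨?_, ?_⟩, hrhs 0 h.bdd₁, hrhs 1 h.bdd₂, ?_⟩
  · rw [Matrix.mulVec_sub, Matrix.mulVec_sub, hz, designRhs_sub, designRhs_sub, ← hs.1,
      designRhs_designMatrix, designRhs_designMatrix, penMat_eq (j := 0), Matrix.add_mulVec,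
      Matrix.add_mulVec, Matrix.smul_mulVec, Matrix.smul_mulVec]
    abel
  · rw [Matrix.mulVec_sub, Matrix.mulVec_sub, hz, designRhs_sub, designRhs_sub, ← hs.2,
      designRhs_designMatrix, designRhs_designMatrix, empMat_transpose, penMat_eq (j := 1),
      Matrix.add_mulVec, Matrix.add_mulVec, Matrix.smul_mulVec, Matrix.smul_mulVec]
    abel
  -- The mean of the limit is that of the initial value; the mean of the knot spline is within
  -- O(1/K) of the empirical mean of f_2, which is small by assumption.
  · rw [dotProduct_sub, hμ, cross_one_dotProduct hK hx, cross_one_dotProduct hK hx]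
    have h1 : |(1 / (n : ℝ)) * ∑ l, f 1 (x l).2
        - (1 / (n : ℝ)) * ∑ l, bvec p K (x l).2 ⬝ᵥ knotCoef p K (f 1)| ≤ C * (p + 1) / K := by
      rw [← mul_sub, ← Finset.sum_sub_distrib, abs_mul, abs_of_pos (by positivity : 0 < 1 / (n : ℝ))]
      calc _ ≤ 1 / (n : ℝ) * ∑ _l : Fin n, (C : ℝ) * (p + 1) / K := by
            gcongr
            exact (Finset.abs_sum_le_sum_abs _ _).trans
              (Finset.sum_le_sum fun l _ => hap 1 l)
        _ = _ := by
          rw [Finset.sum_const, Finset.card_univ, Fintype.card_fin, nsmul_eq_mul]; field_simp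
    have h2 : (2 * M + C * (p + 1)) / (K : ℝ) = M / K + (M / K + C * (p + 1) / K) := by ring
    rw [h2]
    refine (abs_sub _ _).trans (add_le_add hb0 ?_)
    rw [abs_sub_comm] at h1
    calc _ = |((1 / (n : ℝ)) * ∑ l, bvec p K (x l).2 ⬝ᵥ knotCoef p K (f 1)
          - (1 / (n : ℝ)) * ∑ l, f 1 (x l).2) + (1 / (n : ℝ)) * ∑ l, f 1 (x l).2| := by
          rw [sub_add_cancel]
      _ ≤ _ := (abs_add_le _ _).trans (by linarith)

end Backfitting

/-! ### Expansion of the estimators on good designs -/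

/-- From A(w - g) = (G - A)g and coercivity, |w - g| ≤ κδ/c. The difference of the quadratic forms
then telescopes. -/
lemma abs_quadratic_sub_le {N : ℕ} {A G S T : Matrix (Fin N) (Fin N) ℝ} {w g : Fin N → ℝ}
    {κ c b D ε δ : ℝ} (hκ : 0 < κ) (hc : 0 < c) (hb : 0 ≤ b) (hD : 0 ≤ D)
    (hA : ∀ v, c / κ * l2 v ^ 2 ≤ v ⬝ᵥ (A *ᵥ v)) (hAw : A *ᵥ w = G *ᵥ g)
    (hd : l2 ((G - A) *ᵥ g) ≤ δ) (hS : ∀ v, l2 (S *ᵥ v) ≤ D / κ * l2 v)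
    (hST : frob (S - T) ≤ ε / κ) (hw : l2 w ≤ b * κ) (hg : l2 g ≤ b * κ) :
    |w ⬝ᵥ (S *ᵥ w) - g ⬝ᵥ (T *ᵥ g)| ≤ (2 * b * D / c * δ + b ^ 2 * ε) * κ := by
  have hδ : 0 ≤ δ := (l2_nonneg _).trans hd
  have hε : 0 ≤ ε / κ := (frob_nonneg _).trans hST
  have e1 : A *ᵥ (w - g) = (G - A) *ᵥ g := by
    rw [Matrix.mulVec_sub, hAw, Matrix.sub_mulVec]
  have h1 : l2 (w - g) ≤ κ / c * δ := by
    refine l2_le_of_dotProduct_le (by positivity) ?_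
    have h2 := hA (w - g)
    rw [e1] at h2
    have h3 := (dotProduct_le_l2 (w - g) ((G - A) *ᵥ g)).trans
      (mul_le_mul_of_nonneg_left hd (l2_nonneg _))
    have h4 := mul_le_mul_of_nonneg_left (h2.trans h3) (by positivity : 0 ≤ κ / c)
    rw [← l2_sq_eq_dotProduct]
    calc l2 (w - g) ^ 2 = κ / c * (c / κ * l2 (w - g) ^ 2) := by field_simp
      _ ≤ κ / c * (l2 (w - g) * δ) := h4
      _ = _ := by ring
  have e2 : w ⬝ᵥ (S *ᵥ w) - g ⬝ᵥ (T *ᵥ g) = (w - g) ⬝ᵥ (S *ᵥ w) + g ⬝ᵥ (S *ᵥ (w - g))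
      + g ⬝ᵥ ((S - T) *ᵥ g) := by
    rw [Matrix.mulVec_sub, Matrix.sub_mulVec, dotProduct_sub, dotProduct_sub, sub_dotProduct]
    ring
  have b1 : |(w - g) ⬝ᵥ (S *ᵥ w)| ≤ κ / c * δ * (D / κ * (b * κ)) :=
    (abs_dotProduct_le _ _).trans (mul_le_mul h1 ((hS w).trans
      (mul_le_mul_of_nonneg_left hw (by positivity))) (l2_nonneg _) (by positivity))
  have b2 : |g ⬝ᵥ (S *ᵥ (w - g))| ≤ b * κ * (D / κ * (κ / c * δ)) :=
    (abs_dotProduct_le _ _).trans (mul_le_mul hg ((hS _).trans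
      (mul_le_mul_of_nonneg_left h1 (by positivity))) (l2_nonneg _) (by positivity))
  have b3 : |g ⬝ᵥ ((S - T) *ᵥ g)| ≤ ε / κ * (b * κ) * (b * κ) := by
    refine (abs_bilin_le_frob _ _ _).trans ?_
    have := l2_nonneg g
    gcongr
  rw [e2]
  refine (abs_add_le _ _).trans ((add_le_add ((abs_add_le _ _).trans (add_le_add b1 b2)) b3).trans
    (le_of_eq ?_))
  field_simp
  ring

section Expansion

variable {p m : ℕ} {q s2 : ℝ × ℝ → ℝ}

/-- The local part of the variance agrees with the leading variance. -/
lemma exists_abs_localVar_sub_le [IsProbabilityMeasure (designLaw q)] (hq : BddPos q)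
    (hs : BddPos s2) (p m : ℕ) {c b : ℝ} (hc : 0 < c) (hb : 0 ≤ b) : ∃ C : ℝ, 0 < C ∧
      ∀ (ε : ℝ) (K n : ℕ) (lam : Fin 2 → ℝ) (x : Fin n → ℝ × ℝ) (j : Fin 2) (t : ℝ), ε ≤ 1 →
        0 < K → 0 < n → (∀ j, 0 ≤ lam j) → (∀ j, lam j / n ≤ ε / K) → t ∈ Ioo (0 : ℝ) 1 →
        frob (empMat p K x (fun _ => 1) j j - popMat p K q (fun _ => 1) j j) ≤ ε / K →
        frob (empMat p K x s2 j j - popMat p K q s2 j j) ≤ ε / K →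
        (∀ v, c / K * l2 v ^ 2 ≤ v ⬝ᵥ (penMat p m K lam x j *ᵥ v)) →
        ∀ w, penMat p m K lam x j *ᵥ w = bvec p K t → l2 w ≤ b * K →
        |(1 / (n : ℝ)) * (w ⬝ᵥ (empMat p K x s2 j j *ᵥ w)) - leadVar p K n q s2 j t|
          ≤ C * ε * (K / n) := by
  obtain ⟨cg, Cg, hcg, hCg, hgram⟩ := exists_gram_bound hq hs p
  obtain ⟨D, hD, hDb⟩ := abs_popMat_le hq hs p
  set b' := b + Cg with hb'
  set D' := (2 * p + 1) * (D + 1) with hD'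
  set Q : ℝ := (2 * m + 1) * ((m + 1) * 4 ^ m) with hQ
  have hb'0 : 0 < b' := by positivity
  have hD'0 : 0 < D' := by positivity
  have hQ0 : 0 < Q := by positivity
  refine ⟨2 * b' * D' / c * ((1 + Q) * Cg) + b' ^ 2, by positivity,
    fun ε K n lam x j t hε hK hn hlam0 hlam ht hdev hdevS hco w hw hwl => ?_⟩
  have hK' : (0 : ℝ) < K := by exact_mod_cast hK
  have hn' : (0 : ℝ) < n := by exact_mod_cast hn
  obtain ⟨hu, hgt⟩ := hgram K hK j
  obtain ⟨hg1, -, hlead⟩ := hgt t ht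
  set g := (gram p K q j)⁻¹ *ᵥ bvec p K t with hg
  have hGg : gram p K q j *ᵥ g = bvec p K t := mulVec_nonsing_inv_mulVec hu _
  rw [(hlead n).1, ← mul_sub, abs_mul, abs_of_pos (by positivity : 0 < 1 / (n : ℝ))]
  -- Moment deviation and penalty are each of size ε/K while g is O(K); that λ is o(n/K), and not
  -- merely O(n/K), is what makes this small.
  have hd : l2 ((gram p K q j - penMat p m K lam x j) *ᵥ g) ≤ (1 + Q) * Cg * ε := by
    have e : (gram p K q j - penMat p m K lam x j) *ᵥ g
        = -((empMat p K x (fun _ => 1) j j - popMat p K q (fun _ => 1) j j) *ᵥ g)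
          - (lam j / n) • (penalty m (K + p) *ᵥ g) := by
      rw [gram_eq_popMat hq hK, penMat_eq, Matrix.sub_mulVec, Matrix.sub_mulVec, Matrix.add_mulVec,
        Matrix.smul_mulVec]
      abel
    rw [e]
    have h1 := (l2_mulVec_le (empMat p K x (fun _ => 1) j j - popMat p K q (fun _ => 1) j j) g).trans
      (mul_le_mul hdev hg1 (l2_nonneg _) ((frob_nonneg _).trans hdev))
    have h2 := (penalty_banded (m := m) (N := K + p)).l2_mulVec_le abs_penalty_le (by positivity) g
    have h3 : l2 ((lam j / n) • (penalty m (K + p) *ᵥ g)) ≤ ε / K * (Q * (Cg * K)) := by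
      rw [l2_smul, abs_of_nonneg (div_nonneg (hlam0 j) hn'.le)]
      refine mul_le_mul (hlam j) (h2.trans (mul_le_mul_of_nonneg_left hg1 hQ0.le)) (l2_nonneg _)
        ((div_nonneg (hlam0 j) hn'.le).trans (hlam j))
    refine (l2_sub_le _ _).trans ?_
    rw [l2_neg]
    refine (add_le_add h1 h3).trans (le_of_eq ?_)
    field_simp
  have hS : ∀ v, l2 (empMat p K x s2 j j *ᵥ v) ≤ D' / K * l2 v := by
    intro v
    have hbdd : ∀ i k, |empMat p K x s2 j j i k| ≤ (D + 1) / K := by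
      intro i k
      have e : empMat p K x s2 j j i k = popMat p K q s2 j j i k
        + (empMat p K x s2 j j - popMat p K q s2 j j) i k := by simp
      rw [e, add_div]
      exact (abs_add_le _ _).trans (add_le_add ((hDb K hK).1 j j i k)
        ((abs_apply_le_frob _ i k).trans (hdevS.trans (div_le_div_of_nonneg_right hε hK'.le))))
    refine ((empMat_banded hK x j).l2_mulVec_le hbdd (by positivity) v).trans (le_of_eq ?_)
    rw [hD']; ring
  have hfin := abs_quadratic_sub_le hK' hc hb'0.le hD'0.le hco (hw.trans hGg.symm) hd hS hdevS
    (hwl.trans (by gcongr; linarith)) (hg1.trans (by gcongr; linarith))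
  refine (mul_le_mul_of_nonneg_left hfin (by positivity)).trans (le_of_eq ?_)
  ring

/-- The leading bias is `O(K⁻¹)`. -/
lemma exists_abs_biasLam_le [IsProbabilityMeasure (designLaw q)] (hq : BddPos q)
    (p : ℕ) {m : ℕ} (hm : 1 ≤ m) {f : ℝ → ℝ} {L : NNReal} (hf : LipschitzOnWith L f (Icc 0 1)) :
    ∃ C : ℝ, 0 < C ∧ ∀ (K n : ℕ) (lam t : ℝ) (j : Fin 2) (b : Fin (K + p) → ℝ), 0 < K → 0 ≤ lam →
      lam / n ≤ 1 / K → t ∈ Ioo (0 : ℝ) 1 → IsBestApprox p K f b →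
      |biasLam p m K n lam q j b t| ≤ C / K := by
  obtain ⟨cg, Cg, hcg, hCg, hgram⟩ := exists_gram_bound hq BddPos.one p
  obtain ⟨c, hc, hstab⟩ := exists_stability p
  set Q : ℝ := (2 * m + 1) * ((m + 1) * 4 ^ m) with hQ
  have hQ0 : 0 < Q := by positivity
  set E : ℝ := 2 * (L * (p + 1)) / √c with hE
  have hE0 : 0 ≤ E := by positivity
  refine ⟨Cg * (Q * (L * m) + Q * E) + 1, by positivity,
    fun K n lam t j b hK hlam0 hlam ht hb => ?_⟩
  have hK' : (0 : ℝ) < K := by exact_mod_cast hK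
  -- The best approximant and the knot spline are both within O(1/K) of f, so by stability in the
  -- supremum norm their coefficients are too. The best coefficients thus inherit the small
  -- increments that the penalty sees.
  have hdiff : ∀ k, |(b - knotCoef p K f) k| ≤ E / K := by
    intro k
    have h1 := (hstab K hK (b - knotCoef p K f)).2 (2 * (L * (p + 1)) / K) (fun t ht => by
      have h2 := hb.abs_sub_le (c := knotCoef p K f) (δ := L * (p + 1) / K) (by positivity)
        (fun x hx => abs_sub_knotCoef_le hK hf hx) ht
      have h3 := abs_sub_knotCoef_le (p := p) hK hf ht
      have e : bvec p K t ⬝ᵥ (b - knotCoef p K f) = (f t - bvec p K t ⬝ᵥ knotCoef p K f)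
        - (f t - bvec p K t ⬝ᵥ b) := by rw [dotProduct_sub]; ring
      rw [e]
      refine (abs_sub _ _).trans ((add_le_add h3 h2).trans (le_of_eq ?_))
      ring) k
    refine abs_le_of_sq_le_sq ?_ (by positivity)
    rw [hE, div_div, mul_comm √c, ← div_div, div_pow _ √c, Real.sq_sqrt hc.le, le_div_iff₀ hc]
    linarith
  have hpen : ∀ i, |(penalty m (K + p) *ᵥ b) i| ≤ (Q * (L * m) + Q * E) / K := by
    intro i
    have h1 := abs_penalty_mulVec_le (N := K + p) hm (c := knotCoef p K f) (δ := L / K)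
      (fun i k => by
        have := knotCoef_sub_le (p := p) (K := K) hf i k
        rwa [mul_div_right_comm] at this) (by positivity) i
    have h2 := (penalty_banded (m := m) (N := K + p)).abs_mulVec_le abs_penalty_le
      (by positivity : 0 ≤ E / K) hdiff i
    have e : (penalty m (K + p) *ᵥ b) i = (penalty m (K + p) *ᵥ knotCoef p K f) i
        + (penalty m (K + p) *ᵥ (b - knotCoef p K f)) i := by
      rw [← Pi.add_apply, ← Matrix.mulVec_add, add_sub_cancel]
    rw [e]
    refine (abs_add_le _ _).trans ((add_le_add h1 h2).trans (le_of_eq ?_))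
    rw [hQ]; ring
  have hg := ((hgram K hK j).2 t ht).2.1
  have hsymm : (gram p K q j)ᵀ = gram p K q j := by
    rw [gram_eq_popMat hq hK]; exact popMat_transpose j j
  rw [biasLam, dotProduct_mulVec_comm, Matrix.transpose_nonsing_inv, hsymm, abs_mul, abs_neg,
    abs_of_nonneg (div_nonneg hlam0 (Nat.cast_nonneg n))]
  set g := (gram p K q j)⁻¹ *ᵥ bvec p K t
  have h1 : |g ⬝ᵥ (penalty m (K + p) *ᵥ b)| ≤ Cg * K * ((Q * (L * m) + Q * E) / K) := by
    calc _ ≤ ∑ i, |g i| * ((Q * (L * m) + Q * E) / K) := by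
          refine (Finset.abs_sum_le_sum_abs _ _).trans (Finset.sum_le_sum fun i _ => ?_)
          rw [abs_mul]; exact mul_le_mul_of_nonneg_left (hpen i) (abs_nonneg _)
      _ ≤ _ := by
          rw [← Finset.sum_mul]; exact mul_le_mul_of_nonneg_right hg (by positivity)
  calc _ ≤ 1 / K * (Cg * K * ((Q * (L * m) + Q * E) / K)) :=
        mul_le_mul hlam h1 (abs_nonneg _) (by positivity)
    _ = Cg * (Q * (L * m) + Q * E) / K := by field_simp
    _ ≤ _ := by gcongr; linarith

end Expansion

section Expansion

lemma abs_sub_le_of_split {z g h C C₁ C₂ ε κ n : ℝ} (hε : 0 ≤ ε) (hκ : 0 < κ) (hn : 0 < n)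
    (h₁ : C₁ ≤ C) (h₂ : C₂ ≤ C) (hz : |z - h| ≤ C₁ * (√κ / n)) (hg : |h - g| ≤ C₂ * ε * (κ / n)) :
    |z - g| ≤ C * (ε + 1 / √κ) * (κ / n) := by
  have hs : 0 < √κ := Real.sqrt_pos.2 hκ
  have e1 : √κ / n = 1 / √κ * (κ / n) := by
    rw [div_mul_div_comm, one_mul, div_eq_div_iff hn.ne' (by positivity)]
    linear_combination n * Real.mul_self_sqrt hκ.le
  rw [e1] at hz
  calc |z - g| = |(z - h) + (h - g)| := by rw [sub_add_sub_cancel]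
    _ ≤ C₁ * (1 / √κ * (κ / n)) + C₂ * ε * (κ / n) := (abs_add_le _ _).trans (add_le_add hz hg)
    _ ≤ C * (1 / √κ * (κ / n)) + C * ε * (κ / n) := by gcongr
    _ = _ := by ring

set_option maxHeartbeats 1000000 in
/-- On good designs the estimators are affine in the errors, with small bias, the right variance and
small covariance. -/
lemma exists_expansion {q s2 : ℝ × ℝ → ℝ} [IsProbabilityMeasure (designLaw q)] (hq : BddPos q)
    (hs : BddPos s2) (p : ℕ) {m : ℕ} (hm : 1 ≤ m) {f : Fin 2 → ℝ → ℝ} {Lf : NNReal}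
    (hf : ∀ j, LipschitzOnWith Lf (f j) (Icc 0 1)) :
    ∃ ε₀ θ : ℝ, 0 < ε₀ ∧ 0 < θ ∧ ∀ M : ℝ, 0 ≤ M → ∃ C : ℝ, 0 < C ∧
      ∀ (ε : ℝ) (K n : ℕ) (lam : Fin 2 → ℝ) (x : Fin n → ℝ × ℝ) (t : Fin 2 → ℝ) (ν : Fin 2 → ℕ)
        (b0 : Fin (K + p) → ℝ), 0 < ε → ε ≤ ε₀ → 0 < K → 0 < n → (∀ j, 0 ≤ lam j) →
        (∀ j, lam j / n ≤ ε / K) → (∀ l, x l ∈ unitSquare) → (∀ j, t j ∈ Ioo (0 : ℝ) 1) →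
        (∀ j, IsCell K (t j) (ν j)) →
        GoodMoments p K q (fun _ => 1) ε M θ (ν 0) (ν 1) x →
        GoodMoments p K q s2 ε M θ (ν 0) (ν 1) x →
        |(1 / (n : ℝ)) * ∑ l, f 1 (x l).2| ≤ M / K →
        |(1 / (n : ℝ)) * ∑ l, bvec p K (x l).2 ⬝ᵥ b0| ≤ M / K →
        WellPosed p m K lam x ∧ ∃ (μ : Fin 2 → ℝ) (w : Fin 2 → Fin n → ℝ),
          (∀ e j, fhat p m K lam x (response f x e) b0 j (t j) = μ j + w j ⬝ᵥ e) ∧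
          (∀ j, |μ j - f j (t j)| ≤ C / K) ∧
          (∀ j, |∑ l, s2 (x l) * w j l * w j l - leadVar p K n q s2 j (t j)|
            ≤ C * (ε + 1 / √K) * (K / n)) ∧
          |∑ l, s2 (x l) * w 0 l * w 1 l| ≤ C / n := by
  obtain ⟨ε₀, c, a, θ, hε₀, hε₀1, hc, ha, hθ, hloc⟩ := exists_localizedSystem hq hs p hm
  refine ⟨ε₀, θ, hε₀, hθ, fun M hM => ?_⟩
  obtain ⟨b, hb, hsys⟩ := hloc M hM
  have hb0 : 0 < b := one_pos.trans_le hb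
  obtain ⟨Cv, hCv, hvar⟩ := exists_abs_localVar_sub_le hq hs p m hc hb0.le
  set R : ℝ := (2 * (max p m : ℕ) + 1) * a * (2 * Lf * (p + 1))
        + (2 * m + 1) * ((m + 1) * 4 ^ m) * (Lf * m) with hR
  set T : ℝ := 2 * M + Lf * (p + 1) with hT
  have hR0 : 0 ≤ R := by positivity
  have hT0 : 0 ≤ T := by positivity
  -- R bounds the scaled residuals and T the scaled mean. The summand a R is added because the mean
  -- of the first component is recovered from a sum over at most aK residual entries, and b² serves
  -- the bounds on the smoothing vectors.
  set B : ℝ := R + a * R + T + b ^ 2 with hB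
  have haR : 0 ≤ a * R := by positivity
  have hb2 : 0 < b ^ 2 := by positivity
  have hB0 : 0 < B := by positivity
  set C₁ : ℝ := B ^ 2 + B * ((2 / c + 1) * B * √a) + Lf * (p + 1) with hC₁
  set C₂ : ℝ := b * (2 * √((2 * (max p m : ℕ) + 1) * a * b ^ 2) * √(b ^ 4 / c) + b ^ 4 / c) with hC₂
  set C₃ : ℝ := b ^ 3 + 2 * ((b ^ 3 + b ^ 2 * ((b + b ^ 2) / c + b * √a)) * b ^ 3)
    + b * (b ^ 4 / c) with hC₃
  have hC₁0 : 0 < C₁ := by positivity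
  have hC₂0 : 0 < C₂ := by positivity
  have hC₃0 : 0 < C₃ := by positivity
  refine ⟨C₁ + (Cv + C₂) + C₃, by positivity, fun ε K n lam x t ν b0 hε hεε hK hn hlam0 hlam hx ht hν
    h₁ h₂ hmean hmb0 => ?_⟩
  have hK' : (0 : ℝ) < K := by exact_mod_cast hK
  have hn' : (0 : ℝ) < n := by exact_mod_cast hn
  have hε1 : ε ≤ 1 := hεε.trans hε₀1
  have hlam' : ∀ j, lam j / n ≤ 1 / K := fun j => (hlam j).trans (by gcongr)
  have loc := hsys K n lam x t ν hK hn hlam0 hlam' hx ht hν (h₁.mono hεε) (h₂.mono hεε)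
  have sys : DesignSystem (max p m) p m K c a lam x := loc.sys
  refine ⟨sys.wellPosed hK hx, ?_⟩
  obtain ⟨u, v, huv, hv0, hlin⟩ := exists_noise_response sys hK hx
  set H := empMat p K x (fun _ => 1) 0 1 with hH
  set w₁ := (penMat p m K lam x 0)⁻¹ *ᵥ bvec p K (t 0) with hw₁
  set w₂ := (penMat p m K lam x 1)⁻¹ *ᵥ bvec p K (t 1) with hw₂
  have hAw₁ : penMat p m K lam x 0 *ᵥ w₁ = bvec p K (t 0) := mulVec_nonsing_inv_mulVec sys.isUnit₁ _
  have hAw₂ : penMat p m K lam x 1 *ᵥ w₂ = bvec p K (t 1) := mulVec_nonsing_inv_mulVec sys.isUnit₂ _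
  obtain ⟨α, hα⟩ := exists_dotProduct_eq v (Hᵀ *ᵥ w₁)
  obtain ⟨β, hβ⟩ := exists_dotProduct_eq u (H *ᵥ w₂)
  set y : Fin n → ℝ := response f x 0 with hy
  set bl := backfitLimit p m K lam x y b0 with hbl
  have hresp : ∀ e, response f x e = y + e := fun e => by
    ext l; simp [hy, response]
  -- the noise parts
  have hn₁ : ∀ e, bvec p K (t 0) ⬝ᵥ u e
      = ((1 / (n : ℝ)) • (designMatrix p K x 0 *ᵥ w₁) - α) ⬝ᵥ e := fun e => by
    rw [← hAw₁, (huv e).dotProduct_eq sys.symm₁, dotProduct_designRhs, sub_dotProduct, hα]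
  have hn₂ : ∀ e, bvec p K (t 1) ⬝ᵥ v e
      = ((1 / (n : ℝ)) • (designMatrix p K x 1 *ᵥ w₂) - β) ⬝ᵥ e := fun e => by
    rw [← hAw₂, (huv e).swap.dotProduct_eq sys.symm₂, dotProduct_designRhs, sub_dotProduct, hβ,
      Matrix.transpose_transpose]
  -- the bias
  obtain ⟨r₁, r₂, hres, hr₁, hr₂, hμ⟩ := exists_isSol_residual sys hK hn hm hlam0 hlam' hx hf hmean
    hmb0
  rw [← hR] at hr₁ hr₂
  rw [← hT] at hμ
  have hRB : R / (K : ℝ) ^ 2 ≤ B / (K : ℝ) ^ 2 := by gcongr; linarith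
  -- The bias bound with exchanged roles needs the mean of the first component, whereas the
  -- iteration controls that of the second; `sum_eq` links them.
  have hsw : |(H *ᵥ 1) ⬝ᵥ (bl.1 - knotCoef p K (f 0))| ≤ B / K := by
    have h3 : (H *ᵥ 1) ⬝ᵥ (bl.1 - knotCoef p K (f 0))
        = 1 ⬝ᵥ r₁ - (Hᵀ *ᵥ 1) ⬝ᵥ (bl.2 - knotCoef p K (f 1)) := eq_sub_of_add_eq (sys.sum_eq hres)
    have h4 : |1 ⬝ᵥ r₁| ≤ a * R / K := by
      calc |1 ⬝ᵥ r₁| ≤ ∑ _i : Fin (K + p), R / (K : ℝ) ^ 2 := by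
            simp only [dotProduct, Pi.one_apply, one_mul]
            exact (Finset.abs_sum_le_sum_abs _ _).trans (Finset.sum_le_sum fun i _ => hr₁ i)
        _ = ((K + p : ℕ) : ℝ) * (R / (K : ℝ) ^ 2) := by
            rw [Finset.sum_const, Finset.card_univ, Fintype.card_fin, nsmul_eq_mul]
        _ ≤ a * K * (R / (K : ℝ) ^ 2) := mul_le_mul_of_nonneg_right sys.card_le (by positivity)
        _ = _ := by field_simp
    rw [h3]
    refine (abs_sub _ _).trans ((add_le_add h4 hμ).trans ?_)
    rw [← add_div]; gcongr; linarith
  have hwsum : ∀ z W : Fin (K + p) → ℝ, ∑ i, |z i| ≤ b * l2 (W * z) → l2 (W * z) ≤ b * K →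
      ∑ i, |z i| ≤ B * K := fun z W h3 h4 => by
    refine h3.trans ((mul_le_mul_of_nonneg_left h4 hb0.le).trans ?_)
    rw [← mul_assoc, ← sq]; gcongr; linarith
  have hsK : 0 < √(K : ℝ) := Real.sqrt_pos.2 hK'
  have hbB : b ^ 2 / √(K : ℝ) ≤ B / √(K : ℝ) := by gcongr; linarith
  have hbias₁ := sys.abs_dotProduct_le hB0.le hres (fun i => (hr₁ i).trans hRB)
    (fun i => (hr₂ i).trans hRB) (hμ.trans (by gcongr; linarith)) (loc.l2_smooth_le.trans hbB)
    (hwsum _ _ (loc.sum₁ _) loc.loc₁)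
  have hbias₂ := sys.swap.abs_dotProduct_le hB0.le hres.swap (fun i => (hr₂ i).trans hRB)
    (fun i => (hr₁ i).trans hRB) (by rw [Matrix.transpose_transpose]; exact hsw)
    (loc.swap.l2_smooth_le.trans hbB) (hwsum _ _ (loc.sum₂ _) loc.loc₂)
  rw [hAw₁, dotProduct_sub] at hbias₁
  rw [hAw₂, dotProduct_sub] at hbias₂
  have hap := fun j => abs_sub_knotCoef_le (p := p) hK (hf j) (ht j)
  have hCC₁ : C₁ ≤ C₁ + (Cv + C₂) + C₃ := by linarith
  have hCCv : Cv ≤ C₁ + (Cv + C₂) + C₃ := by linarith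
  have hCC₂ : C₂ ≤ C₁ + (Cv + C₂) + C₃ := by linarith
  have hCC₃ : C₃ ≤ C₁ + (Cv + C₂) + C₃ := by linarith
  have hbfin : ∀ z g h : ℝ, |z - h| ≤ (B ^ 2 + B * ((2 / c + 1) * B * √a)) / K →
      |g - h| ≤ Lf * (p + 1) / K → |z - g| ≤ (C₁ + (Cv + C₂) + C₃) / K := by
    intro z g h h3 h4
    refine le_trans ?_ (div_le_div_of_nonneg_right hCC₁ hK'.le)
    rw [hC₁, add_div, show z - g = (z - h) - (g - h) by ring]
    exact (abs_sub _ _).trans (add_le_add h3 h4)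
  -- the variances
  have hsd := fun e => sys.sq_le_of_design loc.fit (huv e) (hv0 e)
  have hvar₁ := loc.abs_variance_sub_le (fun e => (hsd e).2) hα
  have hvar₂ := loc.swap.abs_variance_sub_le (v := u) (α := β) (fun e => (hsd e).1)
    (by rw [Matrix.transpose_transpose]; exact hβ)
  rw [← empMat_eq, ← hC₂] at hvar₁ hvar₂
  have hlead₁ := hvar ε K n lam x 0 (t 0) hε1 hK hn hlam0 hlam (ht 0) (h₁.dev 0 0) (h₂.dev 0 0)
    sys.coercive₁ w₁ hAw₁ ((loc.le₁ _).trans loc.loc₁)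
  have hlead₂ := hvar ε K n lam x 1 (t 1) hε1 hK hn hlam0 hlam (ht 1) (h₁.dev 1 1) (h₂.dev 1 1)
    sys.coercive₂ w₂ hAw₂ ((loc.le₂ _).trans loc.loc₂)
  have hcov := loc.abs_covariance_le huv hv0 hα hβ
  refine ⟨![bvec p K (t 0) ⬝ᵥ bl.1, bvec p K (t 1) ⬝ᵥ bl.2],
    ![(1 / (n : ℝ)) • (designMatrix p K x 0 *ᵥ w₁) - α,
      (1 / (n : ℝ)) • (designMatrix p K x 1 *ᵥ w₂) - β], ?_, ?_, ?_, ?_⟩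
  · intro e j
    have h3 := hlin y e b0
    fin_cases j
    · simp only [fhat, hresp, Fin.zero_eta, if_true, Matrix.cons_val_zero]
      rw [h3.1, dotProduct_add, hn₁]
    · simp only [fhat, hresp, Fin.mk_one, one_ne_zero, if_false, Matrix.cons_val_one,
        Matrix.cons_val_fin_one]
      rw [h3.2, dotProduct_add, hn₂]
  · intro j
    fin_cases j
    · exact hbfin _ _ _ hbias₁ (hap 0)
    · exact hbfin _ _ _ hbias₂ (hap 1)
  · intro j
    fin_cases j
    · exact abs_sub_le_of_split hε.le hK' hn' hCC₂ hCCv hvar₁ hlead₁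
    · exact abs_sub_le_of_split hε.le hK' hn' hCC₂ hCCv hvar₂ hlead₂
  · exact hcov.trans (div_le_div_of_nonneg_right hCC₃ hn'.le)

end Expansion

/-! ### Good designs have high probability -/

section GoodDesign

variable {Ω : Type*} [MeasurableSpace Ω] {P : Measure Ω} [IsProbabilityMeasure P]
  {X : ℕ → Ω → ℝ × ℝ} {q g : ℝ × ℝ → ℝ} {K : ℕ → ℕ}

/-- The growth condition enters the argument only in this form: K² = o(n) makes the Frobenius
deviation o(1/K) and the cross entries O(K^{-2}) in mean square. -/
lemma tendsto_sq_div {γ : ℝ} (hγ : γ < 1 / 2)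
    (hK : (fun n => (K n : ℝ)) =O[atTop] fun n => (n : ℝ) ^ γ) :
    Tendsto (fun n => (K n : ℝ) ^ 2 / n) atTop (𝓝 0) := by
  obtain ⟨C, hC⟩ := hK.bound
  have h0 : Tendsto (fun n : ℕ => C ^ 2 * (n : ℝ) ^ (-(1 - 2 * γ))) atTop (𝓝 0) := by
    have := ((tendsto_rpow_neg_atTop (by linarith : 0 < 1 - 2 * γ)).comp
      (tendsto_natCast_atTop_atTop (R := ℝ))).const_mul (C ^ 2)
    simpa using this
  refine tendsto_of_tendsto_of_tendsto_of_le_of_le' tendsto_const_nhds h0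
    (Eventually.of_forall fun n => by positivity) ?_
  filter_upwards [hC, eventually_gt_atTop 0] with n hn hn0
  have hn' : (0 : ℝ) < n := by exact_mod_cast hn0
  rw [Real.norm_of_nonneg (by positivity), Real.norm_of_nonneg (by positivity)] at hn
  have e : (n : ℝ) ^ (-(1 - 2 * γ)) = ((n : ℝ) ^ γ) ^ 2 / n := by
    rw [← Real.rpow_natCast, ← Real.rpow_mul hn'.le, eq_div_iff hn'.ne']
    nth_rewrite 2 [← Real.rpow_one (n : ℝ)]
    rw [← Real.rpow_add hn']
    congr 1; push_cast; ring
  rw [e, mul_div_assoc', ← mul_pow]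
  gcongr

lemma eventually_sq_le (hKtop : Tendsto K atTop atTop)
    (hK : Tendsto (fun n => (K n : ℝ) ^ 2 / n) atTop (𝓝 0)) :
    ∀ᶠ n : ℕ in atTop, 0 < n ∧ 0 < K n ∧ K n ^ 2 ≤ n := by
  filter_upwards [eventually_gt_atTop 0, hKtop.eventually_gt_atTop 0,
    hK.eventually_le_const one_pos] with n h1 h2 h3
  refine ⟨h1, h2, ?_⟩
  rw [div_le_one (by exact_mod_cast h1)] at h3
  exact_mod_cast h3

/-- Seven events, four deviations and three weighted sums, each get probability δ/7. The level M
depends on δ alone while ε is arbitrary; uniformity in ν₀, ν₁ lets the cells of the fixed points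
move with n. -/
lemma eventually_measure_goodMoments (hX : ∀ i, Measurable (X i))
    (hμ : ∀ i, P.map (X i) = designLaw q) (hind : iIndepFun X P) (hq : BddPos q) (hg : BddPos g)
    (p : ℕ) (hKtop : Tendsto K atTop atTop)
    (hK : Tendsto (fun n => (K n : ℝ) ^ 2 / n) atTop (𝓝 0)) {θ : ℝ} (hθ : 0 < θ) {δ : ℝ}
    (hδ : 0 < δ) : ∃ M₀ : ℝ, 0 < M₀ ∧ ∀ M, M₀ ≤ M → ∀ ε : ℝ, 0 < ε → ∀ᶠ n in atTop, ∀ ν₀ ν₁ : ℕ,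
      P {ω | ¬ GoodMoments p (K n) q g ε M θ ν₀ ν₁ (fun l : Fin n => X l ω)}
        ≤ ENNReal.ofReal δ := by
  obtain ⟨D, hD, hDb⟩ := exists_measure_weighted_empMat_le hX hμ hind hq hg p
  obtain ⟨S, hS, hSb⟩ := exists_sum_wt_le hθ
  obtain ⟨C, hC, hCb⟩ := hg.abs_le
  set T : ℝ := S * (p + 1) + S * S with hT
  have hT0 : 0 < T := by positivity
  refine ⟨7 * T * D / δ, by positivity, fun M hM ε hε => ?_⟩
  have hM0 : 0 < M := lt_of_lt_of_le (by positivity) hM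
  have hTM : T * D / M ≤ δ / 7 := by
    rw [div_le_iff₀ hδ] at hM
    rw [div_le_div_iff₀ hM0 (by norm_num)]
    linarith
  have hlim : ∀ᶠ n in atTop, C ^ 2 / ε ^ 2 * ((K n : ℝ) ^ 2 / n) ≤ δ / 7 := by
    have := hK.const_mul (C ^ 2 / ε ^ 2)
    rw [mul_zero] at this
    exact this.eventually_le_const (by positivity)
  filter_upwards [hlim, eventually_sq_le hKtop hK] with n hn ⟨hn0, hK0, hKn⟩ ν₀ ν₁
  have hK' : (0 : ℝ) < K n := by exact_mod_cast hK0
  have hn' : (0 : ℝ) < n := by exact_mod_cast hn0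
  set N := K n + p with hN
  have hNK : (N : ℝ) ≤ (p + 1) * K n := by
    have h1 : (1 : ℝ) ≤ K n := by exact_mod_cast hK0
    have h2 : (p : ℝ) * 1 ≤ p * K n := by gcongr
    rw [hN]; push_cast; linarith
  have hdev : ∀ j j', P {ω | (ε / K n) ^ 2 <
      frob (empMat p (K n) (fun l : Fin n => X l ω) g j j' - popMat p (K n) q g j j') ^ 2}
        ≤ ENNReal.ofReal (δ / 7) := fun j j' => by
    refine (measure_frob_empMat_sub_popMat_le hX hμ hind hg.1 hCb hK0 j j' hn0
      (by positivity)).trans (ENNReal.ofReal_le_ofReal (le_trans (le_of_eq ?_) hn))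
    field_simp
  have hwt : ∀ (ν : ℕ) (i : Fin N), 0 ≤ (wt N θ ν i ^ 2)⁻¹ := fun ν i => by positivity
  have hrow : P {ω | M / (K n : ℝ) ^ 3 < ∑ i, ∑ k, (wt N θ ν₀ i ^ 2)⁻¹ *
      empMat p (K n) (fun l : Fin n => X l ω) g 0 1 i k ^ 2} ≤ ENNReal.ofReal (δ / 7) := by
    refine (hDb (K n) hK0 n hKn 0 1 (by decide) _ (fun i k => hwt ν₀ i) _
      (by positivity)).trans (ENNReal.ofReal_le_ofReal (le_trans ?_ hTM))
    have h1 : ∑ i : Fin N, ∑ _k : Fin N, (wt N θ ν₀ i ^ 2)⁻¹ ≤ T * K n := by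
      simp only [Finset.sum_const, Finset.card_univ, Fintype.card_fin, nsmul_eq_mul]
      rw [← Finset.mul_sum]
      calc _ ≤ (p + 1) * K n * S := mul_le_mul hNK (hSb N ν₀)
            (Finset.sum_nonneg fun i _ => hwt ν₀ i) (by positivity)
        _ = S * (p + 1) * K n := by ring
        _ ≤ _ := by gcongr; rw [hT]; linarith [mul_pos hS hS]
    calc _ ≤ T * K n * (D / (K n : ℝ) ^ 4) / (M / (K n : ℝ) ^ 3) := by gcongr
      _ = _ := by field_simp
  have hcol : P {ω | M / (K n : ℝ) ^ 3 < ∑ i, ∑ k, (wt N θ ν₁ k ^ 2)⁻¹ *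
      empMat p (K n) (fun l : Fin n => X l ω) g 0 1 i k ^ 2} ≤ ENNReal.ofReal (δ / 7) := by
    refine (hDb (K n) hK0 n hKn 0 1 (by decide) (fun _ k => (wt N θ ν₁ k ^ 2)⁻¹)
      (fun i k => hwt ν₁ k) _ (by positivity)).trans (ENNReal.ofReal_le_ofReal (le_trans ?_ hTM))
    have h1 : ∑ _i : Fin N, ∑ k : Fin N, (wt N θ ν₁ k ^ 2)⁻¹ ≤ T * K n := by
      simp only [Finset.sum_const, Finset.card_univ, Fintype.card_fin, nsmul_eq_mul]
      calc _ ≤ (p + 1) * K n * S := mul_le_mul hNK (hSb N ν₁)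
            (Finset.sum_nonneg fun i _ => hwt ν₁ i) (by positivity)
        _ = S * (p + 1) * K n := by ring
        _ ≤ _ := by gcongr; rw [hT]; linarith [mul_pos hS hS]
    calc _ ≤ T * K n * (D / (K n : ℝ) ^ 4) / (M / (K n : ℝ) ^ 3) := by gcongr
      _ = _ := by field_simp
  have hboth : P {ω | M / (K n : ℝ) ^ 4 < ∑ i, ∑ k, (wt N θ ν₀ i ^ 2)⁻¹ * (wt N θ ν₁ k ^ 2)⁻¹ *
      empMat p (K n) (fun l : Fin n => X l ω) g 0 1 i k ^ 2} ≤ ENNReal.ofReal (δ / 7) := by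
    refine (hDb (K n) hK0 n hKn 0 1 (by decide)
      (fun i k => (wt N θ ν₀ i ^ 2)⁻¹ * (wt N θ ν₁ k ^ 2)⁻¹)
      (fun i k => mul_nonneg (hwt ν₀ i) (hwt ν₁ k)) _
      (by positivity)).trans (ENNReal.ofReal_le_ofReal (le_trans ?_ hTM))
    have h1 : ∑ i : Fin N, ∑ k : Fin N, (wt N θ ν₀ i ^ 2)⁻¹ * (wt N θ ν₁ k ^ 2)⁻¹ ≤ T := by
      simp only [← Finset.mul_sum]
      rw [← Finset.sum_mul]
      calc _ ≤ S * S := mul_le_mul (hSb N ν₀) (hSb N ν₁)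
            (Finset.sum_nonneg fun i _ => hwt ν₁ i) hS.le
        _ ≤ _ := by rw [hT]; linarith [mul_pos hS (by positivity : (0 : ℝ) < p + 1)]
    calc _ ≤ T * (D / (K n : ℝ) ^ 4) / (M / (K n : ℝ) ^ 4) := by gcongr
      _ = _ := by field_simp
  have hsub : {ω | ¬ GoodMoments p (K n) q g ε M θ ν₀ ν₁ (fun l : Fin n => X l ω)} ⊆
      (⋃ a : Fin 2 × Fin 2, {ω | (ε / K n) ^ 2 <
        frob (empMat p (K n) (fun l : Fin n => X l ω) g a.1 a.2 - popMat p (K n) q g a.1 a.2) ^ 2})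
      ∪ ({ω | M / (K n : ℝ) ^ 3 < ∑ i, ∑ k, (wt N θ ν₀ i ^ 2)⁻¹ *
          empMat p (K n) (fun l : Fin n => X l ω) g 0 1 i k ^ 2}
      ∪ ({ω | M / (K n : ℝ) ^ 3 < ∑ i, ∑ k, (wt N θ ν₁ k ^ 2)⁻¹ *
          empMat p (K n) (fun l : Fin n => X l ω) g 0 1 i k ^ 2}
      ∪ {ω | M / (K n : ℝ) ^ 4 < ∑ i, ∑ k, (wt N θ ν₀ i ^ 2)⁻¹ * (wt N θ ν₁ k ^ 2)⁻¹ *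
          empMat p (K n) (fun l : Fin n => X l ω) g 0 1 i k ^ 2})) := by
    intro ω hω
    by_contra hcon
    simp only [Set.mem_union, Set.mem_iUnion, Set.mem_ofPred_eq, not_or, not_exists, not_lt]
      at hcon
    refine hω ⟨fun j j' => ?_, hcon.2.1, hcon.2.2.1, hcon.2.2.2⟩
    exact le_of_sq_le_sq (hcon.1 (j, j')) (by positivity)
  refine (measure_mono hsub).trans ?_
  refine (measure_union_le _ _).trans ?_
  have hdevs : P (⋃ a : Fin 2 × Fin 2, {ω | (ε / K n) ^ 2 <
        frob (empMat p (K n) (fun l : Fin n => X l ω) g a.1 a.2 - popMat p (K n) q g a.1 a.2) ^ 2})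
      ≤ 4 * ENNReal.ofReal (δ / 7) := by
    refine (measure_iUnion_le _).trans ?_
    rw [tsum_fintype]
    refine (Finset.sum_le_sum fun a _ => hdev a.1 a.2).trans ?_
    simp
  have e7 : ENNReal.ofReal δ = 4 * ENNReal.ofReal (δ / 7) + (ENNReal.ofReal (δ / 7)
      + (ENNReal.ofReal (δ / 7) + ENNReal.ofReal (δ / 7))) := by
    have h4 : (4 : ℝ≥0∞) = ENNReal.ofReal 4 := by simp
    rw [h4, ← ENNReal.ofReal_mul (by norm_num), ← ENNReal.ofReal_add (by positivity) (by positivity),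
      ← ENNReal.ofReal_add (by positivity) (by positivity),
      ← ENNReal.ofReal_add (by positivity) (by positivity)]
    congr 1; ring
  rw [e7]
  exact add_le_add hdevs ((measure_union_le _ _).trans (add_le_add hrow
    ((measure_union_le _ _).trans (add_le_add hcol hboth))))

/-- The empirical mean of a centred component is negligible. -/
lemma eventually_measure_mean (hX : ∀ i, Measurable (X i))
    (hμ : ∀ i, P.map (X i) = designLaw q) (hind : iIndepFun X P) {f : ℝ → ℝ}
    (hf : ContinuousOn f (Icc 0 1)) (hcent : ∫ ω, f (X 0 ω).2 ∂P = 0)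
    (hK : Tendsto (fun n => (K n : ℝ) ^ 2 / n) atTop (𝓝 0)) (hKtop : Tendsto K atTop atTop)
    {δ : ℝ} (hδ : 0 < δ) {M : ℝ} (hM : 1 ≤ M) :
    ∀ᶠ n in atTop, P {ω | (∀ l, X l ω ∈ unitSquare) ∧
      M / K n < |(1 / (n : ℝ)) * ∑ l : Fin n, f (X l ω).2|} ≤ ENNReal.ofReal δ := by
  have := isProbabilityMeasure_designLaw hX hμ
  -- The function f is controlled on [0,1] only, so it is replaced by its constant extension, which
  -- is continuous; the event therefore includes that the design lies in the square.
  set h : ℝ × ℝ → ℝ := fun z => IccExtend zero_le_one ((Icc (0 : ℝ) 1).domRestrict f) z.2 with hh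
  have hcont : Continuous h := (continuous_IccExtend_iff.2 hf.domRestrict).comp continuous_snd
  have heq : ∀ z ∈ unitSquare, h z = f z.2 := fun z hz => by
    have hz2 : z.2 ∈ Icc (0 : ℝ) 1 := Ioo_subset_Icc_self hz.2
    simp only [hh]
    rw [IccExtend_of_mem _ _ hz2]; rfl
  obtain ⟨C, hC⟩ := isCompact_Icc.exists_bound_of_continuousOn hf
  have hb : ∀ z ∈ unitSquare, |h z| ≤ C := fun z hz => by
    rw [heq z hz]; exact hC _ (Ioo_subset_Icc_self hz.2)
  have hLp : MemLp h 2 (designLaw q) := memLp_of_bdd (ae_mem_unitSquare q) hcont.measurable hb 2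
  have hint : ∫ z, h z ∂designLaw q = 0 := by
    rw [← hcent, ← hμ 0, integral_map (hX 0).aemeasurable hcont.aestronglyMeasurable]
    refine integral_congr_ae ?_
    have h1 : ∀ᵐ ω ∂P, X 0 ω ∈ unitSquare := by
      refine ae_of_ae_map (hX 0).aemeasurable ?_
      rw [hμ 0]; exact ae_mem_unitSquare q
    filter_upwards [h1] with ω hω using heq _ hω
  have hsq : ∫ z, h z ^ 2 ∂designLaw q ≤ C ^ 2 := by
    have h1 : ∀ᵐ z ∂designLaw q, h z ^ 2 ≤ C ^ 2 := by
      filter_upwards [ae_mem_unitSquare q] with z hz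
      exact sq_le_sq' (abs_le.1 (hb z hz)).1 (abs_le.1 (hb z hz)).2
    refine (integral_mono_ae hLp.integrable_sq (integrable_const _) h1).trans ?_
    simp
  have hlim : ∀ᶠ n in atTop, C ^ 2 * ((K n : ℝ) ^ 2 / n) ≤ δ := by
    have := hK.const_mul (C ^ 2)
    rw [mul_zero] at this
    exact this.eventually_le_const hδ
  filter_upwards [hlim, eventually_sq_le hKtop hK] with n hn ⟨hn0, hK0, hKn⟩
  have hK' : (0 : ℝ) < K n := by exact_mod_cast hK0
  have hn' : (0 : ℝ) < n := by exact_mod_cast hn0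
  have hM0 : 0 < M := by linarith
  have h2 := integral_sq_empMean_sub_le hX hμ hind hcont.measurable hLp hn0
  rw [hint] at h2
  simp only [sub_zero] at h2
  have h3 := measure_lt_sum_sq_le (ι := Unit) (P := P)
    (Z := fun _ ω => empMean (fun l : Fin n => X l ω) h) (fun _ => memLp_empMean hX hμ hLp n)
    (w := fun _ => 1) (B := fun _ => 1 / n * C ^ 2) (fun _ => zero_le_one)
    (fun _ => h2.trans (by gcongr)) (t := (M / K n) ^ 2) (by positivity)
  refine (measure_mono ?_).trans (h3.trans (ENNReal.ofReal_le_ofReal ?_))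
  · rintro ω ⟨hω, hlt⟩
    simp only [Set.mem_ofPred_eq, Finset.univ_unique, Finset.sum_singleton, one_mul, empMean]
    rw [← sq_abs ((1 / (n : ℝ)) * _)]
    have e : ∑ l : Fin n, h (X l ω) = ∑ l : Fin n, f (X l ω).2 :=
      Finset.sum_congr rfl fun l _ => heq _ (hω l)
    rw [e]
    gcongr
  · simp only [Finset.univ_unique, Finset.sum_singleton, one_mul]
    calc 1 / (n : ℝ) * C ^ 2 / (M / K n) ^ 2 = C ^ 2 * ((K n : ℝ) ^ 2 / n) / M ^ 2 := by
          field_simp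
      _ ≤ C ^ 2 * ((K n : ℝ) ^ 2 / n) := div_le_self (by positivity) (one_le_pow₀ hM)
      _ ≤ δ := hn

end GoodDesign

/-! ### Moments of affine functions of the errors -/

section Errors

variable {ν : Measure (ℕ → ℝ)} [IsProbabilityMeasure ν] {n : ℕ}

lemma memLp_affine (hL : ∀ i, MemLp (fun e : ℕ → ℝ => e i) 2 ν) (c : ℝ) (w : Fin n → ℝ) :
    MemLp (fun e : ℕ → ℝ => c + w ⬝ᵥ fun l : Fin n => e l) 2 ν := by
  refine (memLp_const c).add ?_
  simp only [dotProduct]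
  exact memLp_finsetSum _ fun l _ => (hL l).const_mul (w l)

lemma integral_affine (hL : ∀ i, MemLp (fun e : ℕ → ℝ => e i) 2 ν)
    (hm : ∀ i, ∫ e : ℕ → ℝ, e i ∂ν = 0) (c : ℝ) (w : Fin n → ℝ) :
    ∫ e : ℕ → ℝ, (c + w ⬝ᵥ fun l : Fin n => e l) ∂ν = c := by
  have h1 : ∀ l : Fin n, Integrable (fun e : ℕ → ℝ => w l * e l) ν := fun l =>
    ((hL l).integrable (by norm_num)).const_mul (w l)
  simp only [dotProduct]
  rw [integral_add (integrable_const c) (integrable_finsetSum _ fun l _ => h1 l),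
    integral_finsetSum _ fun l _ => h1 l]
  simp [integral_const_mul, hm]

lemma covariance_affine (hind : iIndepFun (fun (i : ℕ) (e : ℕ → ℝ) => e i) ν)
    (hL : ∀ i, MemLp (fun e : ℕ → ℝ => e i) 2 ν) (c c' : ℝ) (w w' : Fin n → ℝ) :
    cov[fun e : ℕ → ℝ => c + w ⬝ᵥ fun l : Fin n => e l,
      fun e : ℕ → ℝ => c' + w' ⬝ᵥ fun l : Fin n => e l; ν]
      = ∑ l : Fin n, Var[fun e : ℕ → ℝ => e l; ν] * w l * w' l := by
  have h1 : ∀ (z : Fin n → ℝ) (l : Fin n), MemLp (fun e : ℕ → ℝ => z l * e l) 2 ν := fun z l =>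
    (hL l).const_mul (z l)
  simp only [dotProduct]
  rw [covariance_const_add_left (integrable_finsetSum _ fun l _ => (h1 w l).integrable (by norm_num)),
    covariance_const_add_right
      (integrable_finsetSum _ fun l _ => (h1 w' l).integrable (by norm_num)),
    covariance_fun_sum_fun_sum (fun l => h1 w l) (fun l => h1 w' l)]
  refine Finset.sum_congr rfl fun l _ => ?_
  rw [Finset.sum_eq_single l]
  · rw [covariance_const_mul_left, covariance_const_mul_right, covariance_self (hL l).aemeasurable]
    ring
  · intro k _ hkl
    rw [covariance_const_mul_left, covariance_const_mul_right,
      (hind.indepFun (i := (l : ℕ)) (j := (k : ℕ)) (fun h => hkl (Fin.ext h.symm))).covariance_eq_zero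
        (hL l) (hL k)]
    ring
  · simp

end Errors

/-! ### Stochastic expansion of the estimators -/

section Model

variable {Ω : Type*} [MeasurableSpace Ω] {P : Measure Ω} [IsProbabilityMeasure P]
  {X : ℕ → Ω → ℝ × ℝ} {ξ : ℕ → Ω → ℝ} {f : Fin 2 → ℝ → ℝ} {q s2 : ℝ × ℝ → ℝ}

instance (ω : Ω) : IsProbabilityMeasure (errLaw P X ξ ω) := by
  unfold errLaw; infer_instance

/-- The conditional moments of the estimators at the outcome `ω` have the leading terms of the
theorem up to errors governed by `C` and `η`. -/
structure HasExpansion (P : Measure Ω) [IsProbabilityMeasure P] (X : ℕ → Ω → ℝ × ℝ)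
    (ξ : ℕ → Ω → ℝ) (f : Fin 2 → ℝ → ℝ) (q s2 : ℝ × ℝ → ℝ) (p m : ℕ) (K : ℕ → ℕ)
    (lam : Fin 2 → ℕ → ℝ) (b0 : (n : ℕ) → (Fin n → ℝ × ℝ) → Fin (K n + p) → ℝ) (t : Fin 2 → ℝ)
    (C η : ℝ) (n : ℕ) (ω : Ω) : Prop where
  wellPosed : WellPosed p m (K n) (fun j => lam j n) (fun i : Fin n => X i ω)
  memLp : ∀ j, MemLp (estimator p m K lam f X b0 j (t j) n ω) 2 (errLaw P X ξ ω)
  mean : ∀ j, |∫ e, estimator p m K lam f X b0 j (t j) n ω e ∂(errLaw P X ξ ω) - f j (t j)|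
    ≤ C / K n
  variance : ∀ j, |Var[estimator p m K lam f X b0 j (t j) n ω; errLaw P X ξ ω]
    - leadVar p (K n) n q s2 j (t j)| ≤ C * (η + 1 / √(K n)) * (K n / n)
  cov : |cov[estimator p m K lam f X b0 0 (t 0) n ω, estimator p m K lam f X b0 1 (t 1) n ω;
    errLaw P X ξ ω]| ≤ C / n

variable {p m : ℕ} {K : ℕ → ℕ} {lam : Fin 2 → ℕ → ℝ}

lemma eventually_lam_div_le (hKtop : Tendsto K atTop atTop)
    (hlam : ∀ j, lam j =o[atTop] fun n => (n : ℝ) * (K n : ℝ)⁻¹) {η : ℝ} (hη : 0 < η) :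
    ∀ᶠ n in atTop, ∀ j, lam j n / n ≤ η / K n := by
  rw [eventually_all]
  intro j
  filter_upwards [(hlam j).bound hη, eventually_gt_atTop 0, hKtop.eventually_gt_atTop 0]
    with n hn hn0 hK0
  have hn' : (0 : ℝ) < n := by exact_mod_cast hn0
  have hK' : (0 : ℝ) < K n := by exact_mod_cast hK0
  rw [Real.norm_of_nonneg (by positivity : (0 : ℝ) ≤ n * (K n : ℝ)⁻¹)] at hn
  rw [div_le_iff₀ hn']
  refine (Real.le_norm_self _).trans (hn.trans (le_of_eq ?_))
  ring

lemma exists_lipschitz (hf : ∀ j, ContDiffOn ℝ ((p + 1 : ℕ) : WithTop ℕ∞) (f j) (Icc 0 1)) :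
    ∃ L : NNReal, ∀ j, LipschitzOnWith L (f j) (Icc 0 1) := by
  have h : ∀ j, ∃ L : NNReal, LipschitzOnWith L (f j) (Icc 0 1) := fun j =>
    (((hf j).of_le (by exact_mod_cast Nat.le_add_left 1 p)).locallyLipschitzOn
      (convex_Icc 0 1)).exists_lipschitzOnWith_of_compact isCompact_Icc
  choose L hL using h
  exact ⟨max (L 0) (L 1), fun j => by
    fin_cases j
    exacts [(hL 0).weaken (le_max_left _ _), (hL 1).weaken (le_max_right _ _)]⟩

/-- With high probability the conditional moments of the estimators have the expansion of the
theorem. -/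
lemma IsAdditiveModel.exists_hasExpansion (hmodel : IsAdditiveModel P X ξ f q s2)
    (hq : BddPos q) (hs2 : BddPos s2) (hm : 1 ≤ m)
    (hf : ∀ j, ContDiffOn ℝ ((p + 1 : ℕ) : WithTop ℕ∞) (f j) (Icc 0 1))
    (hKtop : Tendsto K atTop atTop) (hK : Tendsto (fun n => (K n : ℝ) ^ 2 / n) atTop (𝓝 0))
    (hlam0 : ∀ j n, 0 ≤ lam j n) (hlam : ∀ j, lam j =o[atTop] fun n => (n : ℝ) * (K n : ℝ)⁻¹)
    {b0 : (n : ℕ) → (Fin n → ℝ × ℝ) → Fin (K n + p) → ℝ}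
    (hb0 : IsBigOP P (fun n ω => (1 / (n : ℝ)) * ∑ i : Fin n,
        bvec p (K n) (X i ω).2 ⬝ᵥ b0 n (fun i : Fin n => X i ω)) (fun n => (K n : ℝ)⁻¹))
    {t : Fin 2 → ℝ} (ht : ∀ j, t j ∈ Ioo (0 : ℝ) 1) {δ : ℝ} (hδ : 0 < δ) :
    ∃ C : ℝ, 0 < C ∧ ∀ η : ℝ, 0 < η → ∀ᶠ n in atTop,
      P {ω | ¬ HasExpansion P X ξ f q s2 p m K lam b0 t C η n ω} ≤ ENNReal.ofReal δ := by
  have hX := hmodel.measurable_X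
  have hμ : ∀ i, P.map (X i) = designLaw q := hmodel.law_X
  have hind := hmodel.indep_X
  have := isProbabilityMeasure_designLaw hX hμ
  obtain ⟨L, hL⟩ := exists_lipschitz hf
  obtain ⟨ε₀, θ, hε₀, hθ, hexp⟩ := exists_expansion hq hs2 p hm hL
  have hδ4 : 0 < δ / 4 := by positivity
  obtain ⟨M₁, hM₁, hgm₁⟩ := eventually_measure_goodMoments hX hμ hind hq BddPos.one p hKtop hK hθ
    hδ4
  obtain ⟨M₂, hM₂, hgm₂⟩ := eventually_measure_goodMoments hX hμ hind hq hs2 p hKtop hK hθ hδ4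
  obtain ⟨M₃, hM₃⟩ := hb0 (δ / 4) hδ4
  -- One level above all thresholds; M₃ may be negative, and the bound for the mean of f_2 asks for
  -- M ≥ 1.
  set M := M₁ + M₂ + |M₃| + 1 with hM
  have hM3 := abs_nonneg M₃
  obtain ⟨C, hC, hexpC⟩ := hexp M (by positivity)
  have hmean := eventually_measure_mean hX hμ hind (hL 1).continuousOn
    (by simpa [coord] using hmodel.centred 1 0) hK hKtop hδ4 (M := M) (by linarith)
  -- C depends on δ through M but not on η. This order of quantifiers is what later gives o_P for
  -- the variance.
  refine ⟨C, hC, fun η hη => ?_⟩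
  have hε : 0 < min η ε₀ := lt_min hη hε₀
  have hsq : ∀ᵐ ω ∂P, ∀ i, X i ω ∈ unitSquare := ae_all_iff.2 fun i => by
    refine ae_of_ae_map (hX i).aemeasurable ?_
    rw [hμ i]; exact ae_mem_unitSquare q
  filter_upwards [hgm₁ M (by linarith) _ hε, hgm₂ M (by linarith) _ hε, hM₃, hmean,
    eventually_lam_div_le hKtop hlam hε, eventually_sq_le hKtop hK]
    with n h₁ h₂ h₃ h₄ hlamn ⟨hn0, hK0, _⟩
  have hK' : (0 : ℝ) < K n := by exact_mod_cast hK0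
  have hn' : (0 : ℝ) < n := by exact_mod_cast hn0
  have hcell : ∀ j, ∃ ν : ℕ, IsCell (K n) (t j) ν := fun j => by
    obtain ⟨ν, -, h5, h6⟩ := exists_cell hK0 (ht j)
    exact ⟨ν, h5, h6⟩
  choose ν hν using hcell
  -- Outside four bad events, and up to the null set where the conditional law of the errors
  -- misbehaves, the deterministic expansion applies. Outer measure suffices, so the bad set need
  -- not be measurable.
  refine (measure_mono_ae (t := {ω | ¬ GoodMoments p (K n) q (fun _ => 1) (min η ε₀) M θ (ν 0) (ν 1)
      (fun l : Fin n => X l ω)} ∪ ({ω | ¬ GoodMoments p (K n) q s2 (min η ε₀) M θ (ν 0) (ν 1)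
      (fun l : Fin n => X l ω)} ∪ ({ω | M₃ * |(K n : ℝ)⁻¹| < |(1 / (n : ℝ)) * ∑ i : Fin n,
        bvec p (K n) (X i ω).2 ⬝ᵥ b0 n (fun i : Fin n => X i ω)|} ∪
      {ω | (∀ l, X l ω ∈ unitSquare) ∧
        M / K n < |(1 / (n : ℝ)) * ∑ l : Fin n, f 1 (X l ω).2|}))) ?_).trans ?_
  · filter_upwards [hsq, hmodel.indep_ε, hmodel.memLp_ε, hmodel.mean_ε, hmodel.var_ε]
      with ω hω hi hL2 hm0 hv
    intro hbad
    by_contra hcon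
    refine hbad ?_
    change ω ∉ (_ ∪ (_ ∪ (_ ∪ _)) : Set Ω) at hcon
    simp only [Set.mem_union, Set.mem_ofPred_eq, not_or, not_and, not_lt, not_not] at hcon
    obtain ⟨g₁, g₂, g₃, g₄⟩ := hcon
    have g₃' : |(1 / (n : ℝ)) * ∑ i : Fin n,
        bvec p (K n) (X i ω).2 ⬝ᵥ b0 n (fun i : Fin n => X i ω)| ≤ M / K n := by
      refine g₃.trans ?_
      rw [abs_of_pos (inv_pos.2 hK'), ← div_eq_mul_inv]
      refine div_le_div_of_nonneg_right ?_ hK'.le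
      have := le_abs_self M₃
      linarith
    obtain ⟨hwp, μ, w, hrep, hbias, hvar, hcov⟩ := hexpC (min η ε₀) (K n) n (fun j => lam j n)
      (fun l : Fin n => X l ω) t ν (b0 n fun l : Fin n => X l ω) hε (min_le_right _ _) hK0 hn0
      (fun j => hlam0 j n) hlamn (fun l => hω l) ht hν g₁ g₂ (g₄ hω) g₃'
    have hest : ∀ j, estimator p m K lam f X b0 j (t j) n ω
        = fun e => μ j + w j ⬝ᵥ fun l : Fin n => e l := fun j => funext fun e => hrep _ j
    have hcv : ∀ j j', cov[estimator p m K lam f X b0 j (t j) n ω,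
        estimator p m K lam f X b0 j' (t j') n ω; errLaw P X ξ ω]
          = ∑ l : Fin n, s2 (X l ω) * w j l * w j' l := fun j j' => by
      rw [hest, hest, covariance_affine hi hL2]
      exact Finset.sum_congr rfl fun l _ => by rw [hv]
    have hmL : ∀ j, MemLp (estimator p m K lam f X b0 j (t j) n ω) 2 (errLaw P X ξ ω) := fun j => by
      rw [hest]; exact memLp_affine hL2 _ _
    refine ⟨hwp, hmL, fun j => ?_, fun j => ?_, ?_⟩
    · rw [hest, integral_affine hL2 hm0]; exact hbias j
    · rw [← covariance_self (hmL j).aemeasurable, hcv]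
      refine (hvar j).trans ?_
      gcongr
      exact min_le_left _ _
    · rw [hcv]; exact hcov
  · have e4 : ENNReal.ofReal δ = ENNReal.ofReal (δ / 4) + (ENNReal.ofReal (δ / 4)
        + (ENNReal.ofReal (δ / 4) + ENNReal.ofReal (δ / 4))) := by
      rw [← ENNReal.ofReal_add (by positivity) (by positivity),
        ← ENNReal.ofReal_add (by positivity) (by positivity),
        ← ENNReal.ofReal_add (by positivity) (by positivity)]
      congr 1; ring
    rw [e4]
    exact (measure_union_le _ _).trans (add_le_add (h₁ _ _) ((measure_union_le _ _).trans
      (add_le_add (h₂ _ _) ((measure_union_le _ _).trans (add_le_add h₃ h₄)))))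

end Model

lemma tendsto_measure_of_forall_ofReal {Ω : Type*} [MeasurableSpace Ω] {P : Measure Ω}
    {s : ℕ → Set Ω}
    (h : ∀ δ : ℝ, 0 < δ → ∀ᶠ n in atTop, P (s n) ≤ ENNReal.ofReal δ) :
    Tendsto (fun n => P (s n)) atTop (𝓝 0) := by
  rw [ENNReal.tendsto_nhds_zero]
  intro ε hε
  rcases eq_or_ne ε ⊤ with rfl | htop
  · exact Eventually.of_forall fun _ => le_top
  · filter_upwards [h ε.toReal (ENNReal.toReal_pos hε.ne' htop)] with n hn
    rwa [ENNReal.ofReal_toReal htop] at hn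

end AddSpline

end

/-! ### From the expansion on good designs to the stochastic orders. -/

theorem theorem1 {Ω : Type*} [MeasurableSpace Ω] (P : Measure Ω) [IsProbabilityMeasure P]
    (X : ℕ → Ω → ℝ × ℝ) (ε : ℕ → Ω → ℝ) (f : Fin 2 → ℝ → ℝ) (q s2 : ℝ × ℝ → ℝ)
    (hmodel : AddSpline.IsAdditiveModel P X ε f q s2)
    (hq : AddSpline.BddPos q) (hs2 : AddSpline.BddPos s2)
    (p m : ℕ) (hm : 1 ≤ m)
    (hf : ∀ j, ContDiffOn ℝ ((p + 1 : ℕ) : WithTop ℕ∞) (f j) (Icc 0 1))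
    (K : ℕ → ℕ) (γ : ℝ) (hγ0 : 0 < γ) (hγ : γ < 1 / 2)
    (hKtop : Tendsto K atTop atTop)
    (hK : (fun n => (K n : ℝ)) =O[atTop] fun n => (n : ℝ) ^ γ)
    (lam : Fin 2 → ℕ → ℝ) (hlam0 : ∀ j n, 0 ≤ lam j n)
    (hlam : ∀ j, lam j =o[atTop] fun n => (n : ℝ) * (K n : ℝ)⁻¹)
    (bstar : Fin 2 → (n : ℕ) → Fin (K n + p) → ℝ)
    (hbstar : ∀ j n, AddSpline.IsBestApprox p (K n) (f j) (bstar j n))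
    (b0 : (n : ℕ) → (Fin n → ℝ × ℝ) → Fin (K n + p) → ℝ)
    (hb0 : AddSpline.IsBigOP P
      (fun n ω => (1 / (n : ℝ)) * ∑ i : Fin n,
        AddSpline.bvec p (K n) (X i ω).2 ⬝ᵥ b0 n (fun i : Fin n => X i ω))
      (fun n => (K n : ℝ)⁻¹))
    (x : Fin 2 → ℝ) (hx : ∀ j, x j ∈ Ioo (0 : ℝ) 1) :
    -- the estimators, their conditional moments and the leading terms are well defined
    (∀ j, ∀ᶠ n in atTop, IsUnit (AddSpline.gram p (K n) q j).det) ∧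
    Tendsto (fun n => P {ω | ¬ (AddSpline.WellPosed p m (K n) (fun j => lam j n)
        (fun i : Fin n => X i ω) ∧
      ∀ j, MemLp (AddSpline.estimator p m K lam f X b0 j (x j) n ω) 2
        (AddSpline.errLaw P X ε ω))}) atTop (𝓝 0) ∧
    -- bias
    (∀ j, ∃ R₁ R₂ : ℕ → Ω → ℝ,
      (∀ n ω, ∫ e, AddSpline.estimator p m K lam f X b0 j (x j) n ω e ∂(AddSpline.errLaw P X ε ω)
        = f j (x j) + AddSpline.biasLam p m (K n) n (lam j n) q j (bstar j n) (x j)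
          + R₁ n ω + R₂ n ω) ∧
      AddSpline.IsBigOP P R₁ (fun n => (K n : ℝ)⁻¹) ∧
      AddSpline.IsLittleOP P R₂ (fun n => lam j n * (K n : ℝ) * (n : ℝ)⁻¹)) ∧
    -- variances
    (∀ j, ∃ ρ : ℕ → Ω → ℝ,
      (∀ᶠ n in atTop, ∀ ω,
        Var[AddSpline.estimator p m K lam f X b0 j (x j) n ω; AddSpline.errLaw P X ε ω]
          = AddSpline.leadVar p (K n) n q s2 j (x j) * (1 + ρ n ω)) ∧
      AddSpline.IsLittleOP P ρ (fun _ => 1)) ∧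
    -- covariance
    AddSpline.IsBigOP P
      (fun n ω => cov[AddSpline.estimator p m K lam f X b0 0 (x 0) n ω,
        AddSpline.estimator p m K lam f X b0 1 (x 1) n ω; AddSpline.errLaw P X ε ω])
      (fun n => (n : ℝ)⁻¹) := by
  have hprob := AddSpline.isProbabilityMeasure_designLaw hmodel.measurable_X hmodel.law_X
  have hK2 := AddSpline.tendsto_sq_div hγ hK
  have hpos := AddSpline.eventually_sq_le hKtop hK2
  have hexp := fun δ (hδ : 0 < δ) =>
    hmodel.exists_hasExpansion hq hs2 hm hf hKtop hK2 hlam0 hlam hb0 hx (δ := δ) hδ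
  obtain ⟨c, _, hc, _, hgram⟩ := AddSpline.exists_gram_bound hq hs2 p
  obtain ⟨L, hL⟩ := AddSpline.exists_lipschitz hf
  refine ⟨fun j => ?_, ?_, fun j => ?_, fun j => ?_, fun δ hδ => ?_⟩
  · filter_upwards [hpos] with n hn using (hgram (K n) hn.2.1 j).1
  · refine AddSpline.tendsto_measure_of_forall_ofReal fun δ hδ => ?_
    obtain ⟨C, -, hC⟩ := hexp δ hδ
    filter_upwards [hC 1 one_pos] with n hn
    refine (measure_mono fun ω hω h => ?_).trans hn
    exact hω ⟨h.wellPosed, h.memLp⟩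
  · obtain ⟨Cb, hCb, hbl⟩ := AddSpline.exists_abs_biasLam_le hq p hm (hL j)
    -- The mean error and the leading bias are both O(1/K), so their difference goes entirely into
    -- the first remainder and the second is taken to be zero.
    refine ⟨fun n ω => ∫ e, AddSpline.estimator p m K lam f X b0 j (x j) n ω e
        ∂(AddSpline.errLaw P X ε ω) - f j (x j)
          - AddSpline.biasLam p m (K n) n (lam j n) q j (bstar j n) (x j),
      fun _ _ => 0, fun n ω => by ring, fun δ hδ => ?_, fun η hη => ?_⟩
    · obtain ⟨C, -, hC⟩ := hexp δ hδ
      refine ⟨C + Cb, ?_⟩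
      filter_upwards [hC 1 one_pos, hpos, AddSpline.eventually_lam_div_le hKtop hlam one_pos]
        with n hn hn0 hln
      refine (measure_mono fun ω hω h => ?_).trans hn
      have hK' : (0 : ℝ) < K n := by exact_mod_cast hn0.2.1
      have h1 := hbl (K n) n (lam j n) (x j) j (bstar j n) hn0.2.1 (hlam0 j n) (hln j) (hx j)
        (hbstar j n)
      have h2 := (abs_sub _ _).trans (add_le_add (h.mean j) h1)
      rw [Set.mem_ofPred_eq, abs_of_pos (inv_pos.2 hK'), ← div_eq_mul_inv, add_div] at hω
      exact absurd h2 (not_le.2 hω)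
    · have h0 : ∀ n, {ω : Ω | η * |lam j n * (K n : ℝ) * (n : ℝ)⁻¹| < |(0 : ℝ)|} = ∅ := fun n => by
        ext ω
        simp only [Set.mem_ofPred_eq, abs_zero, Set.mem_empty_iff_false, iff_false, not_lt]
        positivity
      simp only [h0, measure_empty]
      exact tendsto_const_nhds
  · have hlead : ∀ᶠ n in atTop, c * (K n / n) ≤ AddSpline.leadVar p (K n) n q s2 j (x j) ∧
        0 < AddSpline.leadVar p (K n) n q s2 j (x j) := by
      filter_upwards [hpos] with n hn
      have h1 := (((hgram (K n) hn.2.1 j).2 (x j) (hx j)).2.2 n).2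
      have hK' : (0 : ℝ) < K n := by exact_mod_cast hn.2.1
      have hn' : (0 : ℝ) < n := by exact_mod_cast hn.1
      exact ⟨h1, lt_of_lt_of_le (by positivity) h1⟩
    refine ⟨fun n ω => Var[AddSpline.estimator p m K lam f X b0 j (x j) n ω;
        AddSpline.errLaw P X ε ω] / AddSpline.leadVar p (K n) n q s2 j (x j) - 1, ?_, fun η hη => ?_⟩
    · filter_upwards [hlead] with n hn ω
      rw [add_sub_cancel, mul_div_cancel₀ _ hn.2.ne']
    · refine AddSpline.tendsto_measure_of_forall_ofReal fun δ hδ => ?_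
      obtain ⟨C, hC0, hC⟩ := hexp δ hδ
      -- Chosen so that, once 1/√K ≤ η', the variance error 2Cη'K/n equals η times the lower bound
      -- cK/n of the leading variance.
      set η' : ℝ := η * c / (2 * C) with hη'
      have hη'0 : 0 < η' := by positivity
      have hsqrt : ∀ᶠ n in atTop, 1 / √(K n : ℝ) ≤ η' := by
        have h1 : Tendsto (fun n => 1 / √(K n : ℝ)) atTop (𝓝 0) := by
          simp only [one_div]
          exact tendsto_inv_atTop_zero.comp (Real.tendsto_sqrt_atTop.comp
            ((tendsto_natCast_atTop_atTop (R := ℝ)).comp hKtop))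
        exact h1.eventually_le_const hη'0
      filter_upwards [hC η' hη'0, hlead, hsqrt, hpos] with n hn hl hsq hn0
      refine (measure_mono fun ω hω h => ?_).trans hn
      have hK' : (0 : ℝ) < K n := by exact_mod_cast hn0.2.1
      have hn' : (0 : ℝ) < n := by exact_mod_cast hn0.1
      rw [Set.mem_ofPred_eq, abs_one, mul_one, div_sub_one hl.2.ne', abs_div, abs_of_pos hl.2,
        lt_div_iff₀ hl.2] at hω
      have h2 : C * (η' + 1 / √(K n : ℝ)) * (K n / n) ≤ C * (η' + η') * (K n / n) := by gcongr
      have h3 : C * (η' + η') * (K n / n) = η * (c * (K n / n)) := by rw [hη']; field_simp; ring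
      have h4 := mul_le_mul_of_nonneg_left hl.1 hη.le
      have h5 := h.variance j
      linarith
  · obtain ⟨C, -, hC⟩ := hexp δ hδ
    refine ⟨C, ?_⟩
    filter_upwards [hC 1 one_pos, hpos] with n hn hn0
    refine (measure_mono fun ω hω h => ?_).trans hn
    have hn' : (0 : ℝ) < n := by exact_mod_cast hn0.1
    rw [Set.mem_ofPred_eq, abs_of_pos (inv_pos.2 hn'), ← div_eq_mul_inv] at hω
    exact absurd h.cov (not_le.2 hω)
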